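/- Let $\mathbb{P}^1$ be the monoid projective line: the space with points $0,\infty,\eta$, nonempty open sets those containing $\eta$, and structure sheaf of commutative monoids with zero with sections $\langle t\rangle=\{0,1,t,t^2,\dots\}$ on $U_0=\{0,\eta\}$, $\langle t^{-1}\rangle$ on $U_\infty=\{\infty,\eta\}$ and $\langle t,t^{-1}\rangle$ on $\{\eta\}=U_0\cap U_\infty$. Let $Coh_n(\mathbb{P}^1)$ be the category of normal coherent sheaves on $\mathbb{P}^1$: sheaves $\mathcal F$ of pointed sets with an action of $\mathcal{O}$ which on each affine open set $U$ are associated with a finitely generated $\mathcal{O}(U)$-module on which each scalar acts injectively away from the preimage of the base point; morphisms are morphisms of sheaves of modules which on each affine open set are injective away from the preimage of the base point. Direct sums $\oplus$ are (sheafified) wedges of pointed sets, and $\mathcal F/\mathcal F'$ is the (sheafified) quotient collapsing $\mathcal F'$ to the base point. Let $H$ be the complex vector space of finitely supported functions $f:\mathrm{Iso}(Coh_n(\mathbb{P}^1))\to\mathbb{C}$. (1) For $f,g\in H$ and every $\mathcal{F}$ the sum $$(f\star g)(\mathcal F)=\sum_{\mathcal F'\subset\mathcal F} f(\mathcal F/\mathcal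 F')\,g(\mathcal F')$$ over the coherent subsheaves of $\mathcal F$ has only finitely many nonzero terms and defines an element $f\star g\in H$. The product $\star$ is bilinear and associative. (2) The formula $\Delta(f)(\mathcal F,\mathcal F')=f(\mathcal F\oplus\mathcal F')$ defines a linear map $\Delta:H\to H\otimes H$, where $H\otimes H$ is identified with the finitely supported functions on pairs of isomorphism classes. It is coassociative, $(\Delta\otimes\mathrm{Id})\circ\Delta=(\mathrm{Id}\otimes\Delta)\circ\Delta$, and compatible with $\star$: $\Delta(f\star g)=\Delta(f)\star\Delta(g)$, with the componentwise product on $H\otimes H$. (3) Consequently, with unit $\delta_0$ (the delta function at the class of the zero sheaf) and counit $f\mapsto f(0)$, $H$ is a cocommutative bialgebra over $\mathbb{C}$. Let $K_0$ be the quotient of the free abelian group on $\mathrm{Iso}(Coh_n(\mathbb{P}^1))$ by the relations $[\mathcal F']+[\mathcal F'']-[\mathcal F]$ for the short exact sequences $0\to\mathcal F'\to\mathcal F\to\mathcal F''\to0$ in $Coh_n(\mathbb{P}^1)$, and let $K_0^+\subset K_0$ be the submonoid generated by the classes of sheaves. Putting $\deg\delta_{\mathcal F}=[\mathcal F]$ makes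 $H$ a $K_0^+$-graded bialgebra (product, unit, coproduct and counit respect the grading) which is connected: its component of degree $0$ is $\mathbb{C}\,\delta_0$. -/

import Mathlib

open scoped TensorProduct

namespace HallP1

open TopologicalSpace

/-! ### Modules over a commutative monoid with zero

A module over a commutative monoid with zero `A` is a pointed set `M` with an action of `A`
such that `1 • m = m`, `(a * b) • m = a • b • m`, `0 • m = 0` (where `0 : M` is the base point);
this is Mathlib's `MulActionWithZero A M`. -/

section Modules

variable {A : Type*} [MonoidWithZero A] {M N : Type*} [Zero M] [MulActionWithZero A M]
  [Zero N] [MulActionWithZero A N]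

/-- A map of pointed sets which is injective away from the preimage of the base point,
i.e. a morphism of vector spaces over the field with one element. -/
def IsNormalMap {M N : Type*} [Zero N] (f : M → N) : Prop :=
  ∀ m m' : M, f m ≠ 0 → f m = f m' → m = m'

/-- A module is normal if multiplication by each scalar is a normal map. -/
def IsNormalModule (A M : Type*) [MonoidWithZero A] [Zero M] [MulActionWithZero A M] : Prop :=
  ∀ a : A, IsNormalMap (fun m : M => a • m)

/-- Finitely generated: every element is a multiple of one of finitely many generators. -/
def IsFG (A M : Type*) [MonoidWithZero A] [Zero M] [MulActionWithZero A M] : Prop :=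
  ∃ G : Finset M, ∀ m : M, ∃ a : A, ∃ g ∈ G, m = a • g

/-- The direct sum `M ⊕ N` of two pointed sets: the wedge `M ∨ N`, i.e. the disjoint union with
base points identified, realised as the union of the two axes in `M × N`. -/
def Wedge (M N : Type*) [Zero M] [Zero N] : Type _ :=
  {p : M × N // p.1 = 0 ∨ p.2 = 0}

instance : Zero (Wedge M N) := ⟨⟨0, Or.inl rfl⟩⟩

instance : MulActionWithZero A (Wedge M N) where
  smul a p := ⟨(a • p.1.1, a • p.1.2), by
    rcases p.2 with h | h
    · left; simp [h]
    · right; simp [h]⟩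
  one_smul p := Subtype.ext (Prod.ext (one_smul A _) (one_smul A _))
  mul_smul a b p := Subtype.ext (Prod.ext (mul_smul a b _) (mul_smul a b _))
  smul_zero a := Subtype.ext (Prod.ext (smul_zero a) (smul_zero a))
  zero_smul p := Subtype.ext (Prod.ext (zero_smul A _) (zero_smul A _))

/-- The equivalence relation that collapses a subset to a point. -/
def collapse {X : Type*} (S : Set X) : Setoid X where
  r m m' := m = m' ∨ (m ∈ S ∧ m' ∈ S)
  iseqv :=
    { refl := fun _ => Or.inl rfl
      symm := by
        rintro m m' (h | h)
        · exact Or.inl h.symm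
        · exact Or.inr h.symm
      trans := by
        rintro m m' m'' (rfl | h) (rfl | h')
        · exact Or.inl rfl
        · exact Or.inr h'
        · exact Or.inr h
        · exact Or.inr ⟨h.1, h'.2⟩ }

/-- The quotient `M / S`, obtained by collapsing a submodule `S` to the base point. -/
def CollapseQuot (S : Set M) : Type _ := Quotient (collapse S)

/-- The quotient map. -/
def CollapseQuot.mk (S : Set M) (m : M) : CollapseQuot S := Quotient.mk (collapse S) m

instance (S : Set M) : Zero (CollapseQuot S) := ⟨CollapseQuot.mk S 0⟩

theorem CollapseQuot.mk_eq {X : Type*} {S : Set X} {m m' : X} :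
    CollapseQuot.mk S m = CollapseQuot.mk S m' ↔ m = m' ∨ (m ∈ S ∧ m' ∈ S) :=
  ⟨fun h => Quotient.exact h, fun h => Quotient.sound h⟩

theorem CollapseQuot.exists_rep {X : Type*} {S : Set X} (q : CollapseQuot S) :
    ∃ m, CollapseQuot.mk S m = q := Quotient.exists_rep q

/-- The map induced on quotients by a map sending `S` to `T`. -/
def CollapseQuot.map {S : Set M} {T : Set N} (f : M → N) (h : ∀ m ∈ S, f m ∈ T) :
    CollapseQuot S → CollapseQuot T :=
  Quotient.map f (by
    rintro m m' (rfl | h')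
    · exact Or.inl rfl
    · exact Or.inr ⟨h _ h'.1, h _ h'.2⟩)

/-- The module structure on the quotient by a submodule. -/
@[reducible] def CollapseQuot.action (S : Set M) (hS : ∀ (a : A), ∀ m ∈ S, a • m ∈ S) :
    MulActionWithZero A (CollapseQuot S) where
  smul a := CollapseQuot.map (fun m => a • m) (hS a)
  one_smul := by
    rintro ⟨m⟩
    exact congrArg (CollapseQuot.mk S) (one_smul A m)
  mul_smul := by
    rintro a b ⟨m⟩
    exact congrArg (CollapseQuot.mk S) (mul_smul a b m)
  smul_zero a := congrArg (CollapseQuot.mk S) (smul_zero a)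
  zero_smul := by
    rintro ⟨m⟩
    exact congrArg (CollapseQuot.mk S) (zero_smul A m)

end Modules

/-! ### The monoid projective line -/

/-- The three points `0`, `∞`, `η` of the monoid projective line. -/
inductive P1 : Type
  | zero
  | infty
  | eta

/-- A set of points is open iff it is empty or contains the generic point. -/
instance : TopologicalSpace P1 where
  IsOpen U := U.Nonempty → P1.eta ∈ U
  isOpen_univ := fun _ => trivial
  isOpen_inter := fun _ _ hs ht h =>
    ⟨hs (h.mono Set.inter_subset_left), ht (h.mono Set.inter_subset_right)⟩
  isOpen_sUnion := by
    rintro S hS ⟨x, s, hs, hx⟩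
    exact ⟨s, hs, hS s hs ⟨x, hx⟩⟩

/-- The monoid `⟨t, t⁻¹⟩ = {0} ∪ {tⁿ | n ∈ ℤ}`. -/
abbrev K : Type := WithZero (Multiplicative ℤ)

/-- The coordinate `t`. -/
def t : K := ((Multiplicative.ofAdd (1 : ℤ) : Multiplicative ℤ) : K)

/-- The stalks of the structure sheaf, inside `⟨t, t⁻¹⟩`: `⟨t⟩` at `0`, `⟨t⁻¹⟩` at `∞` and
`⟨t, t⁻¹⟩` at `η`. -/
def stalk : P1 → Set K
  | .zero => {a | a = 0 ∨ ∃ n : ℕ, a = t ^ n}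
  | .infty => {a | a = 0 ∨ ∃ n : ℕ, a = t⁻¹ ^ n}
  | .eta => Set.univ

theorem zero_mem_stalk (x : P1) : (0 : K) ∈ stalk x := by
  cases x
  · exact Or.inl rfl
  · exact Or.inl rfl
  · trivial

theorem one_mem_stalk (x : P1) : (1 : K) ∈ stalk x := by
  cases x
  · exact Or.inr ⟨0, (pow_zero _).symm⟩
  · exact Or.inr ⟨0, (pow_zero _).symm⟩
  · trivial

theorem mul_mem_stalk (x : P1) {a b : K} (ha : a ∈ stalk x) (hb : b ∈ stalk x) :
    a * b ∈ stalk x := by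
  cases x
  · rcases ha with rfl | ⟨n, rfl⟩
    · exact Or.inl (zero_mul _)
    · rcases hb with rfl | ⟨m, rfl⟩
      · exact Or.inl (mul_zero _)
      · exact Or.inr ⟨n + m, (pow_add _ _ _).symm⟩
  · rcases ha with rfl | ⟨n, rfl⟩
    · exact Or.inl (zero_mul _)
    · rcases hb with rfl | ⟨m, rfl⟩
      · exact Or.inl (mul_zero _)
      · exact Or.inr ⟨n + m, (pow_add _ _ _).symm⟩
  · trivial

/-- The structure sheaf: `𝒪(U)` is the monoid of constant functions `U → ⟨t, t⁻¹⟩` with value in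
the stalk at each point of `U`. Thus `𝒪(U₀) = ⟨t⟩`, `𝒪(U_∞) = ⟨t⁻¹⟩`,
`𝒪(U₀ ∩ U_∞) = ⟨t, t⁻¹⟩`, `𝒪(P¹) = {0, 1}`, and `𝒪(∅)` is the one-element monoid. -/
def O (U : Opens P1) : Submonoid (U → K) where
  carrier := {s | (∀ x, s x ∈ stalk x.1) ∧ ∀ x y, s x = s y}
  one_mem' := ⟨fun x => one_mem_stalk x.1, fun _ _ => rfl⟩
  mul_mem' := fun {a b} ha hb =>
    ⟨fun x => mul_mem_stalk x.1 (ha.1 x) (hb.1 x), fun x y => by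
      change a x * b x = a y * b y
      rw [ha.2 x y, hb.2 x y]⟩

instance (U : Opens P1) : CommMonoidWithZero (O U) :=
  { (inferInstance : CommMonoid (O U)) with
    zero := ⟨0, fun x => zero_mem_stalk x.1, fun _ _ => rfl⟩
    zero_mul := fun a => Subtype.ext (zero_mul a.1)
    mul_zero := fun a => Subtype.ext (mul_zero a.1) }

/-- Restriction of sections of the structure sheaf. -/
def O.res {U V : Opens P1} (h : U ≤ V) (a : O V) : O U :=
  ⟨fun x => a.1 ⟨x.1, h x.2⟩, fun x => a.2.1 ⟨x.1, h x.2⟩,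
    fun x y => a.2.2 ⟨x.1, h x.2⟩ ⟨y.1, h y.2⟩⟩

/-- The smallest open neighbourhood `{x, η}` of a point: `U₀`, `U_∞` and `U₀ ∩ U_∞ = {η}` for
`x = 0, ∞, η`. These are precisely the nonempty affine open subsets of `P¹`, and for each sheaf
the sections over `nb x` are the stalk at `x`. -/
def nb (x : P1) : Opens P1 := ⟨{y | y = x ∨ y = P1.eta}, fun _ => Or.inr rfl⟩

theorem mem_nb (x : P1) : x ∈ nb x := Or.inl rfl

theorem eta_mem {x : P1} {U : Opens P1} (h : x ∈ U) : P1.eta ∈ U := U.2 ⟨x, h⟩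

theorem nb_le {x : P1} {U : Opens P1} (h : x ∈ U) : nb x ≤ U := by
  rintro y (rfl | rfl)
  · exact h
  · exact eta_mem h

theorem nb_eta_le (x : P1) : nb .eta ≤ nb x := nb_le (Or.inr rfl)

/-! ### Sheaves of modules on the projective line -/

/-- A presheaf of modules over the structure sheaf of `P¹`. -/
structure PMod where
  sec : Opens P1 → Type
  [zero : ∀ U, Zero (sec U)]
  [act : ∀ U, MulActionWithZero (O U) (sec U)]
  res : ∀ {U V : Opens P1}, U ≤ V → sec V → sec U
  res_self : ∀ {U : Opens P1} (s : sec U), res (le_refl U) s = s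
  res_res : ∀ {U V W : Opens P1} (h : U ≤ V) (h' : V ≤ W) (s : sec W),
    res h (res h' s) = res (h.trans h') s
  res_zero : ∀ {U V : Opens P1} (h : U ≤ V), res h (0 : sec V) = 0
  res_smul : ∀ {U V : Opens P1} (h : U ≤ V) (a : O V) (s : sec V),
    res h (a • s) = O.res h a • res h s

attribute [instance] PMod.zero PMod.act

namespace PMod

/-- The sheaf condition (unique gluing). -/
def IsSheaf (F : PMod) : Prop :=
  ∀ (ι : Type) (U : ι → Opens P1) (s : ∀ i, F.sec (U i)),
    (∀ i j, F.res (inf_le_left : U i ⊓ U j ≤ U i) (s i) =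
      F.res (inf_le_right : U i ⊓ U j ≤ U j) (s j)) →
    ∃! r : F.sec (⨆ i, U i), ∀ i, F.res (le_iSup U i) r = s i

/-- Coherence. On each affine open `U = nb x`, the sheaf is associated with a finitely generated
`𝒪(U)`-module, which then has to be `F(U)`. The only nonempty basic open subset of `U` other
than `U` is `{η}`, so this says that `F(U)` is finitely generated and that `F(η)` is the
localization of `F(U)` at the multiplicative set of nonzero elements of `𝒪(U)` (the powers of
`t` for `U = U₀`): each section over `η` is a fraction `m / a`, and `m / 1 = m' / 1` only if
`a m = a m'` for some denominator `a`. (Denominators act bijectively on `F(η)`, because they are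
invertible in `𝒪(η)`.) -/
structure IsCoherent (F : PMod) : Prop where
  fg : ∀ x : P1, IsFG (O (nb x)) (F.sec (nb x))
  surj : ∀ (x : P1) (y : F.sec (nb .eta)), ∃ a : O (nb x), a ≠ 0 ∧ ∃ m : F.sec (nb x),
    O.res (nb_eta_le x) a • y = F.res (nb_eta_le x) m
  inj : ∀ (x : P1) (m m' : F.sec (nb x)), F.res (nb_eta_le x) m = F.res (nb_eta_le x) m' →
    ∃ a : O (nb x), a ≠ 0 ∧ a • m = a • m'

/-- Normality: the sections over each affine open subset form a normal module. -/
def IsNormal (F : PMod) : Prop := ∀ x : P1, IsNormalModule (O (nb x)) (F.sec (nb x))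

/-- Morphisms of (pre)sheaves of modules. -/
@[ext] structure Hom (F G : PMod) where
  app : ∀ U : Opens P1, F.sec U → G.sec U
  app_zero : ∀ U, app U 0 = 0
  app_smul : ∀ U (a : O U) (s : F.sec U), app U (a • s) = a • app U s
  app_res : ∀ {U V : Opens P1} (h : U ≤ V) (s : F.sec V), app U (F.res h s) = G.res h (app V s)

/-- A morphism is normal if it is so over each affine open subset. -/
def Hom.IsNormal {F G : PMod} (φ : Hom F G) : Prop := ∀ x : P1, IsNormalMap (φ.app (nb x))

/-- Compatible families of germs at the points of `U`, the stalk at `x` being the module of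
sections over `nb x`. -/
def Germs (P : PMod) (U : Opens P1) : Type :=
  {s : ∀ x : U, P.sec (nb x.1) // ∀ (x y : U) (h : nb y.1 ≤ nb x.1), P.res h (s x) = s y}

instance (P : PMod) (U : Opens P1) : Zero (P.Germs U) := ⟨⟨fun _ => 0, fun _ _ h => P.res_zero h⟩⟩

instance (P : PMod) (U : Opens P1) : MulActionWithZero (O U) (P.Germs U) where
  smul a s := ⟨fun x => O.res (nb_le x.2) a • s.1 x, fun x y h => by
    rw [P.res_smul, s.2 x y h]; rfl⟩
  one_smul s := Subtype.ext (funext fun x => one_smul (O (nb x.1)) (s.1 x))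
  mul_smul a b s := Subtype.ext (funext fun x =>
    mul_smul (O.res (nb_le x.2) a) (O.res (nb_le x.2) b) (s.1 x))
  smul_zero a := Subtype.ext (funext fun x => smul_zero (O.res (nb_le x.2) a))
  zero_smul s := Subtype.ext (funext fun x => zero_smul (O (nb x.1)) (s.1 x))

/-- The sheaf associated with a presheaf: its sections over `U` are the compatible families
of germs at the points of `U`. -/
def sheafify (P : PMod) : PMod where
  sec U := P.Germs U
  res h s := ⟨fun x => s.1 ⟨x.1, h x.2⟩, fun x y => s.2 ⟨x.1, h x.2⟩ ⟨y.1, h y.2⟩⟩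
  res_self _ := rfl
  res_res _ _ _ := rfl
  res_zero _ := rfl
  res_smul _ _ _ := rfl

theorem sheafify_isSheaf (P : PMod) : P.sheafify.IsSheaf := by
  classical
  intro ι U (s : ∀ i, P.Germs (U i)) hs
  have hmem : ∀ x : (⨆ i, U i : Opens P1), ∃ i, x.1 ∈ U i := fun x => Opens.mem_iSup.1 x.2
  choose c hc using hmem
  have key : ∀ (i j : ι) (x : P1) (hi : x ∈ U i) (hj : x ∈ U j),
      (s i).1 ⟨x, hi⟩ = (s j).1 ⟨x, hj⟩ := fun i j x hi hj =>
    congrFun (congrArg Subtype.val (hs i j)) ⟨x, hi, hj⟩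
  refine ⟨(⟨fun x => (s (c x)).1 ⟨x.1, hc x⟩, ?_⟩ : P.Germs (⨆ i, U i)), ?_, ?_⟩
  · intro x y h
    have hy : y.1 ∈ U (c x) := nb_le (hc x) (h (mem_nb y.1))
    exact ((s (c x)).2 ⟨x.1, hc x⟩ ⟨y.1, hy⟩ h).trans (key _ _ _ _ _)
  · intro i
    exact Subtype.ext (funext fun x => key _ _ _ _ _)
  · intro r hr
    refine Subtype.ext (funext fun x => ?_)
    have := congrFun (congrArg Subtype.val (hr (c x))) ⟨x.1, hc x⟩
    exact this

/-- A section over `nb x` of the associated sheaf is determined by its germ at `x`. -/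
theorem sheafify_ext (P : PMod) {x : P1} {s s' : P.Germs (nb x)}
    (h : s.1 ⟨x, mem_nb x⟩ = s'.1 ⟨x, mem_nb x⟩) : s = s' := by
  refine Subtype.ext (funext fun y => ?_)
  rw [← s.2 ⟨x, mem_nb x⟩ y (nb_le y.2), h, s'.2 ⟨x, mem_nb x⟩ y (nb_le y.2)]

/-- The section over `nb x` of the associated sheaf with given germ at `x`. -/
def toSheafify (P : PMod) {x : P1} (m : P.sec (nb x)) : P.Germs (nb x) :=
  ⟨fun y => P.res (nb_le y.2) m, fun _ _ _ => P.res_res _ _ _⟩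

theorem toSheafify_germ (P : PMod) {x : P1} (m : P.sec (nb x)) :
    (P.toSheafify m).1 ⟨x, mem_nb x⟩ = m := P.res_self m

theorem sheafify_isNormal (P : PMod) (h : P.IsNormal) : P.sheafify.IsNormal := by
  intro x a (s : P.Germs (nb x)) (s' : P.Germs (nb x)) hne he
  refine P.sheafify_ext ?_
  refine h x a _ _ ?_ (congrFun (congrArg Subtype.val he) ⟨x, mem_nb x⟩)
  intro h0
  exact hne (P.sheafify_ext h0)

theorem sheafify_isCoherent (P : PMod) (h : P.IsCoherent) : P.sheafify.IsCoherent := by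
  classical
  refine ⟨fun x => ?_, fun x (y : P.Germs (nb .eta)) => ?_,
    fun x (m : P.Germs (nb x)) (m' : P.Germs (nb x)) he => ?_⟩
  · obtain ⟨G, hG⟩ := h.fg x
    refine ⟨(G.image P.toSheafify : Finset (P.Germs (nb x))), fun (m : P.Germs (nb x)) => ?_⟩
    obtain ⟨a, g, hg, hm⟩ := hG (m.1 ⟨x, mem_nb x⟩)
    refine ⟨a, P.toSheafify g, Finset.mem_image_of_mem _ hg, P.sheafify_ext ?_⟩
    rw [hm]
    exact (congrArg (fun z => a • z) (P.toSheafify_germ g)).symm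
  · obtain ⟨a, ha, m, hm⟩ := h.surj x (y.1 ⟨.eta, mem_nb _⟩)
    exact ⟨a, ha, P.toSheafify m, P.sheafify_ext hm⟩
  · have e : ∀ s : P.Germs (nb x), P.res (nb_eta_le x) (s.1 ⟨x, mem_nb x⟩) =
        s.1 ⟨.eta, nb_eta_le x (mem_nb _)⟩ := fun s =>
      s.2 ⟨x, mem_nb x⟩ ⟨.eta, nb_eta_le x (mem_nb _)⟩ (nb_eta_le x)
    have he' := congrFun (congrArg Subtype.val he) ⟨.eta, mem_nb _⟩
    obtain ⟨a, ha, hm⟩ := h.inj x (m.1 ⟨x, mem_nb x⟩) (m'.1 ⟨x, mem_nb x⟩)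
      ((e m).trans (he'.trans (e m').symm))
    exact ⟨a, ha, P.sheafify_ext hm⟩

/-- The presheaf direct sum. -/
def preSum (F G : PMod) : PMod where
  sec U := Wedge (F.sec U) (G.sec U)
  res h p := ⟨(F.res h p.1.1, G.res h p.1.2), by
    rcases p.2 with e | e
    · left; simp only [e, F.res_zero]
    · right; simp only [e, G.res_zero]⟩
  res_self p := Subtype.ext (Prod.ext (F.res_self _) (G.res_self _))
  res_res h h' p := Subtype.ext (Prod.ext (F.res_res h h' _) (G.res_res h h' _))
  res_zero h := Subtype.ext (Prod.ext (F.res_zero h) (G.res_zero h))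
  res_smul h a p := Subtype.ext (Prod.ext (F.res_smul h a _) (G.res_smul h a _))

theorem preSum_isNormal {F G : PMod} (hF : F.IsNormal) (hG : G.IsNormal) :
    (preSum F G).IsNormal := by
  rintro x a ⟨⟨m, n⟩, hmn⟩ ⟨⟨m', n'⟩, hmn'⟩ hne he
  have h1 : a • m = a • m' := congrArg (fun p => p.1.1) he
  have h2 : a • n = a • n' := congrArg (fun p => p.1.2) he
  simp only at hmn hmn'
  by_cases hm : a • m = 0
  · have hn : a • n ≠ 0 := fun hn => hne (Subtype.ext (Prod.ext hm hn))
    have hn0 : n ≠ 0 := by rintro rfl; exact hn (smul_zero a)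
    have hn0' : n' ≠ 0 := by rintro rfl; exact hn (h2.trans (smul_zero a))
    have e1 : m = 0 := hmn.resolve_right hn0
    have e2 : m' = 0 := hmn'.resolve_right hn0'
    exact Subtype.ext (Prod.ext (e1.trans e2.symm) (hG x a n n' hn h2))
  · have hm0 : m ≠ 0 := by rintro rfl; exact hm (smul_zero a)
    have hm0' : m' ≠ 0 := by rintro rfl; exact hm (h1.trans (smul_zero a))
    have e1 : n = 0 := hmn.resolve_left hm0
    have e2 : n' = 0 := hmn'.resolve_left hm0'
    exact Subtype.ext (Prod.ext (hF x a m m' hm h1) (e1.trans e2.symm))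

theorem O_mul_ne_zero {x : P1} {a b : O (nb x)} (ha : a ≠ 0) (hb : b ≠ 0) : a * b ≠ 0 := by
  intro h
  have hx := congrFun (congrArg Subtype.val h) ⟨x, mem_nb x⟩
  have hx' : a.1 ⟨x, mem_nb x⟩ * b.1 ⟨x, mem_nb x⟩ = 0 := hx
  rcases mul_eq_zero.1 hx' with h0 | h0
  · exact ha (Subtype.ext (funext fun y => (a.2.2 y ⟨x, mem_nb x⟩).trans h0))
  · exact hb (Subtype.ext (funext fun y => (b.2.2 y ⟨x, mem_nb x⟩).trans h0))

theorem preSum_isCoherent {F G : PMod} (hF : F.IsCoherent) (hG : G.IsCoherent) :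
    (preSum F G).IsCoherent := by
  classical
  refine ⟨fun x => ?_, ?_, ?_⟩
  · obtain ⟨A, hA⟩ := hF.fg x
    obtain ⟨B, hB⟩ := hG.fg x
    let i : F.sec (nb x) → Wedge (F.sec (nb x)) (G.sec (nb x)) := fun m => ⟨(m, 0), Or.inr rfl⟩
    let j : G.sec (nb x) → Wedge (F.sec (nb x)) (G.sec (nb x)) := fun m => ⟨(0, m), Or.inl rfl⟩
    refine ⟨A.image i ∪ B.image j, ?_⟩
    rintro ⟨⟨m, n⟩, (h : m = 0) | (h : n = 0)⟩
    · subst h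
      obtain ⟨a, g, hg, e⟩ := hB n
      exact ⟨a, j g, Finset.mem_union_right _ (Finset.mem_image_of_mem _ hg),
        Subtype.ext (Prod.ext (smul_zero a).symm e)⟩
    · subst h
      obtain ⟨a, g, hg, e⟩ := hA m
      exact ⟨a, i g, Finset.mem_union_left _ (Finset.mem_image_of_mem _ hg),
        Subtype.ext (Prod.ext e (smul_zero a).symm)⟩
  · rintro x ⟨⟨m, n⟩, (h : m = 0) | (h : n = 0)⟩
    · subst h
      obtain ⟨a, ha, k, hk⟩ := hG.surj x n
      exact ⟨a, ha, ⟨(0, k), Or.inl rfl⟩,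
        Subtype.ext (Prod.ext ((smul_zero _).trans (F.res_zero _).symm) hk)⟩
    · subst h
      obtain ⟨a, ha, k, hk⟩ := hF.surj x m
      exact ⟨a, ha, ⟨(k, 0), Or.inr rfl⟩,
        Subtype.ext (Prod.ext hk ((smul_zero _).trans (G.res_zero _).symm))⟩
  · rintro x ⟨⟨m, n⟩, hp⟩ ⟨⟨m', n'⟩, hp'⟩ he
    obtain ⟨a, ha, ea⟩ := hF.inj x m m' (congrArg (fun p => p.1.1) he)
    obtain ⟨b, hb, eb⟩ := hG.inj x n n' (congrArg (fun p => p.1.2) he)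
    refine ⟨a * b, O_mul_ne_zero ha hb, Subtype.ext (Prod.ext ?_ ?_)⟩
    · change (a * b) • m = (a * b) • m'
      rw [mul_comm, mul_smul, mul_smul, ea]
    · change (a * b) • n = (a * b) • n'
      rw [mul_smul, mul_smul, eb]

end PMod

/-! ### The category of normal coherent sheaves -/

/-- Objects of `Coh_n(P¹)`: normal coherent sheaves on the monoid projective line. -/
structure CohN where
  mod : PMod
  isSheaf : mod.IsSheaf
  isCoherent : mod.IsCoherent
  isNormal : mod.IsNormal

/-- Isomorphisms of sheaves of modules (bijective morphisms; these and their inverses are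
automatically normal). -/
structure CohN.Iso (F G : CohN) where
  equiv : ∀ U : Opens P1, F.mod.sec U ≃ G.mod.sec U
  map_zero : ∀ U, equiv U 0 = 0
  map_smul : ∀ U (a : O U) (s : F.mod.sec U), equiv U (a • s) = a • equiv U s
  map_res : ∀ {U V : Opens P1} (h : U ≤ V) (s : F.mod.sec V),
    equiv U (F.mod.res h s) = G.mod.res h (equiv V s)

instance isoSetoid : Setoid CohN where
  r F G := Nonempty (CohN.Iso F G)
  iseqv :=
    { refl := fun _ => ⟨⟨fun _ => Equiv.refl _, fun _ => rfl, fun _ _ _ => rfl, fun _ _ => rfl⟩⟩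
      symm := fun {_ _} ⟨e⟩ => ⟨⟨fun U => (e.equiv U).symm,
        fun U => by rw [Equiv.symm_apply_eq, e.map_zero],
        fun U a s => by rw [Equiv.symm_apply_eq, e.map_smul, Equiv.apply_symm_apply],
        fun {U V} h s => by rw [Equiv.symm_apply_eq, e.map_res, Equiv.apply_symm_apply]⟩⟩
      trans := fun {_ _ _} ⟨e⟩ ⟨e'⟩ => ⟨⟨fun U => (e.equiv U).trans (e'.equiv U),
        fun U => by simp [e.map_zero, e'.map_zero],
        fun U a s => by simp [e.map_smul, e'.map_smul],
        fun {U V} h s => by simp [e.map_res, e'.map_res]⟩⟩ }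

/-- `Iso(Coh_n(P¹))`. -/
def IsoCl : Type 1 := Quotient isoSetoid

/-- The isomorphism class of a normal coherent sheaf. -/
def CohN.cls (F : CohN) : IsoCl := Quotient.mk isoSetoid F

/-- The zero sheaf. -/
def zeroSheaf : CohN where
  mod :=
    { sec := fun _ => PUnit
      zero := fun _ => ⟨PUnit.unit⟩
      act := fun _ =>
        { smul := fun _ _ => PUnit.unit
          one_smul := fun _ => rfl
          mul_smul := fun _ _ _ => rfl
          smul_zero := fun _ => rfl
          zero_smul := fun _ => rfl }
      res := fun _ _ => PUnit.unit
      res_self := fun _ => rfl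
      res_res := fun _ _ _ => rfl
      res_zero := fun _ => rfl
      res_smul := fun _ _ _ => rfl }
  isSheaf := fun _ _ _ _ => ⟨PUnit.unit, fun _ => rfl, fun _ _ => rfl⟩
  isCoherent :=
    { fg := fun _ => ⟨{PUnit.unit}, fun _ => ⟨1, PUnit.unit, Finset.mem_singleton_self _, rfl⟩⟩
      surj := fun x _ => ⟨1, fun h => one_ne_zero
        (α := K) (congrFun (congrArg Subtype.val h) ⟨x, mem_nb x⟩), PUnit.unit, rfl⟩
      inj := fun x _ _ _ => ⟨1, fun h => one_ne_zero
        (α := K) (congrFun (congrArg Subtype.val h) ⟨x, mem_nb x⟩), rfl⟩ }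
  isNormal := fun _ _ _ _ _ _ => rfl

/-- The direct sum `F ⊕ G`: the sheaf associated with `U ↦ F(U) ∨ G(U)`. -/
def CohN.sum (F G : CohN) : CohN where
  mod := (PMod.preSum F.mod G.mod).sheafify
  isSheaf := PMod.sheafify_isSheaf _
  isCoherent := PMod.sheafify_isCoherent _ (PMod.preSum_isCoherent F.isCoherent G.isCoherent)
  isNormal := PMod.sheafify_isNormal _ (PMod.preSum_isNormal F.isNormal G.isNormal)

/-- A subsheaf of modules of `F`. -/
@[ext] structure PMod.Sub (F : PMod) where
  carrier : ∀ U : Opens P1, Set (F.sec U)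
  zero_mem : ∀ U, (0 : F.sec U) ∈ carrier U
  smul_mem : ∀ U (a : O U) {s : F.sec U}, s ∈ carrier U → a • s ∈ carrier U
  res_mem : ∀ {U V : Opens P1} (h : U ≤ V) {s : F.sec V}, s ∈ carrier V → F.res h s ∈ carrier U
  isLocal : ∀ (ι : Type) (U : ι → Opens P1) (s : F.sec (⨆ i, U i)),
    (∀ i, F.res (le_iSup U i) s ∈ carrier (U i)) → s ∈ carrier (⨆ i, U i)

namespace PMod.Sub

variable {F : PMod}

/-- Sections of a subsheaf. -/
def Sec (N : F.Sub) (U : Opens P1) : Type := {s : F.sec U // s ∈ N.carrier U}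

instance (N : F.Sub) (U : Opens P1) : Zero (N.Sec U) := ⟨⟨0, N.zero_mem U⟩⟩

instance (N : F.Sub) (U : Opens P1) : MulActionWithZero (O U) (N.Sec U) where
  smul a s := ⟨a • s.1, N.smul_mem U a s.2⟩
  one_smul s := Subtype.ext (one_smul _ s.1)
  mul_smul a b s := Subtype.ext (mul_smul a b s.1)
  smul_zero a := Subtype.ext (smul_zero a)
  zero_smul s := Subtype.ext (zero_smul _ s.1)

/-- A subsheaf, as a sheaf of modules. -/
def toPMod (N : F.Sub) : PMod where
  sec U := N.Sec U
  res h s := ⟨F.res h s.1, N.res_mem h s.2⟩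
  res_self s := Subtype.ext (F.res_self s.1)
  res_res h h' s := Subtype.ext (F.res_res h h' s.1)
  res_zero h := Subtype.ext (F.res_zero h)
  res_smul h a s := Subtype.ext (F.res_smul h a s.1)

theorem toPMod_isSheaf (N : F.Sub) (hF : F.IsSheaf) : N.toPMod.IsSheaf := by
  intro ι U (s : ∀ i, N.Sec (U i)) hs
  obtain ⟨r, hr, hu⟩ := hF ι U (fun i => (s i).1) fun i j => congrArg Subtype.val (hs i j)
  refine ⟨(⟨r, N.isLocal ι U r fun i => ?_⟩ : N.Sec (⨆ i, U i)),
    fun i => Subtype.ext (hr i), fun r' hr' => ?_⟩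
  · rw [hr i]
    exact (s i).2
  · exact Subtype.ext (hu r'.1 fun i => congrArg Subtype.val (hr' i))

theorem toPMod_isNormal (N : F.Sub) (hF : F.IsNormal) : N.toPMod.IsNormal := by
  intro x a (s : N.Sec (nb x)) (s' : N.Sec (nb x)) hne he
  refine Subtype.ext (hF x a s.1 s'.1 (fun h => hne (Subtype.ext h)) (congrArg Subtype.val he))

instance (N : F.Sub) (U : Opens P1) : MulActionWithZero (O U) (CollapseQuot (N.carrier U)) :=
  CollapseQuot.action (N.carrier U) (fun a _ h => N.smul_mem U a h)

/-- The presheaf quotient `U ↦ F(U) / N(U)`. -/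
def preQuot (N : F.Sub) : PMod where
  sec U := CollapseQuot (N.carrier U)
  res h := CollapseQuot.map (F.res h) (fun _ h' => N.res_mem h h')
  res_self := by
    rintro U ⟨s⟩
    exact congrArg (CollapseQuot.mk _) (F.res_self s)
  res_res := by
    rintro U V W h h' ⟨s⟩
    exact congrArg (CollapseQuot.mk _) (F.res_res h h' s)
  res_zero h := congrArg (CollapseQuot.mk _) (F.res_zero h)
  res_smul := by
    rintro U V h a ⟨s⟩
    exact congrArg (CollapseQuot.mk _) (F.res_smul h a s)

theorem preQuot_isNormal (N : F.Sub) (hF : F.IsNormal) : N.preQuot.IsNormal := by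
  intro x a (q : CollapseQuot (N.carrier (nb x))) (q' : CollapseQuot (N.carrier (nb x))) hne he
  obtain ⟨s, rfl⟩ := q.exists_rep
  obtain ⟨s', rfl⟩ := q'.exists_rep
  have he' : CollapseQuot.mk (N.carrier (nb x)) (a • s) = CollapseQuot.mk _ (a • s') := he
  rcases CollapseQuot.mk_eq.1 he' with h | h
  · refine congrArg (CollapseQuot.mk _) (hF x a s s' (fun h0 => hne ?_) h)
    exact congrArg (CollapseQuot.mk (N.carrier (nb x))) h0
  · exact absurd (CollapseQuot.mk_eq.2 (Or.inr ⟨h.1, N.zero_mem _⟩)) hne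

theorem preQuot_isCoherent (N : F.Sub) (hF : F.IsCoherent) (hN : N.toPMod.IsCoherent) :
    N.preQuot.IsCoherent := by
  classical
  have hkill : ∀ (x : P1) (m : F.sec (nb x)), F.res (nb_eta_le x) m ∈ N.carrier (nb .eta) →
      ∃ a : O (nb x), a ≠ 0 ∧ a • m ∈ N.carrier (nb x) := by
    intro x m hm
    obtain ⟨a, ha, n, hn⟩ := hN.surj x (⟨_, hm⟩ : N.Sec (nb .eta))
    have hn' : F.res (nb_eta_le x) (a • m) = F.res (nb_eta_le x) n.1 := by
      rw [F.res_smul]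
      exact congrArg (fun z : N.Sec (nb .eta) => z.1) hn
    obtain ⟨b, hb, e⟩ := hF.inj x _ _ hn'
    refine ⟨b * a, PMod.O_mul_ne_zero hb ha, ?_⟩
    rw [mul_smul, e]
    exact N.smul_mem _ b n.2
  refine ⟨fun x => ?_, ?_, ?_⟩
  · obtain ⟨G, hG⟩ := hF.fg x
    refine ⟨(G.image (CollapseQuot.mk (N.carrier (nb x))) :
      Finset (CollapseQuot (N.carrier (nb x)))), ?_⟩
    rintro ⟨m⟩
    obtain ⟨a, g, hg, e⟩ := hG m
    exact ⟨a, CollapseQuot.mk _ g, Finset.mem_image_of_mem _ hg,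
      congrArg (CollapseQuot.mk (N.carrier (nb x))) e⟩
  · rintro x ⟨y⟩
    obtain ⟨a, ha, m, hm⟩ := hF.surj x y
    exact ⟨a, ha, CollapseQuot.mk _ m, congrArg (CollapseQuot.mk (N.carrier (nb .eta))) hm⟩
  · rintro x ⟨m⟩ ⟨m'⟩ he
    rcases CollapseQuot.mk_eq.1 he with h | h
    · obtain ⟨a, ha, e⟩ := hF.inj x m m' h
      exact ⟨a, ha, congrArg (CollapseQuot.mk (N.carrier (nb x))) e⟩
    · obtain ⟨a, ha, ea⟩ := hkill x m h.1
      obtain ⟨b, hb, eb⟩ := hkill x m' h.2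
      refine ⟨a * b, PMod.O_mul_ne_zero ha hb, CollapseQuot.mk_eq.2 (Or.inr ⟨?_, ?_⟩)⟩
      · change (a * b) • m ∈ N.carrier (nb x)
        rw [mul_comm, mul_smul]
        exact N.smul_mem _ b ea
      · change (a * b) • m' ∈ N.carrier (nb x)
        rw [mul_smul]
        exact N.smul_mem _ a eb

end PMod.Sub

/-- A coherent subsheaf of `F` (it is automatically normal). -/
@[ext] structure CohN.Sub (F : CohN) where
  sub : F.mod.Sub
  isCoherent : sub.toPMod.IsCoherent

/-- A coherent subsheaf as an object of `Coh_n(P¹)`. -/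
def CohN.Sub.obj {F : CohN} (N : F.Sub) : CohN where
  mod := N.sub.toPMod
  isSheaf := N.sub.toPMod_isSheaf F.isSheaf
  isCoherent := N.isCoherent
  isNormal := N.sub.toPMod_isNormal F.isNormal

/-- The quotient `F / N`: the sheaf associated with `U ↦ F(U) / N(U)`. -/
def CohN.Sub.quot {F : CohN} (N : F.Sub) : CohN where
  mod := N.sub.preQuot.sheafify
  isSheaf := PMod.sheafify_isSheaf _
  isCoherent := PMod.sheafify_isCoherent _ (N.sub.preQuot_isCoherent F.isCoherent N.isCoherent)
  isNormal := PMod.sheafify_isNormal _ (N.sub.preQuot_isNormal F.isNormal)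

/-- Short exact sequences `0 → F' → F → F'' → 0` in `Coh_n(P¹)`: normal morphisms, exact on
stalks. -/
structure IsShortExact {F' F F'' : CohN} (j : PMod.Hom F'.mod F.mod)
    (p : PMod.Hom F.mod F''.mod) : Prop where
  normal_left : j.IsNormal
  normal_right : p.IsNormal
  injective : ∀ x : P1, Function.Injective (j.app (nb x))
  surjective : ∀ x : P1, Function.Surjective (p.app (nb x))
  exact : ∀ (x : P1) (s : F.mod.sec (nb x)), p.app (nb x) s = 0 ↔ s ∈ Set.range (j.app (nb x))

/-! ### The Grothendieck group and the Hall algebra -/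

/-- The relations `[F'] + [F''] - [F]` of the Grothendieck group. -/
def K0rel : Set (FreeAbelianGroup IsoCl) :=
  {r | ∃ (F' F F'' : CohN) (j : PMod.Hom F'.mod F.mod) (p : PMod.Hom F.mod F''.mod),
    IsShortExact j p ∧ r = FreeAbelianGroup.of F'.cls + FreeAbelianGroup.of F''.cls -
      FreeAbelianGroup.of F.cls}

/-- The Grothendieck group `K₀(P¹)` of `Coh_n(P¹)`. -/
abbrev K0 : Type 1 := FreeAbelianGroup IsoCl ⧸ AddSubgroup.closure K0rel

/-- The class in `K₀` of an isomorphism class of sheaves. -/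
def K0cls (c : IsoCl) : K0 := QuotientAddGroup.mk (FreeAbelianGroup.of c)

/-- The effective cone `K₀⁺ ⊆ K₀`, generated by the classes of sheaves. -/
def K0plus : AddSubmonoid K0 := AddSubmonoid.closure (Set.range K0cls)

/-- The vector space of finitely supported functions `Iso(Coh_n(P¹)) → ℂ`. -/
abbrev Hall : Type 1 := IsoCl →₀ ℂ

/-- The function `δ_c` supported at one isomorphism class. -/
noncomputable def delta (c : IsoCl) : Hall := Finsupp.single c 1

/-- The homogeneous component of degree `γ`, spanned by the `δ_F` with `[F] = γ` in `K₀`. -/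
noncomputable def Hall.grade (γ : K0plus) : Submodule ℂ Hall :=
  Submodule.span ℂ {f | ∃ c : IsoCl, K0cls c = (γ : K0) ∧ f = delta c}

/-- The value at `(c, c')` of an element of `Hall ⊗ Hall`, viewed as a finitely supported
function on pairs of isomorphism classes. -/
noncomputable def evalTensor (w : Hall ⊗[ℂ] Hall) (c c' : IsoCl) : ℂ :=
  finsuppTensorFinsupp' ℂ IsoCl IsoCl w (c, c')

end HallP1

open HallP1

/-! Every open subset of the three-point space is the union of the minimal neighbourhoods `nb x` of
its points, so a sheaf amounts to its three stalks with their restriction maps. `CohN.cls_eq` and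
`CohN.subEquiv` move isomorphism classes and coherent subsheaves to `StalkMod`, where everything is
combinatorics of pointed sets with operators: the nonzero scalars at a closed point are the powers
of one element `gen x`, and a nonzero element of a quotient has exactly one lift.

Three finiteness statements make the operations well defined. Given the class of the quotient, its
torsion is killed by a fixed power of `gen x`, and a subsystem with that quotient is recovered from
its trace on a finite test set (`Good.finite_quot`); this bounds the sum at a fixed sheaf. An
extension of `A` by `B` is determined by where `gen x` sends the lifts of those elements of `A` that
it kills, and the possible targets form a finite set (`finite_extensions`); this bounds the support
of a product. A direct summand is determined by the generators it contains
(`finite_decompositions`); this bounds the support of a coproduct.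

Associativity holds because both bracketings sum over flags of two subsystems (`hallStar_assoc`).
Coassociativity and cocommutativity are those of the direct sum. Since a wedge is a union of two
axes, every subsystem of a direct sum splits uniquely as a sum of subsystems (`csubSum`), and this
gives compatibility of product and coproduct (`hallComul_star`).

Connectedness requires that only the zero sheaf has class zero in `K0`. The detecting invariant is
the Euler characteristic of all twists, a regularised count of nonzero germs at `0` plus those at
`∞` minus those at `η`. It is additive on short exact sequences (`ShortExact.chi_eq`); for a large
twist all its local terms are nonnegative, so its vanishing forces the sheaf to vanish
(`Good.isZero_of_chi`). -/

namespace HallP1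

open TopologicalSpace

/-! ### The structure monoids -/

theorem O_ext {x : P1} {a b : O (nb x)} (h : a.1 ⟨x, mem_nb x⟩ = b.1 ⟨x, mem_nb x⟩) : a = b :=
  Subtype.ext (funext fun y => by rw [a.2.2 y ⟨x, mem_nb x⟩, b.2.2 y ⟨x, mem_nb x⟩, h])

theorem O_one_ne_zero (x : P1) : (1 : O (nb x)) ≠ 0 := fun h =>
  one_ne_zero (α := K) (congrFun (congrArg Subtype.val h) ⟨x, mem_nb x⟩)

theorem O_pow_ne_zero {x : P1} {a : O (nb x)} (h : a ≠ 0) (n : ℕ) : a ^ n ≠ 0 := by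
  induction n with
  | zero => rw [pow_zero]; exact O_one_ne_zero x
  | succ n ih => rw [pow_succ]; exact PMod.O_mul_ne_zero ih h

theorem O_res_one {U V : Opens P1} (h : U ≤ V) : O.res h 1 = 1 := rfl

theorem O_res_zero {U V : Opens P1} (h : U ≤ V) : O.res h 0 = 0 := rfl

theorem O_res_pow {U V : Opens P1} (h : U ≤ V) (a : O V) (n : ℕ) :
    O.res h (a ^ n) = O.res h a ^ n := rfl

theorem O_res_ne_zero {x y : P1} (h : nb y ≤ nb x) {a : O (nb x)} (ha : a ≠ 0) :
    O.res h a ≠ 0 := by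
  intro h0
  refine ha (O_ext ?_)
  have := congrFun (congrArg Subtype.val h0) ⟨y, mem_nb y⟩
  exact (a.2.2 _ _).trans this

/-- The section with a given value. -/
def constO (x : P1) (k : K) (h : k ∈ stalk x) : O (nb x) :=
  ⟨fun _ => k, by
    refine ⟨?_, fun _ _ => rfl⟩
    rintro ⟨y, hy⟩
    rcases hy with rfl | rfl
    · exact h
    · trivial, ⟩

theorem t_ne_zero : t ≠ 0 := WithZero.coe_ne_zero

/-- The generator of the nonzero scalars at each point. -/
def genVal : P1 → K
  | .zero => t
  | .infty => t⁻¹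
  | .eta => t

theorem genVal_mem (x : P1) : genVal x ∈ stalk x := by
  cases x
  · exact Or.inr ⟨1, (pow_one _).symm⟩
  · exact Or.inr ⟨1, (pow_one _).symm⟩
  · trivial

theorem genVal_ne_zero (x : P1) : genVal x ≠ 0 := by
  cases x
  · exact t_ne_zero
  · exact inv_ne_zero t_ne_zero
  · exact t_ne_zero

/-- The generator of the nonzero scalars at `x`: `t` at `0` and `η`, `t⁻¹` at `∞`. -/
def gen (x : P1) : O (nb x) := constO x (genVal x) (genVal_mem x)

theorem gen_ne_zero (x : P1) : gen x ≠ 0 := fun h =>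
  genVal_ne_zero x (congrFun (congrArg Subtype.val h) ⟨x, mem_nb x⟩)

theorem exists_zpow_t (k : K) (hk : k ≠ 0) : ∃ n : ℤ, k = t ^ n := by
  obtain ⟨m, rfl⟩ := WithZero.ne_zero_iff_exists.1 hk
  refine ⟨m.toAdd, ?_⟩
  rw [t, ← WithZero.coe_zpow, ← ofAdd_zsmul]
  simp

theorem eta_cases {a : O (nb .eta)} (ha : a ≠ 0) :
    (∃ n : ℕ, a = gen .eta ^ n) ∨ ∃ n : ℕ, a * gen .eta ^ n = 1 := by
  have h0 : a.1 ⟨.eta, mem_nb _⟩ ≠ 0 := fun h => ha (O_ext h)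
  obtain ⟨n, hn⟩ := exists_zpow_t _ h0
  rcases Int.eq_nat_or_neg n with ⟨m, rfl | rfl⟩
  · refine Or.inl ⟨m, O_ext ?_⟩
    rw [hn, zpow_natCast]; rfl
  · refine Or.inr ⟨m, O_ext ?_⟩
    change a.1 _ * t ^ m = 1
    rw [hn, zpow_neg, zpow_natCast]
    exact inv_mul_cancel₀ (pow_ne_zero _ t_ne_zero)

theorem eta_exists_inv {a : O (nb .eta)} (ha : a ≠ 0) : ∃ b : O (nb .eta), b * a = 1 := by
  have h0 : a.1 ⟨.eta, mem_nb _⟩ ≠ 0 := fun h => ha (O_ext h)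
  exact ⟨constO .eta (a.1 ⟨.eta, mem_nb _⟩)⁻¹ trivial, O_ext (inv_mul_cancel₀ h0)⟩

/-- Inverses of powers occur only at `η`. This trichotomy lets later arguments deal with a single
operator `gen x` per point. -/
theorem O_cases {x : P1} (a : O (nb x)) :
    a = 0 ∨ (∃ n : ℕ, a = gen x ^ n) ∨ (x = .eta ∧ ∃ n : ℕ, a * gen x ^ n = 1) := by
  by_cases ha : a = 0
  · exact Or.inl ha
  right
  have h0 : a.1 ⟨x, mem_nb x⟩ ≠ 0 := fun h => ha (O_ext h)
  have hm := a.2.1 ⟨x, mem_nb x⟩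
  cases x
  · obtain h | ⟨n, h⟩ := hm
    · exact absurd h h0
    · exact Or.inl ⟨n, O_ext h⟩
  · obtain h | ⟨n, h⟩ := hm
    · exact absurd h h0
    · exact Or.inl ⟨n, O_ext h⟩
  · rcases eta_cases ha with h | h
    · exact Or.inl h
    · exact Or.inr ⟨rfl, h⟩

theorem O_res_gen_zero : O.res (nb_eta_le .zero) (gen .zero) = gen .eta := O_ext rfl

theorem O_res_gen_infty : gen .eta * O.res (nb_eta_le .infty) (gen .infty) = 1 :=
  O_ext (mul_inv_cancel₀ t_ne_zero)

theorem nb_le_cases {x y : P1} (h : nb y ≤ nb x) : y = x ∨ y = .eta := h (mem_nb y)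

instance : Finite P1 := by
  refine Finite.of_injective
    (fun x : P1 => match x with | .zero => (0 : Fin 3) | .infty => 1 | .eta => 2) ?_
  intro x y h
  cases x <;> cases y <;> simp_all

/-! ### Stalk systems -/

/-- The system of stalks of a presheaf of modules on `P¹`: `op h a` is restriction along
`nb y ≤ nb x` followed by multiplication by `a`. -/
structure StalkMod where
  M : P1 → Type
  [zero : ∀ x, Zero (M x)]
  op : ∀ {x y : P1}, nb y ≤ nb x → O (nb y) → M x → M y
  op_zero : ∀ {x y : P1} (h : nb y ≤ nb x) (a : O (nb y)), op h a (0 : M x) = 0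
  zero_op : ∀ {x y : P1} (h : nb y ≤ nb x) (m : M x), op h 0 m = 0
  one_op : ∀ {x : P1} (m : M x), op le_rfl 1 m = m
  op_op : ∀ {x y w : P1} (h : nb y ≤ nb x) (h' : nb w ≤ nb y) (a : O (nb y)) (b : O (nb w))
    (m : M x), op h' b (op h a m) = op (h'.trans h) (b * O.res h' a) m

attribute [instance] StalkMod.zero

/-- The stalks of a presheaf. -/
abbrev PMod.st (F : PMod) : StalkMod where
  M x := F.sec (nb x)
  op h a m := a • F.res h m
  op_zero h a := by rw [F.res_zero, smul_zero]
  zero_op h m := zero_smul _ _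
  one_op m := by rw [F.res_self, one_smul]
  op_op h h' a b m := by rw [F.res_smul, F.res_res, mul_smul]

namespace StalkMod

/-- Isomorphisms of stalk systems. -/
structure Iso (P Q : StalkMod) where
  e : ∀ x, P.M x ≃ Q.M x
  map_op : ∀ {x y : P1} (h : nb y ≤ nb x) (a : O (nb y)) (m : P.M x),
    e y (P.op h a m) = Q.op h a (e x m)

namespace Iso

variable {P Q R : StalkMod}

theorem map_zero (φ : Iso P Q) (x : P1) : φ.e x 0 = 0 := by
  rw [← P.zero_op le_rfl 0, φ.map_op, Q.zero_op]

theorem map_eq_zero (φ : Iso P Q) {x : P1} {m : P.M x} : φ.e x m = 0 ↔ m = 0 := by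
  rw [← φ.map_zero x, (φ.e x).apply_eq_iff_eq]

def refl (P : StalkMod) : Iso P P := ⟨fun _ => Equiv.refl _, fun _ _ _ => rfl⟩

def symm (φ : Iso P Q) : Iso Q P :=
  ⟨fun x => (φ.e x).symm, fun h a m => by
    rw [Equiv.symm_apply_eq, φ.map_op, Equiv.apply_symm_apply]⟩

def trans (φ : Iso P Q) (ψ : Iso Q R) : Iso P R :=
  ⟨fun x => (φ.e x).trans (ψ.e x), fun h a m => by
    simp only [Equiv.trans_apply, φ.map_op, ψ.map_op]⟩

/-- A bijective equivariant map. -/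
noncomputable def ofBijective (f : ∀ x, P.M x → Q.M x) (hf : ∀ x, Function.Bijective (f x))
    (h : ∀ {x y : P1} (h : nb y ≤ nb x) (a : O (nb y)) (m : P.M x),
      f y (P.op h a m) = Q.op h a (f x m)) : Iso P Q :=
  ⟨fun x => Equiv.ofBijective (f x) (hf x), h⟩

end Iso

variable {P Q R : StalkMod}

/-- Compatibility with all operations follows from compatibility with generators. -/
theorem map_op_of_gen {f : ∀ x, P.M x → Q.M x} (h0 : ∀ x, f x 0 = 0)
    (hτ : ∀ x m, f x (P.op le_rfl (gen x) m) = Q.op le_rfl (gen x) (f x m))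
    (hρ : ∀ x m, f .eta (P.op (nb_eta_le x) 1 m) = Q.op (nb_eta_le x) 1 (f x m))
    {x y : P1} (h : nb y ≤ nb x) (a : O (nb y)) (m : P.M x) :
    f y (P.op h a m) = Q.op h a (f x m) := by
  have hpow : ∀ x (n : ℕ) (m : P.M x),
      f x (P.op le_rfl (gen x ^ n) m) = Q.op le_rfl (gen x ^ n) (f x m) := by
    intro x n
    induction n with
    | zero => intro m; rw [pow_zero, P.one_op, Q.one_op]
    | succ n ih =>
      intro m
      have := ih (P.op le_rfl (gen x) m)
      rw [hτ, P.op_op, Q.op_op] at this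
      rw [pow_succ]
      exact this
  have hsm : ∀ x (a : O (nb x)) (m : P.M x),
      f x (P.op le_rfl a m) = Q.op le_rfl a (f x m) := by
    intro x a m
    rcases O_cases a with rfl | ⟨n, rfl⟩ | ⟨-, n, hn⟩
    · rw [P.zero_op, Q.zero_op, h0]
    · exact hpow x n m
    -- A negative power is handled by applying the positive case to `a • m` and then inverting.
    · have h1 := hpow x n (P.op le_rfl a m)
      rw [P.op_op] at h1
      have e : gen x ^ n * O.res le_rfl a = 1 := by rw [mul_comm]; exact hn
      rw [e, P.one_op] at h1
      rw [h1, Q.op_op]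
      have e' : a * O.res le_rfl (gen x ^ n) = 1 := hn
      rw [e', Q.one_op]
  have key : ∀ (R : StalkMod) (m : R.M x), R.op h a m = R.op le_rfl a (R.op h 1 m) := by
    intro R m
    rw [R.op_op, O_res_one, mul_one]
  rw [key P, key Q, hsm]
  congr 1
  rcases nb_le_cases h with rfl | rfl
  · rw [P.one_op, Q.one_op]
  · exact hρ x m

theorem op_eq_smul_res (P : StalkMod) {x y : P1} (h : nb y ≤ nb x) (a : O (nb y)) (m : P.M x) :
    P.op h a m = P.op le_rfl a (P.op h 1 m) := by
  rw [P.op_op, O_res_one, mul_one]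

theorem smul_smul (P : StalkMod) {x : P1} (a b : O (nb x)) (m : P.M x) :
    P.op le_rfl a (P.op le_rfl b m) = P.op le_rfl (a * b) m := P.op_op _ _ _ _ _

/-- Finite generation: for each `x`, finitely many germs at `x` generate the stalks at all
generizations of `x`. -/
def Fin (P : StalkMod) : Prop :=
  ∀ x, ∃ G : Finset (P.M x), ∀ (y : P1) (h : nb y ≤ nb x) (m : P.M y),
    ∃ a : O (nb y), ∃ g ∈ G, m = P.op h a g

/-- All operations are normal. -/
def Normal (P : StalkMod) : Prop :=
  ∀ (x y : P1) (h : nb y ≤ nb x) (a : O (nb y)), IsNormalMap (P.op h a : P.M x → P.M y)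

/-- Germs that vanish at `η` are torsion. -/
def Torsion (P : StalkMod) : Prop :=
  ∀ (x : P1) (m : P.M x), P.op (nb_eta_le x) 1 m = 0 →
    ∃ n : ℕ, P.op le_rfl (gen x ^ n) m = 0

theorem Fin.of_surjective (hP : P.Fin) (f : ∀ x, P.M x → Q.M x)
    (hf : ∀ x, Function.Surjective (f x))
    (hop : ∀ {x y : P1} (h : nb y ≤ nb x) (a : O (nb y)) (m : P.M x),
      f y (P.op h a m) = Q.op h a (f x m)) : Q.Fin := by
  classical
  intro x
  obtain ⟨G, hG⟩ := hP x
  refine ⟨G.image (f x), fun y h m => ?_⟩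
  obtain ⟨m, rfl⟩ := hf y m
  obtain ⟨a, g, hg, rfl⟩ := hG y h m
  exact ⟨a, f x g, Finset.mem_image_of_mem _ hg, hop h a g⟩

theorem Fin.of_iso (hP : P.Fin) (φ : Iso P Q) : Q.Fin :=
  hP.of_surjective (fun x => φ.e x) (fun x => (φ.e x).surjective) φ.map_op

theorem Normal.of_iso (hP : P.Normal) (φ : Iso P Q) : Q.Normal := by
  intro x y h a m m' hne he
  have key : ∀ m, P.op h a ((φ.e x).symm m) = (φ.e y).symm (Q.op h a m) := fun m =>
    (φ.symm.map_op h a m).symm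
  refine (φ.e x).symm.injective (hP x y h a _ _ ?_ ?_)
  · rw [key]
    exact fun h0 => hne (φ.symm.map_eq_zero.1 h0)
  · rw [key, key]
    exact congrArg _ he

theorem Torsion.of_iso (hP : P.Torsion) (φ : Iso P Q) : Q.Torsion := by
  intro x m hm
  obtain ⟨n, hn⟩ := hP x ((φ.e x).symm m) (by
    have := φ.symm.map_op (nb_eta_le x) 1 m
    rw [hm, φ.symm.map_zero] at this
    exact this.symm)
  refine ⟨n, ?_⟩
  have := φ.map_op le_rfl (gen x ^ n) ((φ.e x).symm m)
  rw [hn, φ.map_zero, Equiv.apply_symm_apply] at this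
  exact this.symm

/-! ### Subsystems, quotients and sums -/

/-- A subsystem. -/
@[ext] structure Sub (P : StalkMod) where
  carrier : ∀ x, Set (P.M x)
  zero_mem : ∀ x, (0 : P.M x) ∈ carrier x
  op_mem : ∀ {x y : P1} (h : nb y ≤ nb x) (a : O (nb y)) {m : P.M x}, m ∈ carrier x →
    P.op h a m ∈ carrier y

namespace Sub

/-- A subsystem, as a stalk system. -/
def obj (S : P.Sub) : StalkMod where
  M x := {m : P.M x // m ∈ S.carrier x}
  zero x := ⟨⟨0, S.zero_mem x⟩⟩
  op h a m := ⟨P.op h a m.1, S.op_mem h a m.2⟩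
  op_zero h a := Subtype.ext (P.op_zero h a)
  zero_op h m := Subtype.ext (P.zero_op h m.1)
  one_op m := Subtype.ext (P.one_op m.1)
  op_op h h' a b m := Subtype.ext (P.op_op h h' a b m.1)

/-- The quotient by a subsystem. -/
def quot (S : P.Sub) : StalkMod where
  M x := CollapseQuot (S.carrier x)
  op h a := CollapseQuot.map (P.op h a) (fun _ hm => S.op_mem h a hm)
  op_zero h a := congrArg (CollapseQuot.mk _) (P.op_zero h a)
  zero_op h m := by
    obtain ⟨m, rfl⟩ := m.exists_rep
    exact congrArg (CollapseQuot.mk _) (P.zero_op h m)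
  one_op m := by
    obtain ⟨m, rfl⟩ := m.exists_rep
    exact congrArg (CollapseQuot.mk _) (P.one_op m)
  op_op h h' a b m := by
    obtain ⟨m, rfl⟩ := m.exists_rep
    exact congrArg (CollapseQuot.mk _) (P.op_op h h' a b m)

/-- The projection to the quotient. -/
def proj (S : P.Sub) {x : P1} (m : P.M x) : S.quot.M x := CollapseQuot.mk (S.carrier x) m

variable (S : P.Sub)

theorem proj_eq {x : P1} {m m' : P.M x} :
    S.proj m = S.proj m' ↔ m = m' ∨ (m ∈ S.carrier x ∧ m' ∈ S.carrier x) := CollapseQuot.mk_eq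

theorem proj_eq_zero {x : P1} {m : P.M x} : S.proj m = 0 ↔ m ∈ S.carrier x := by
  constructor
  · intro h
    rcases S.proj_eq.1 (h : S.proj m = S.proj 0) with rfl | h
    · exact S.zero_mem x
    · exact h.1
  · exact fun h => S.proj_eq.2 (Or.inr ⟨h, S.zero_mem x⟩)

theorem proj_surjective (x : P1) : Function.Surjective (S.proj : P.M x → S.quot.M x) := fun q =>
  q.exists_rep

theorem op_proj {x y : P1} (h : nb y ≤ nb x) (a : O (nb y)) (m : P.M x) :
    S.quot.op h a (S.proj m) = S.proj (P.op h a m) := rfl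

/-- Subsystems with the same carriers are equal. -/
theorem ext' {S T : P.Sub} (h : ∀ x m, m ∈ S.carrier x ↔ m ∈ T.carrier x) : S = T :=
  Sub.ext (funext fun x => Set.ext (h x))

/-- Extensions of finitely generated systems are finitely generated. -/
theorem fin_of_extension (h1 : S.obj.Fin) (h2 : S.quot.Fin) : P.Fin := by
  classical
  intro x
  obtain ⟨G, hG⟩ := h1 x
  obtain ⟨G', hG'⟩ := h2 x
  refine ⟨G.image (fun g => g.1) ∪ G'.image (Function.surjInv (S.proj_surjective x)),
    fun y h m => ?_⟩
  have key : m ∈ S.carrier y → ∃ a : O (nb y), ∃ g ∈ G, m = P.op h a g.1 := by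
    intro hm
    obtain ⟨a, g, hg, e⟩ := hG y h ⟨m, hm⟩
    exact ⟨a, g, hg, congrArg Subtype.val e⟩
  by_cases hm : m ∈ S.carrier y
  · obtain ⟨a, g, hg, e⟩ := key hm
    exact ⟨a, g.1, Finset.mem_union_left _ (Finset.mem_image_of_mem _ hg), e⟩
  · obtain ⟨a, g, hg, e⟩ := hG' y h (S.proj m)
    refine ⟨a, _, Finset.mem_union_right _ (Finset.mem_image_of_mem _ hg), ?_⟩
    have e' : S.proj m = S.proj (P.op h a (Function.surjInv (S.proj_surjective x) g)) := by
      rw [← S.op_proj, Function.surjInv_eq (S.proj_surjective x) g, e]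
    -- Outside `S` the projection is injective, so the chosen lift of a generator gives `m` itself
    -- and not merely its class.
    rcases S.proj_eq.1 e' with h' | h'
    · exact h'
    · exact absurd h'.1 hm

end Sub

/-- The direct sum of stalk systems. -/
def sum (P Q : StalkMod) : StalkMod where
  M x := Wedge (P.M x) (Q.M x)
  op h a p := ⟨(P.op h a p.1.1, Q.op h a p.1.2), by
    rcases p.2 with e | e
    · left; simp only [e, P.op_zero]
    · right; simp only [e, Q.op_zero]⟩
  op_zero h a := Subtype.ext (Prod.ext (P.op_zero h a) (Q.op_zero h a))
  zero_op h m := Subtype.ext (Prod.ext (P.zero_op h _) (Q.zero_op h _))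
  one_op m := Subtype.ext (Prod.ext (P.one_op _) (Q.one_op _))
  op_op h h' a b m := Subtype.ext (Prod.ext (P.op_op h h' a b _) (Q.op_op h h' a b _))

end StalkMod

end HallP1

namespace HallP1

open TopologicalSpace

/-! ### Sheaves and their stalks -/

theorem iSup_nb (U : Opens P1) : U = ⨆ x : U, nb x.1 := by
  refine le_antisymm (fun x hx => Opens.mem_iSup.2 ⟨⟨x, hx⟩, mem_nb x⟩) ?_
  exact iSup_le fun x => nb_le x.2

namespace PMod

theorem IsSheaf.existsUnique {F : PMod} (hF : F.IsSheaf) {ι : Type} (U : ι → Opens P1)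
    {V : Opens P1} (hV : V = ⨆ i, U i) (s : ∀ i, F.sec (U i))
    (hs : ∀ i j, F.res (inf_le_left : U i ⊓ U j ≤ U i) (s i) =
      F.res (inf_le_right : U i ⊓ U j ≤ U j) (s j)) :
    ∃! r : F.sec V, ∀ i, F.res (hV ▸ le_iSup U i) r = s i := by
  subst hV
  exact hF ι U s hs

theorem Sub.mem_of_cover {F : PMod} (N : F.Sub) {ι : Type} (U : ι → Opens P1) {V : Opens P1}
    (hV : V = ⨆ i, U i) (s : F.sec V)
    (hs : ∀ i, F.res (hV ▸ le_iSup U i) s ∈ N.carrier (U i)) : s ∈ N.carrier V := by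
  subst hV
  exact N.isLocal ι U s hs

/-- The family of germs of a section. -/
def germs (F : PMod) {U : Opens P1} (s : F.sec U) : F.Germs U :=
  ⟨fun x => F.res (nb_le x.2) s, fun _ _ _ => F.res_res _ _ _⟩

/-- Minimal neighbourhoods of distinct points meet exactly in `{η}`, so agreement on overlaps
reduces to having the same germ at `η`. -/
theorem Germs.compat {F : PMod} {U : Opens P1} (s : F.Germs U) (x y : U) :
    F.res (inf_le_left : nb x.1 ⊓ nb y.1 ≤ nb x.1) (s.1 x) =
      F.res (inf_le_right : nb x.1 ⊓ nb y.1 ≤ nb y.1) (s.1 y) := by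
  by_cases hxy : x = y
  · subst hxy; rfl
  · have hη : nb x.1 ⊓ nb y.1 = nb .eta := by
      refine le_antisymm ?_ (le_inf (nb_eta_le _) (nb_eta_le _))
      rintro z ⟨h1 | h1, h2 | h2⟩
      · exact absurd (Subtype.ext (h1.symm.trans h2)) hxy
      · exact Or.inl h2
      · exact Or.inl h1
      · exact Or.inl h1
    have key : ∀ (V : Opens P1) (hV : V = nb .eta) (h1 : V ≤ nb x.1) (h2 : V ≤ nb y.1),
        F.res h1 (s.1 x) = F.res h2 (s.1 y) := by
      rintro V rfl h1 h2
      rw [s.2 x ⟨.eta, eta_mem x.2⟩ h1, s.2 y ⟨.eta, eta_mem x.2⟩ h2]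
    exact key _ hη _ _

/-- This is the sheaf condition for the cover of `U` by minimal neighbourhoods. It is what reduces
sheaves to stalks. -/
theorem germs_bijective {F : PMod} (hF : F.IsSheaf) (U : Opens P1) :
    Function.Bijective (F.germs : F.sec U → F.Germs U) := by
  constructor
  · intro s s' h
    have := hF.existsUnique (fun x : U => nb x.1) (iSup_nb U) (F.germs s).1 (F.germs s).compat
    refine this.unique (fun x => rfl) fun x => ?_
    rw [h]; rfl
  · intro s
    obtain ⟨r, hr, -⟩ := hF.existsUnique (fun x : U => nb x.1) (iSup_nb U) s.1 s.compat
    exact ⟨r, Subtype.ext (funext hr)⟩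

/-- Sheafification does not change the stalks. -/
noncomputable def stSheafify (P : PMod) : StalkMod.Iso P.st P.sheafify.st :=
  StalkMod.Iso.ofBijective (fun _ m => P.toSheafify m)
    (fun x => ⟨fun m m' h => by
        have := congrArg (fun s : P.Germs (nb x) => s.1 ⟨x, mem_nb x⟩) h
        simpa only [P.toSheafify_germ] using this,
      fun s => ⟨s.1 ⟨x, mem_nb x⟩, P.sheafify_ext (P.toSheafify_germ _)⟩⟩)
    (fun {x y} h a m => by
      refine P.sheafify_ext ?_
      rw [P.toSheafify_germ]
      change a • P.res h m = a • P.res _ m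
      rfl)

/-- Denominators of scalars at `η`. -/
theorem exists_denominator (x : P1) (b : O (nb .eta)) :
    ∃ a : O (nb x), a ≠ 0 ∧ ∃ c : O (nb x), O.res (nb_eta_le x) a * b = O.res (nb_eta_le x) c := by
  by_cases hb : b = 0
  · exact ⟨1, O_one_ne_zero x, 0, by rw [hb, mul_zero, O_res_zero]⟩
  cases x
  · rcases eta_cases hb with ⟨n, rfl⟩ | ⟨n, hn⟩
    · exact ⟨1, O_one_ne_zero _, gen _ ^ n, by rw [O_res_one, one_mul, O_res_pow, O_res_gen_zero]⟩
    · exact ⟨gen _ ^ n, O_pow_ne_zero (gen_ne_zero _) n, 1, by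
        rw [O_res_one, O_res_pow, O_res_gen_zero, mul_comm, hn]⟩
  · rcases eta_cases hb with ⟨n, rfl⟩ | ⟨n, hn⟩
    · refine ⟨gen _ ^ n, O_pow_ne_zero (gen_ne_zero _) n, 1, ?_⟩
      rw [O_res_one, O_res_pow, mul_comm, ← mul_pow, O_res_gen_infty, one_pow]
    · refine ⟨1, O_one_ne_zero _, gen _ ^ n, ?_⟩
      have h1 : gen .eta ^ n * O.res (nb_eta_le .infty) (gen .infty) ^ n = 1 := by
        rw [← mul_pow, O_res_gen_infty, one_pow]
      calc O.res (nb_eta_le .infty) 1 * b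
          = b * (gen .eta ^ n * O.res (nb_eta_le .infty) (gen .infty) ^ n) := by
            rw [h1, O_res_one, one_mul, mul_one]
        _ = _ := by rw [← mul_assoc, hn, one_mul, O_res_pow]
  · exact ⟨1, O_one_ne_zero _, b, one_mul b⟩

/-- A section at `η` is a fraction whose denominator becomes invertible there, so generators at `x`
also generate the stalk at `η` over the scalars of `η`. -/
theorem IsCoherent.fin {F : PMod} (hF : F.IsCoherent) : F.st.Fin := by
  intro x
  obtain ⟨G, hG⟩ := hF.fg x
  refine ⟨G, fun y h m => ?_⟩
  rcases nb_le_cases h with rfl | rfl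
  · obtain ⟨a, g, hg, e⟩ := hG m
    exact ⟨a, g, hg, by rw [e]; exact congrArg (fun z => a • z) (F.res_self g).symm⟩
  · obtain ⟨a, ha, m', e⟩ := hF.surj x m
    obtain ⟨c, g, hg, rfl⟩ := hG m'
    obtain ⟨b, hb⟩ := eta_exists_inv (O_res_ne_zero (nb_eta_le x) ha)
    refine ⟨b * O.res h c, g, hg, ?_⟩
    change m = (b * O.res h c) • F.res h g
    rw [mul_smul, ← F.res_smul, ← e, ← mul_smul, hb, one_smul]

theorem IsCoherent.torsion {F : PMod} (hF : F.IsCoherent) : F.st.Torsion := by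
  intro x m hm
  have hm' : F.res (nb_eta_le x) m = F.res (nb_eta_le x) 0 := by
    rw [F.res_zero]
    exact (one_smul (O (nb .eta)) _).symm.trans hm
  obtain ⟨a, ha, e⟩ := hF.inj x m 0 hm'
  rw [smul_zero] at e
  change ∃ n : ℕ, gen x ^ n • F.res _ m = 0
  rw [F.res_self]
  rcases O_cases a with h | ⟨n, rfl⟩ | ⟨-, n, hn⟩
  · exact absurd h ha
  · exact ⟨n, e⟩
  · refine ⟨n, ?_⟩
    have : m = 0 := by
      rw [← one_smul (O (nb x)) m, ← hn, mul_comm, mul_smul, e, smul_zero]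
    rw [this, smul_zero]

/-- Restriction to `η` is normal as well: germs with the same nonzero value at `η` become equal
after multiplication by some denominator, this common multiple is nonzero because its value at `η`
is, and normality of multiplication concludes. -/
theorem IsNormal.st {F : PMod} (hN : F.IsNormal) (hF : F.IsCoherent) : F.st.Normal := by
  intro x y h a m m' hne he
  rcases nb_le_cases h with rfl | rfl
  · change a • F.res _ m ≠ 0 at hne
    change a • F.res _ m = a • F.res _ m' at he
    rw [F.res_self] at hne he
    rw [F.res_self] at he
    exact hN _ a m m' hne he
  · have e := hN _ a _ _ hne he
    obtain ⟨b, hb, e'⟩ := hF.inj x m m' e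
    refine hN x b m m' (fun h0 => hne ?_) e'
    have h1 : F.res h (b • m) = 0 := by
      change F.res h ((fun m => b • m) m) = 0
      rw [h0, F.res_zero]
    obtain ⟨c, hc⟩ := eta_exists_inv (O_res_ne_zero h hb)
    change a • F.res h m = 0
    rw [← one_smul (O (nb .eta)) (F.res h m), ← hc, mul_smul, ← F.res_smul, h1, smul_zero,
      smul_zero]

/-- Converse to `IsCoherent.fin`: writing a section at `η` as a scalar times a generator from `x`
and clearing the denominator of the scalar makes it a fraction. -/
theorem isCoherent_of_fin {F : PMod} (h : F.st.Fin)
    (inj : ∀ (x : P1) (m m' : F.sec (nb x)),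
      F.res (nb_eta_le x) m = F.res (nb_eta_le x) m' → ∃ a : O (nb x), a ≠ 0 ∧ a • m = a • m') :
    F.IsCoherent := by
  refine ⟨fun x => ?_, fun x y => ?_, inj⟩
  · obtain ⟨G, hG⟩ := h x
    refine ⟨G, fun m => ?_⟩
    obtain ⟨a, g, hg, e⟩ := hG x le_rfl m
    exact ⟨a, g, hg, e.trans (congrArg (fun z => a • z) (F.res_self g))⟩
  · obtain ⟨G, hG⟩ := h x
    obtain ⟨b, g, hg, rfl⟩ := hG .eta (nb_eta_le x) y
    obtain ⟨a, ha, c, hc⟩ := exists_denominator x b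
    refine ⟨a, ha, c • g, ?_⟩
    change O.res _ a • b • F.res _ g = _
    rw [← mul_smul, hc, F.res_smul]

end PMod

/-! ### Sheaves are determined by their stalks -/

namespace CohN

/-- The stalks of a normal coherent sheaf. -/
abbrev st (F : CohN) : StalkMod := F.mod.st

theorem st_fin (F : CohN) : F.st.Fin := F.isCoherent.fin

theorem st_torsion (F : CohN) : F.st.Torsion := F.isCoherent.torsion

theorem st_normal (F : CohN) : F.st.Normal := F.isNormal.st F.isCoherent

/-- An isomorphism of sheaves induces isomorphisms of stalks. -/
def Iso.st {F G : CohN} (φ : CohN.Iso F G) : StalkMod.Iso F.st G.st :=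
  ⟨fun x => φ.equiv (nb x), fun h a m => by
    change φ.equiv _ (a • F.mod.res h m) = a • G.mod.res h _
    rw [φ.map_smul, φ.map_res]⟩

/-- Compatible families of germs are preserved by isomorphisms of stalks. -/
def germsMap {F G : CohN} (φ : StalkMod.Iso F.st G.st) {U : Opens P1} (s : F.mod.Germs U) :
    G.mod.Germs U :=
  ⟨fun x => φ.e x.1 (s.1 x), fun x y h => by
    have := φ.map_op h 1 (s.1 x)
    change φ.e y.1 ((1 : O (nb y.1)) • F.mod.res h (s.1 x)) =
      (1 : O (nb y.1)) • G.mod.res h (φ.e x.1 (s.1 x)) at this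
    rw [one_smul, one_smul, s.2 x y h] at this
    exact this.symm⟩

theorem iso_smul {F G : CohN} (φ : StalkMod.Iso F.st G.st) (x : P1) (a : O (nb x))
    (m : F.mod.sec (nb x)) : φ.e x (a • m) = a • (φ.e x m : G.mod.sec (nb x)) := by
  have := φ.map_op le_rfl a m
  change φ.e x (a • F.mod.res _ m) = a • G.mod.res _ _ at this
  rw [F.mod.res_self, G.mod.res_self] at this
  exact this

theorem germsMap_bijective {F G : CohN} (φ : StalkMod.Iso F.st G.st) (U : Opens P1) :
    Function.Bijective (germsMap φ : F.mod.Germs U → G.mod.Germs U) := by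
  refine Function.bijective_iff_has_inverse.2 ⟨germsMap φ.symm, fun s => ?_, fun s => ?_⟩
  · exact Subtype.ext (funext fun x => (φ.e x.1).symm_apply_apply _)
  · exact Subtype.ext (funext fun x => (φ.e x.1).apply_symm_apply _)

/-- The section map induced by an isomorphism of stalks. -/
noncomputable def secEquiv {F G : CohN} (φ : StalkMod.Iso F.st G.st) (U : Opens P1) :
    F.mod.sec U ≃ G.mod.sec U :=
  (Equiv.ofBijective _ (PMod.germs_bijective F.isSheaf U)).trans
    ((Equiv.ofBijective _ (germsMap_bijective φ U)).trans
      (Equiv.ofBijective _ (PMod.germs_bijective G.isSheaf U)).symm)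

theorem germs_secEquiv {F G : CohN} (φ : StalkMod.Iso F.st G.st) {U : Opens P1}
    (s : F.mod.sec U) : G.mod.germs (secEquiv φ U s) = germsMap φ (F.mod.germs s) :=
  (Equiv.ofBijective _ (PMod.germs_bijective G.isSheaf U)).apply_symm_apply _

/-- Sheaves with isomorphic stalks are isomorphic. -/
noncomputable def isoOfSt {F G : CohN} (φ : StalkMod.Iso F.st G.st) : CohN.Iso F G where
  equiv := secEquiv φ
  map_zero U := by
    refine (PMod.germs_bijective G.isSheaf U).1 ?_
    rw [germs_secEquiv]
    refine Subtype.ext (funext fun x => ?_)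
    change φ.e x.1 (F.mod.res _ 0) = G.mod.res _ 0
    rw [F.mod.res_zero, G.mod.res_zero]
    exact φ.map_zero x.1
  map_smul U a s := by
    refine (PMod.germs_bijective G.isSheaf U).1 ?_
    rw [germs_secEquiv]
    refine Subtype.ext (funext fun x => ?_)
    have h := congrFun (congrArg Subtype.val (germs_secEquiv φ s)) x
    change G.mod.res _ (secEquiv φ U s) = φ.e x.1 (F.mod.res _ s) at h
    change φ.e x.1 (F.mod.res _ (a • s)) = G.mod.res _ (a • secEquiv φ U s)
    rw [F.mod.res_smul, G.mod.res_smul, iso_smul, h]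
  map_res {U V} h s := by
    refine (PMod.germs_bijective G.isSheaf U).1 ?_
    rw [germs_secEquiv]
    refine Subtype.ext (funext fun x => ?_)
    have h' := congrFun (congrArg Subtype.val (germs_secEquiv φ s)) ⟨x.1, h x.2⟩
    change G.mod.res _ (secEquiv φ V s) = φ.e x.1 (F.mod.res _ s) at h'
    change φ.e x.1 (F.mod.res _ (F.mod.res h s)) = G.mod.res _ (G.mod.res h (secEquiv φ V s))
    rw [F.mod.res_res, G.mod.res_res, h']

/-- An isomorphism of stalks acts on families of germs, hence on sections over every open set. -/
theorem cls_eq {F G : CohN} : F.cls = G.cls ↔ Nonempty (StalkMod.Iso F.st G.st) :=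
  ⟨fun h => (Quotient.exact h).map Iso.st, fun ⟨φ⟩ => Quotient.sound ⟨isoOfSt φ⟩⟩

end CohN

namespace StalkMod

/-- The finitely generated subsystems. -/
abbrev CSub (P : StalkMod) : Type := {S : P.Sub // S.obj.Fin}

end StalkMod

/-! ### Subsheaves, quotients and direct sums on stalks -/

namespace CohN

/-- The stalks of a subsheaf. -/
def subSt {F : CohN} (N : F.mod.Sub) : F.st.Sub where
  carrier x := N.carrier (nb x)
  zero_mem _ := N.zero_mem _
  op_mem h a _ hm := N.smul_mem _ a (N.res_mem h hm)

/-- The subsheaf with given stalks. -/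
def subOfSt {F : CohN} (S : F.st.Sub) : F.mod.Sub where
  carrier U := {s | ∀ (x : P1) (hx : x ∈ U), F.mod.res (nb_le hx) s ∈ S.carrier x}
  zero_mem U x hx := by rw [F.mod.res_zero]; exact S.zero_mem x
  smul_mem U a s hs x hx := by
    rw [F.mod.res_smul]
    have := S.op_mem le_rfl (O.res (nb_le hx) a) (hs x hx)
    change O.res _ a • F.mod.res le_rfl (F.mod.res _ s) ∈ _ at this
    rwa [F.mod.res_self] at this
  res_mem h s hs x hx := by
    rw [F.mod.res_res]
    exact hs x (h hx)
  isLocal ι U s hs x hx := by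
    obtain ⟨i, hi⟩ := Opens.mem_iSup.1 hx
    have := hs i x hi
    rwa [F.mod.res_res] at this

theorem subSt_subOfSt {F : CohN} (S : F.st.Sub) : subSt (subOfSt S) = S := by
  refine StalkMod.Sub.ext' fun x m => ⟨fun h => ?_, fun h y hy => ?_⟩
  · have := h x (mem_nb x)
    rwa [F.mod.res_self] at this
  · have := S.op_mem (nb_le hy) 1 h
    change (1 : O (nb y)) • F.mod.res _ _ ∈ _ at this
    rwa [one_smul] at this

theorem subOfSt_subSt {F : CohN} (N : F.mod.Sub) : subOfSt (subSt N) = N := by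
  refine PMod.Sub.ext (funext fun U => Set.ext fun s => ⟨fun h => ?_, fun h x hx => ?_⟩)
  · exact N.mem_of_cover (fun x : U => nb x.1) (iSup_nb U) s fun x => h x.1 x.2
  · exact N.res_mem _ h

/-- The injectivity half of the localization condition is inherited from `F`, and finite generation
in the sense of `StalkMod.Fin` contains the other half. -/
theorem isCoherent_iff {F : CohN} (N : F.mod.Sub) :
    N.toPMod.IsCoherent ↔ (subSt N).obj.Fin := by
  refine ⟨fun h => h.fin, fun h => PMod.isCoherent_of_fin h fun x m m' e => ?_⟩
  obtain ⟨a, ha, e'⟩ := F.isCoherent.inj x m.1 m'.1 (congrArg Subtype.val e)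
  exact ⟨a, ha, Subtype.ext e'⟩

/-- Coherent subsheaves are the same as finitely generated subsystems of the stalks. -/
def subEquiv (F : CohN) : F.Sub ≃ F.st.CSub where
  toFun N := ⟨subSt N.sub, (isCoherent_iff _).1 N.isCoherent⟩
  invFun S := ⟨subOfSt S.1, (isCoherent_iff _).2 (by rw [subSt_subOfSt]; exact S.2)⟩
  left_inv N := CohN.Sub.ext (subOfSt_subSt N.sub)
  right_inv S := Subtype.ext (subSt_subOfSt S.1)

/-- The stalks of a coherent subsheaf. -/
def objSt {F : CohN} (N : F.Sub) : StalkMod.Iso N.obj.st (F.subEquiv N).1.obj :=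
  ⟨fun _ => Equiv.refl _, fun _ _ _ => rfl⟩

/-- The stalks of a quotient. -/
noncomputable def quotSt {F : CohN} (N : F.Sub) : StalkMod.Iso N.quot.st (F.subEquiv N).1.quot :=
  N.sub.preQuot.stSheafify.symm.trans ⟨fun _ => Equiv.refl _, fun h a m => by
    obtain ⟨m, rfl⟩ := m.exists_rep
    rfl⟩

/-- The stalks of a direct sum. -/
noncomputable def sumSt (F G : CohN) : StalkMod.Iso (F.sum G).st (F.st.sum G.st) :=
  (PMod.preSum F.mod G.mod).stSheafify.symm.trans ⟨fun _ => Equiv.refl _, fun _ _ _ => rfl⟩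

end CohN

/-! ### Isomorphism classes attached to stalk systems -/

namespace StalkMod

/-- The stalk systems of normal coherent sheaves. -/
def Good (P : StalkMod) : Prop := ∃ F : CohN, Nonempty (Iso F.st P)

open scoped Classical in
/-- The isomorphism class of sheaves with given stalks. -/
noncomputable def cl (P : StalkMod) : IsoCl :=
  -- Systems not coming from a sheaf receive the class of the zero sheaf, only to make `cl` total.
  if h : P.Good then h.choose.cls else zeroSheaf.cls

variable {P Q : StalkMod}

theorem Good.of_iso (h : P.Good) (φ : Iso P Q) : Q.Good := by
  obtain ⟨F, ⟨ψ⟩⟩ := h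
  exact ⟨F, ⟨ψ.trans φ⟩⟩

theorem cl_eq_cls {F : CohN} (φ : Iso F.st P) : P.cl = F.cls := by
  have h : P.Good := ⟨F, ⟨φ⟩⟩
  rw [cl, dif_pos h, CohN.cls_eq]
  exact ⟨h.choose_spec.some.trans φ.symm⟩

theorem cl_st (F : CohN) : F.st.cl = F.cls := cl_eq_cls (Iso.refl _)

theorem good_st (F : CohN) : F.st.Good := ⟨F, ⟨Iso.refl _⟩⟩

theorem Good.cl_eq_iff (hP : P.Good) (hQ : Q.Good) : P.cl = Q.cl ↔ Nonempty (Iso P Q) := by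
  obtain ⟨F, ⟨φ⟩⟩ := hP
  obtain ⟨G, ⟨ψ⟩⟩ := hQ
  rw [cl_eq_cls φ, cl_eq_cls ψ, CohN.cls_eq]
  exact ⟨fun ⟨e⟩ => ⟨φ.symm.trans (e.trans ψ)⟩, fun ⟨e⟩ => ⟨φ.trans (e.trans ψ.symm)⟩⟩

theorem cl_congr (φ : Iso P Q) : P.cl = Q.cl := by
  by_cases h : P.Good
  · exact (h.cl_eq_iff (h.of_iso φ)).2 ⟨φ⟩
  · have h' : ¬ Q.Good := fun h' => h (h'.of_iso φ.symm)
    rw [cl, cl, dif_neg h, dif_neg h']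

theorem exists_good (c : IsoCl) : ∃ P : StalkMod, P.Good ∧ P.cl = c := by
  obtain ⟨F, rfl⟩ := Quotient.exists_rep c
  exact ⟨F.st, good_st F, cl_st F⟩

theorem Good.fin (h : P.Good) : P.Fin := by
  obtain ⟨F, ⟨φ⟩⟩ := h
  exact F.st_fin.of_iso φ

theorem Good.normal (h : P.Good) : P.Normal := by
  obtain ⟨F, ⟨φ⟩⟩ := h
  exact F.st_normal.of_iso φ

theorem Good.torsion (h : P.Good) : P.Torsion := by
  obtain ⟨F, ⟨φ⟩⟩ := h
  exact F.st_torsion.of_iso φ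

namespace Iso

/-- The image of a subsystem under an isomorphism. -/
def mapSub (φ : Iso P Q) (S : P.Sub) : Q.Sub where
  carrier x := {m | (φ.e x).symm m ∈ S.carrier x}
  zero_mem x := by
    change φ.symm.e x 0 ∈ S.carrier x
    rw [φ.symm.map_zero]; exact S.zero_mem x
  op_mem {_ y} h a m hm := by
    change φ.symm.e y (Q.op h a m) ∈ S.carrier y
    rw [φ.symm.map_op]
    exact S.op_mem h a hm

theorem mapSub_symm (φ : Iso P Q) (S : P.Sub) : φ.symm.mapSub (φ.mapSub S) = S :=
  Sub.ext' fun x m => by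
    change (φ.e x).symm (φ.e x m) ∈ S.carrier x ↔ _
    rw [Equiv.symm_apply_apply]

/-- The image is isomorphic to the subsystem. -/
def mapObj (φ : Iso P Q) (S : P.Sub) : Iso S.obj (φ.mapSub S).obj where
  e x := (φ.e x).subtypeEquiv fun m => by
    change _ ↔ (φ.e x).symm (φ.e x m) ∈ S.carrier x
    rw [Equiv.symm_apply_apply]
  map_op h a m := Subtype.ext (φ.map_op h a m.1)

/-- The induced isomorphism of quotients. -/
noncomputable def mapQuot (φ : Iso P Q) (S : P.Sub) : Iso S.quot (φ.mapSub S).quot :=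
  ofBijective (fun x => CollapseQuot.map (φ.e x) fun m hm => by
      change (φ.e x).symm (φ.e x m) ∈ S.carrier x
      rwa [Equiv.symm_apply_apply])
    (fun x => by
      constructor
      · intro q q' h
        obtain ⟨m, rfl⟩ := S.proj_surjective x q
        obtain ⟨m', rfl⟩ := S.proj_surjective x q'
        rcases CollapseQuot.mk_eq.1 h with h | h
        · rw [(φ.e x).injective h]
        · refine S.proj_eq.2 (Or.inr ?_)
          have h1 : (φ.e x).symm (φ.e x m) ∈ S.carrier x := h.1
          have h2 : (φ.e x).symm (φ.e x m') ∈ S.carrier x := h.2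
          rw [Equiv.symm_apply_apply] at h1 h2
          exact ⟨h1, h2⟩
      · intro q
        obtain ⟨m, rfl⟩ := (φ.mapSub S).proj_surjective x q
        exact ⟨S.proj ((φ.e x).symm m),
          congrArg (φ.mapSub S).proj ((φ.e x).apply_symm_apply m)⟩)
    (fun h a q => by
      obtain ⟨m, rfl⟩ := S.proj_surjective _ q
      exact congrArg (φ.mapSub S).proj (φ.map_op h a m))

/-- Isomorphisms transport finitely generated subsystems. -/
def csub (φ : Iso P Q) : P.CSub ≃ Q.CSub where
  toFun S := ⟨φ.mapSub S.1, S.2.of_iso (φ.mapObj S.1)⟩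
  invFun S := ⟨φ.symm.mapSub S.1, S.2.of_iso (φ.symm.mapObj S.1)⟩
  left_inv S := Subtype.ext (φ.mapSub_symm S.1)
  right_inv S := Subtype.ext (φ.symm.mapSub_symm S.1)

end Iso

/-- Realises a subsystem and its quotient at once by a coherent subsheaf of one sheaf, so that facts
about sheaves (coherence of subobjects and quotients, relations in `K0`) pass to stalk systems. -/
theorem Good.exists_sub (hP : P.Good) (S : P.CSub) : ∃ (F : CohN) (N : F.Sub),
    Nonempty (Iso F.st P) ∧ Nonempty (Iso N.obj.st S.1.obj) ∧
      Nonempty (Iso N.quot.st S.1.quot) := by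
  obtain ⟨F, ⟨φ⟩⟩ := hP
  obtain ⟨N, hN⟩ := F.subEquiv.surjective (φ.symm.csub S)
  refine ⟨F, N, ⟨φ⟩, ⟨(CohN.objSt N).trans ?_⟩, ⟨(CohN.quotSt N).trans ?_⟩⟩
  · rw [hN]; exact (φ.symm.mapObj S.1).symm
  · rw [hN]; exact (φ.symm.mapQuot S.1).symm

theorem Good.obj (hP : P.Good) (S : P.CSub) : S.1.obj.Good := by
  obtain ⟨F, N, -, ⟨φ⟩, -⟩ := hP.exists_sub S
  exact ⟨N.obj, ⟨φ⟩⟩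

theorem Good.quot (hP : P.Good) (S : P.CSub) : S.1.quot.Good := by
  obtain ⟨F, N, -, -, ⟨φ⟩⟩ := hP.exists_sub S
  exact ⟨N.quot, ⟨φ⟩⟩

end StalkMod

end HallP1

namespace HallP1

open TopologicalSpace

namespace StalkMod

variable {P Q R P' Q' : StalkMod}

/-! ### Lattice of subsystems -/

namespace Sub

instance : PartialOrder P.Sub where
  le S T := ∀ x, S.carrier x ⊆ T.carrier x
  le_refl _ _ := subset_rfl
  le_trans _ _ _ h h' x := (h x).trans (h' x)
  le_antisymm _ _ h h' := Sub.ext (funext fun x => (h x).antisymm (h' x))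

/-- The intersection of `S` with `T`, as a subsystem of `T`. -/
def inner (S T : P.Sub) : T.obj.Sub where
  carrier x := {m | m.1 ∈ S.carrier x}
  zero_mem x := S.zero_mem x
  op_mem h a _ hm := S.op_mem h a hm

/-- A subsystem of a subsystem. -/
def outer (T : P.Sub) (S : T.obj.Sub) : P.Sub where
  carrier x := {m | ∃ h : m ∈ T.carrier x, (⟨m, h⟩ : T.obj.M x) ∈ S.carrier x}
  zero_mem x := ⟨T.zero_mem x, S.zero_mem x⟩
  op_mem h a _ hm := ⟨T.op_mem h a hm.1, S.op_mem h a hm.2⟩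

theorem outer_le (T : P.Sub) (S : T.obj.Sub) : T.outer S ≤ T := fun _ _ h => h.1

theorem inner_outer (T : P.Sub) (S : T.obj.Sub) : (T.outer S).inner T = S :=
  Sub.ext' fun _ m => ⟨fun h => h.2, fun h => ⟨m.2, h⟩⟩

theorem outer_inner {S T : P.Sub} (h : S ≤ T) : T.outer (S.inner T) = S :=
  Sub.ext' fun x _ => ⟨fun h' => h'.2, fun h' => ⟨h x h', h'⟩⟩

/-- A subsystem contained in another one does not change when regarded inside it. -/
noncomputable def innerObj {S T : P.Sub} (h : S ≤ T) : Iso (S.inner T).obj S.obj :=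
  Iso.ofBijective (fun _ m => ⟨m.1.1, m.2⟩)
    (fun x => ⟨fun _ _ e => Subtype.ext (Subtype.ext (congrArg (fun z : S.obj.M x => z.1) e)),
      fun m => ⟨⟨⟨m.1, h x m.2⟩, m.2⟩, rfl⟩⟩)
    (fun _ _ _ => rfl)

variable (S : P.Sub)

/-- The preimage in `P` of a subsystem of a quotient of `P`. -/
def preimage (L : S.quot.Sub) : P.Sub where
  carrier x := {m | S.proj m ∈ L.carrier x}
  zero_mem x := L.zero_mem x
  op_mem h a _ hm := L.op_mem h a hm

theorem le_preimage (L : S.quot.Sub) : S ≤ S.preimage L := fun x m hm => by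
  change S.proj m ∈ L.carrier x
  rw [S.proj_eq_zero.2 hm]
  exact L.zero_mem x

/-- The image in a quotient. -/
def image (T : P.Sub) : S.quot.Sub where
  carrier x := S.proj '' T.carrier x
  zero_mem x := ⟨0, T.zero_mem x, rfl⟩
  op_mem h a _ hm := by
    obtain ⟨m, hm, rfl⟩ := hm
    exact ⟨_, T.op_mem h a hm, rfl⟩

theorem image_preimage (L : S.quot.Sub) : S.image (S.preimage L) = L := by
  refine Sub.ext' fun x q => ⟨?_, fun h => ?_⟩
  · rintro ⟨m, hm, rfl⟩; exact hm
  · obtain ⟨m, rfl⟩ := S.proj_surjective x q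
    exact ⟨m, h, rfl⟩

theorem preimage_image {T : P.Sub} (h : S ≤ T) : S.preimage (S.image T) = T := by
  refine Sub.ext' fun x m => ⟨?_, fun hm => ⟨m, hm, rfl⟩⟩
  rintro ⟨m', hm', e⟩
  rcases S.proj_eq.1 e with rfl | e
  · exact hm'
  · exact h x e.2

/-- The quotient of a quotient. -/
noncomputable def quotQuot (L : S.quot.Sub) : Iso L.quot (S.preimage L).quot :=
  (Iso.ofBijective (P := (S.preimage L).quot) (Q := L.quot)
    (fun x => Quotient.lift (fun m => L.proj (S.proj m)) (by
      rintro m m' (rfl | h)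
      · rfl
      · exact L.proj_eq.2 (Or.inr h)))
    (fun x => by
      constructor
      · intro q q' e
        obtain ⟨m, rfl⟩ := (S.preimage L).proj_surjective x q
        obtain ⟨m', rfl⟩ := (S.preimage L).proj_surjective x q'
        rcases L.proj_eq.1 e with e | e
        · rcases S.proj_eq.1 e with rfl | e
          · rfl
          · exact (S.preimage L).proj_eq.2
              (Or.inr ⟨S.le_preimage L x e.1, S.le_preimage L x e.2⟩)
        · exact (S.preimage L).proj_eq.2 (Or.inr e)
      · intro q
        obtain ⟨q, rfl⟩ := L.proj_surjective x q
        obtain ⟨m, rfl⟩ := S.proj_surjective x q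
        exact ⟨(S.preimage L).proj m, rfl⟩)
    (fun h a q => by
      obtain ⟨m, rfl⟩ := (S.preimage L).proj_surjective _ q
      rfl)).symm

/-- A subsystem of a quotient is a quotient of its preimage. -/
noncomputable def quotObj (L : S.quot.Sub) : Iso (S.inner (S.preimage L)).quot L.obj :=
  Iso.ofBijective
    (fun x => Quotient.lift (fun m => (⟨S.proj m.1, m.2⟩ : L.obj.M x)) (by
      rintro m m' (rfl | h)
      · rfl
      · exact Subtype.ext (S.proj_eq.2 (Or.inr h))))
    (fun x => by
      constructor
      · intro q q' e
        obtain ⟨m, rfl⟩ := (S.inner (S.preimage L)).proj_surjective x q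
        obtain ⟨m', rfl⟩ := (S.inner (S.preimage L)).proj_surjective x q'
        rcases S.proj_eq.1 (congrArg Subtype.val e) with e | e
        · rw [Subtype.ext e]
        · exact (S.inner (S.preimage L)).proj_eq.2 (Or.inr e)
      · rintro ⟨q, hq⟩
        obtain ⟨m, rfl⟩ := S.proj_surjective x q
        exact ⟨(S.inner (S.preimage L)).proj ⟨m, hq⟩, rfl⟩)
    (fun h a q => by
      obtain ⟨m, rfl⟩ := (S.inner (S.preimage L)).proj_surjective _ q
      rfl)

/-- The zero subsystem. -/
def bot (P : StalkMod) : P.Sub where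
  carrier _ := {0}
  zero_mem _ := rfl
  op_mem h a m hm := by
    rw [Set.mem_singleton_iff] at hm ⊢
    rw [hm, P.op_zero]

/-- The full subsystem. -/
def top (P : StalkMod) : P.Sub where
  carrier _ := Set.univ
  zero_mem _ := trivial
  op_mem _ _ _ _ := trivial

noncomputable def topObj (P : StalkMod) : Iso (top P).obj P :=
  Iso.ofBijective (fun _ m => m.1)
    (fun _ => ⟨Subtype.val_injective, fun m => ⟨⟨m, trivial⟩, rfl⟩⟩) (fun _ _ _ => rfl)

noncomputable def botQuot (P : StalkMod) : Iso P (bot P).quot :=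
  Iso.ofBijective (fun _ m => (bot P).proj m)
    (fun x => ⟨fun m m' e => by
        rcases (bot P).proj_eq.1 e with e | e
        · exact e
        · exact (Set.mem_singleton_iff.1 e.1).trans (Set.mem_singleton_iff.1 e.2).symm,
      (bot P).proj_surjective x⟩) (fun _ _ _ => rfl)

end Sub

/-- A stalk system with no nonzero elements. -/
def IsZero (P : StalkMod) : Prop := ∀ x (m : P.M x), m = 0

theorem IsZero.of_iso (h : P.IsZero) (φ : Iso P Q) : Q.IsZero := fun x m => by
  have := h x ((φ.e x).symm m)
  rw [Equiv.symm_apply_eq, φ.map_zero] at this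
  exact this

/-- Any two zero systems are isomorphic. -/
noncomputable def IsZero.iso (hP : P.IsZero) (hQ : Q.IsZero) : Iso P Q :=
  Iso.ofBijective (fun _ _ => 0)
    (fun x => ⟨fun m m' _ => (hP x m).trans (hP x m').symm, fun m => ⟨0, (hQ x m).symm⟩⟩)
    (fun h a _ => (Q.op_zero h a).symm)

theorem isZero_zeroSheaf : zeroSheaf.st.IsZero := fun _ _ => rfl

theorem Good.cl_eq_zero_iff (hP : P.Good) : P.cl = zeroSheaf.cls ↔ P.IsZero := by
  rw [← cl_st, hP.cl_eq_iff (good_st _)]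
  exact ⟨fun ⟨φ⟩ => isZero_zeroSheaf.of_iso φ.symm, fun h => ⟨h.iso isZero_zeroSheaf⟩⟩

theorem Sub.quot_isZero_iff (S : P.Sub) : S.quot.IsZero ↔ S = top P := by
  constructor
  · exact fun h => Sub.ext' fun x m => ⟨fun _ => trivial, fun _ => S.proj_eq_zero.1 (h x _)⟩
  · rintro rfl x q
    obtain ⟨m, rfl⟩ := (top P).proj_surjective x q
    exact (top P).proj_eq_zero.2 trivial

theorem Sub.obj_isZero_iff (S : P.Sub) : S.obj.IsZero ↔ S = bot P := by
  constructor
  · refine fun h => Sub.ext' fun x m => ⟨fun hm => congrArg Subtype.val (h x ⟨m, hm⟩), ?_⟩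
    rintro rfl
    exact S.zero_mem x
  · rintro rfl x m
    exact Subtype.ext m.2

/-! ### Finitely generated subsystems of subsystems and quotients -/

/-- Finitely generated subsystems of a subsystem. -/
def csubObj (T : P.CSub) : T.1.obj.CSub ≃ {S : P.CSub // S.1 ≤ T.1} where
  toFun S := ⟨⟨T.1.outer S.1, by
    have := S.2
    rw [← T.1.inner_outer S.1] at this
    exact this.of_iso (Sub.innerObj (T.1.outer_le S.1))⟩, T.1.outer_le S.1⟩
  invFun S := ⟨S.1.1.inner T.1, S.1.2.of_iso (Sub.innerObj S.2).symm⟩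
  left_inv S := Subtype.ext (T.1.inner_outer S.1)
  right_inv S := Subtype.ext (Subtype.ext (Sub.outer_inner S.2))

/-- Finitely generated subsystems of a quotient. -/
def csubQuot (S : P.CSub) : S.1.quot.CSub ≃ {T : P.CSub // S.1 ≤ T.1} where
  -- The preimage is an extension of `L` by `S`, hence finitely generated.
  toFun L := ⟨⟨S.1.preimage L.1, (S.1.inner (S.1.preimage L.1)).fin_of_extension
    (S.2.of_iso (Sub.innerObj (S.1.le_preimage L.1)).symm)
    (L.2.of_iso (S.1.quotObj L.1).symm)⟩, S.1.le_preimage L.1⟩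
  invFun T := ⟨S.1.image T.1.1, T.1.2.of_surjective
    (fun _ m => ⟨S.1.proj m.1, ⟨m.1, m.2, rfl⟩⟩)
    (fun x => by
      rintro ⟨_, m, hm, rfl⟩
      exact ⟨⟨m, hm⟩, rfl⟩) (fun _ _ _ => rfl)⟩
  left_inv L := Subtype.ext (S.1.image_preimage L.1)
  right_inv T := Subtype.ext (Subtype.ext (S.1.preimage_image T.2))

theorem cl_obj_csubObj (T : P.CSub) (S : {S : P.CSub // S.1 ≤ T.1}) :
    ((csubObj T).symm S).1.obj.cl = S.1.1.obj.cl := cl_congr (Sub.innerObj S.2)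

theorem cl_quot_csubQuot (S : P.CSub) (T : {T : P.CSub // S.1 ≤ T.1}) :
    ((csubQuot S).symm T).1.quot.cl = T.1.1.quot.cl := by
  refine (cl_congr (S.1.quotQuot _)).trans ?_
  change ((csubQuot S) ((csubQuot S).symm T)).1.1.quot.cl = _
  rw [Equiv.apply_symm_apply]

theorem cl_obj_csubQuot (S : P.CSub) (T : {T : P.CSub // S.1 ≤ T.1}) :
    ((csubQuot S).symm T).1.obj.cl = (S.1.inner T.1.1).quot.cl := by
  refine (cl_congr (S.1.quotObj _).symm).trans ?_
  change (S.1.inner ((csubQuot S) ((csubQuot S).symm T)).1.1).quot.cl = _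
  rw [Equiv.apply_symm_apply]

/-- The zero subsystem is finitely generated. -/
def CSub.bot (P : StalkMod) : P.CSub := ⟨Sub.bot P, fun _ => ⟨{0}, fun _ _ _ => ⟨1, 0,
  Finset.mem_singleton_self _, by
    rw [(Sub.bot P).obj.op_zero]
    exact (Sub.bot P).obj_isZero_iff.2 rfl _ _⟩⟩⟩

/-- The full subsystem. -/
noncomputable def CSub.top (hP : P.Fin) : P.CSub := ⟨Sub.top P, hP.of_iso (Sub.topObj P).symm⟩

theorem CSub.bot_val (P : StalkMod) : (CSub.bot P).1 = Sub.bot P := rfl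

theorem CSub.top_val (hP : P.Fin) : (CSub.top hP).1 = Sub.top P := rfl

/-! ### Direct sums -/

/-- Functoriality of sums. -/
def sumCongr (φ : Iso P P') (ψ : Iso Q Q') : Iso (P.sum Q) (P'.sum Q') where
  e x := ((φ.e x).prodCongr (ψ.e x)).subtypeEquiv fun p => by
    change _ ↔ φ.e x p.1 = 0 ∨ ψ.e x p.2 = 0
    rw [φ.map_eq_zero, ψ.map_eq_zero]
  map_op h a m := Subtype.ext (Prod.ext (φ.map_op h a m.1.1) (ψ.map_op h a m.1.2))

theorem Good.sum (hP : P.Good) (hQ : Q.Good) : (P.sum Q).Good := by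
  obtain ⟨F, ⟨φ⟩⟩ := hP
  obtain ⟨G, ⟨ψ⟩⟩ := hQ
  exact ⟨F.sum G, ⟨(F.sumSt G).trans (sumCongr φ ψ)⟩⟩

def sumComm (P Q : StalkMod) : Iso (P.sum Q) (Q.sum P) where
  e _ := (Equiv.prodComm _ _).subtypeEquiv fun _ => or_comm
  map_op _ _ _ := rfl

def sumAssoc (P Q R : StalkMod) : Iso ((P.sum Q).sum R) (P.sum (Q.sum R)) where
  e x :=
    { toFun := fun p => ⟨(p.1.1.1.1, ⟨(p.1.1.1.2, p.1.2), by
        rcases p.2 with h | h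
        · left; change p.1.1.1.2 = 0; rw [h]; rfl
        · exact Or.inr h⟩), by
        rcases p.2 with h | h
        · left; change p.1.1.1.1 = 0; rw [h]; rfl
        · rcases p.1.1.2 with h' | h'
          · exact Or.inl h'
          · exact Or.inr (Subtype.ext (Prod.ext h' h))⟩
      invFun := fun p => ⟨(⟨(p.1.1, p.1.2.1.1), by
        rcases p.2 with h | h
        · exact Or.inl h
        · right; change p.1.2.1.1 = 0; rw [h]; rfl⟩, p.1.2.1.2), by
        rcases p.2 with h | h
        · rcases p.1.2.2 with h' | h'
          · exact Or.inl (Subtype.ext (Prod.ext h h'))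
          · exact Or.inr h'
        · right; change p.1.2.1.2 = 0; rw [h]; rfl⟩
      left_inv := fun _ => rfl
      right_inv := fun _ => rfl }
  map_op _ _ _ := rfl

/-- Adding a zero system changes nothing. -/
def sumZero (hQ : Q.IsZero) : Iso (P.sum Q) P where
  e x :=
    { toFun := fun p => p.1.1
      invFun := fun m => ⟨(m, 0), Or.inr rfl⟩
      left_inv := fun _ => Subtype.ext (Prod.ext rfl (hQ x _).symm)
      right_inv := fun _ => rfl }
  map_op _ _ _ := rfl

theorem sum_isZero_iff : (P.sum Q).IsZero ↔ P.IsZero ∧ Q.IsZero := by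
  constructor
  · intro h
    refine ⟨fun x m => ?_, fun x m => ?_⟩
    · exact congrArg (fun p => p.1.1) (h x ⟨(m, 0), Or.inr rfl⟩)
    · exact congrArg (fun p => p.1.2) (h x ⟨(0, m), Or.inl rfl⟩)
  · rintro ⟨h1, h2⟩ x p
    exact Subtype.ext (Prod.ext (h1 x _) (h2 x _))

theorem Fin.sum (hP : P.Fin) (hQ : Q.Fin) : (P.sum Q).Fin := by
  classical
  intro x
  obtain ⟨G, hG⟩ := hP x
  obtain ⟨G', hG'⟩ := hQ x
  let i : P.M x → (P.sum Q).M x := fun m => ⟨(m, 0), Or.inr rfl⟩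
  let j : Q.M x → (P.sum Q).M x := fun m => ⟨(0, m), Or.inl rfl⟩
  refine ⟨G.image i ∪ G'.image j, fun y h p => ?_⟩
  rcases p.2 with e | e
  · obtain ⟨a, g, hg, e'⟩ := hG' y h p.1.2
    exact ⟨a, j g, Finset.mem_union_right _ (Finset.mem_image_of_mem _ hg),
      Subtype.ext (Prod.ext (e.trans (P.op_zero h a).symm) e')⟩
  · obtain ⟨a, g, hg, e'⟩ := hG y h p.1.1
    exact ⟨a, i g, Finset.mem_union_left _ (Finset.mem_image_of_mem _ hg),
      Subtype.ext (Prod.ext e' (e.trans (Q.op_zero h a).symm))⟩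

namespace Sub

/-- The sum of subsystems. -/
def prod (S : P.Sub) (T : Q.Sub) : (P.sum Q).Sub where
  carrier x := {p | p.1.1 ∈ S.carrier x ∧ p.1.2 ∈ T.carrier x}
  zero_mem x := ⟨S.zero_mem x, T.zero_mem x⟩
  op_mem h a _ hm := ⟨S.op_mem h a hm.1, T.op_mem h a hm.2⟩

/-- The first component of a subsystem of a sum. -/
def fst (U : (P.sum Q).Sub) : P.Sub where
  carrier x := {m | (⟨(m, 0), Or.inr rfl⟩ : (P.sum Q).M x) ∈ U.carrier x}
  zero_mem x := U.zero_mem x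
  op_mem h a m hm := by
    have := U.op_mem h a hm
    have e : (P.sum Q).op h a ⟨(m, 0), Or.inr rfl⟩ = ⟨(P.op h a m, 0), Or.inr rfl⟩ :=
      Subtype.ext (Prod.ext rfl (Q.op_zero h a))
    rw [e] at this
    exact this

/-- The second component of a subsystem of a sum. -/
def snd (U : (P.sum Q).Sub) : Q.Sub where
  carrier x := {m | (⟨(0, m), Or.inl rfl⟩ : (P.sum Q).M x) ∈ U.carrier x}
  zero_mem x := U.zero_mem x
  op_mem h a m hm := by
    have := U.op_mem h a hm
    have e : (P.sum Q).op h a ⟨(0, m), Or.inl rfl⟩ = ⟨(0, Q.op h a m), Or.inl rfl⟩ :=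
      Subtype.ext (Prod.ext (P.op_zero h a) rfl)
    rw [e] at this
    exact this

theorem fst_prod (S : P.Sub) (T : Q.Sub) : (S.prod T).fst = S :=
  Sub.ext' fun x _ => ⟨fun h => h.1, fun h => ⟨h, T.zero_mem x⟩⟩

theorem snd_prod (S : P.Sub) (T : Q.Sub) : (S.prod T).snd = T :=
  Sub.ext' fun x _ => ⟨fun h => h.2, fun h => ⟨S.zero_mem x, h⟩⟩

/-- Each point of a wedge lies on one of the two axes, so there are no diagonal subobjects. The
compatibility of product and coproduct rests on this. -/
theorem prod_fst_snd (U : (P.sum Q).Sub) : U.fst.prod U.snd = U := by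
  refine Sub.ext' fun x p => ?_
  obtain ⟨⟨m, n⟩, hp⟩ := p
  rcases hp with h | h
  · change m = 0 at h
    subst h
    exact ⟨fun h => h.2, fun h => ⟨U.zero_mem x, h⟩⟩
  · change n = 0 at h
    subst h
    exact ⟨fun h => h.1, fun h => ⟨h, U.zero_mem x⟩⟩

/-- The sum of subsystems is the sum of the systems. -/
noncomputable def prodObj (S : P.Sub) (T : Q.Sub) : Iso (S.prod T).obj (S.obj.sum T.obj) :=
  Iso.ofBijective
    (fun x p => ⟨(⟨p.1.1.1, p.2.1⟩, ⟨p.1.1.2, p.2.2⟩), by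
      rcases p.1.2 with h | h
      · exact Or.inl (Subtype.ext h)
      · exact Or.inr (Subtype.ext h)⟩)
    (fun x => by
      constructor
      · intro p p' e
        refine Subtype.ext (Subtype.ext (Prod.ext ?_ ?_))
        · exact congrArg (fun p => p.1.1.1) e
        · exact congrArg (fun p => p.1.2.1) e
      · intro p
        refine ⟨⟨⟨(p.1.1.1, p.1.2.1), ?_⟩, p.1.1.2, p.1.2.2⟩, rfl⟩
        rcases p.2 with h | h
        · exact Or.inl (congrArg Subtype.val h)
        · exact Or.inr (congrArg Subtype.val h))
    (fun _ _ _ => rfl)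

/-- The quotient of a sum. -/
noncomputable def prodQuot (S : P.Sub) (T : Q.Sub) : Iso (S.prod T).quot (S.quot.sum T.quot) :=
  Iso.ofBijective
    (fun x => Quotient.lift (fun p => (⟨(S.proj p.1.1, T.proj p.1.2), by
        rcases p.2 with h | h
        · left; change S.proj p.1.1 = 0; rw [h]; rfl
        · right; change T.proj p.1.2 = 0; rw [h]; rfl⟩ : (S.quot.sum T.quot).M x)) (by
      rintro p p' (rfl | h)
      · rfl
      · exact Subtype.ext (Prod.ext (S.proj_eq.2 (Or.inr ⟨h.1.1, h.2.1⟩))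
          (T.proj_eq.2 (Or.inr ⟨h.1.2, h.2.2⟩)))))
    (fun x => by
      constructor
      · intro q q' e
        obtain ⟨p, rfl⟩ := (S.prod T).proj_surjective x q
        obtain ⟨p', rfl⟩ := (S.prod T).proj_surjective x q'
        have e1 : S.proj p.1.1 = S.proj p'.1.1 := congrArg (fun p => p.1.1) e
        have e2 : T.proj p.1.2 = T.proj p'.1.2 := congrArg (fun p => p.1.2) e
        refine (S.prod T).proj_eq.2 ?_
        rcases S.proj_eq.1 e1 with h1 | h1
        · rcases T.proj_eq.1 e2 with h2 | h2
          · exact Or.inl (Subtype.ext (Prod.ext h1 h2))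
          -- The first coordinates agree and the second ones are both collapsed. If the common first
          -- coordinate is not in `S` it is nonzero, and then both second coordinates vanish.
          · by_cases hp : p.1.1 ∈ S.carrier x
            · exact Or.inr ⟨⟨hp, h2.1⟩, ⟨h1.subst (motive := fun m => m ∈ S.carrier x) hp, h2.2⟩⟩
            · have n1 : p.1.1 ≠ 0 := fun h =>
                hp (h.symm.subst (motive := fun m => m ∈ S.carrier x) (S.zero_mem x))
              have n2 : p'.1.1 ≠ 0 := fun h => n1 (h1.trans h)
              exact Or.inl (Subtype.ext (Prod.ext h1
                ((p.2.resolve_left n1).trans (p'.2.resolve_left n2).symm)))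
        · rcases T.proj_eq.1 e2 with h2 | h2
          · by_cases hp : p.1.2 ∈ T.carrier x
            · exact Or.inr ⟨⟨h1.1, hp⟩, ⟨h1.2, h2.subst (motive := fun m => m ∈ T.carrier x) hp⟩⟩
            · have n1 : p.1.2 ≠ 0 := fun h =>
                hp (h.symm.subst (motive := fun m => m ∈ T.carrier x) (T.zero_mem x))
              have n2 : p'.1.2 ≠ 0 := fun h => n1 (h2.trans h)
              exact Or.inl (Subtype.ext (Prod.ext
                ((p.2.resolve_right n1).trans (p'.2.resolve_right n2).symm) h2))
          · exact Or.inr ⟨⟨h1.1, h2.1⟩, ⟨h1.2, h2.2⟩⟩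
      · rintro ⟨⟨q, q'⟩, h | h⟩
        · change q = 0 at h
          subst h
          obtain ⟨m, rfl⟩ := T.proj_surjective x q'
          exact ⟨(S.prod T).proj ⟨(0, m), Or.inl rfl⟩, rfl⟩
        · change q' = 0 at h
          subst h
          obtain ⟨m, rfl⟩ := S.proj_surjective x q
          exact ⟨(S.prod T).proj ⟨(m, 0), Or.inr rfl⟩, rfl⟩)
    (fun h a q => by
      obtain ⟨p, rfl⟩ := (S.prod T).proj_surjective _ q
      rfl)

end Sub

theorem Fin.of_sum (h : (P.sum Q).Fin) : P.Fin :=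
  h.of_surjective (fun _ p => p.1.1) (fun _ m => ⟨⟨(m, 0), Or.inr rfl⟩, rfl⟩) fun _ _ _ => rfl

/-- Finitely generated subsystems of a sum. -/
noncomputable def csubSum (P Q : StalkMod) : P.CSub × Q.CSub ≃ (P.sum Q).CSub where
  toFun S := ⟨S.1.1.prod S.2.1, (S.1.2.sum S.2.2).of_iso (Sub.prodObj _ _).symm⟩
  invFun U :=
    have h : (U.1.fst.prod U.1.snd).obj.Fin := by rw [U.1.prod_fst_snd]; exact U.2
    (⟨U.1.fst, (h.of_iso (Sub.prodObj _ _)).of_sum⟩,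
      ⟨U.1.snd, ((h.of_iso (Sub.prodObj _ _)).of_iso (sumComm _ _)).of_sum⟩)
  left_inv S := Prod.ext (Subtype.ext (Sub.fst_prod _ _)) (Subtype.ext (Sub.snd_prod _ _))
  right_inv U := Subtype.ext U.1.prod_fst_snd

end StalkMod

end HallP1

namespace HallP1

open TopologicalSpace

namespace StalkMod

variable {P Q R A B : StalkMod}

/-! ### Finiteness -/

instance (x : P1) : MulActionWithZero (O (nb x)) (P.M x) where
  smul a m := P.op le_rfl a m
  one_smul := P.one_op
  mul_smul a b m := (P.smul_smul a b m).symm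
  smul_zero := P.op_zero le_rfl
  zero_smul := P.zero_op le_rfl

theorem op_le_rfl {x : P1} (a : O (nb x)) (m : P.M x) : P.op le_rfl a m = a • m := rfl

/-- Restriction to the generic point. -/
def rho (P : StalkMod) {x : P1} (m : P.M x) : P.M .eta := P.op (nb_eta_le x) 1 m

theorem op_eq_smul_rho {x : P1} (h : nb .eta ≤ nb x) (a : O (nb .eta)) (m : P.M x) :
    P.op h a m = a • P.rho m := P.op_eq_smul_res h a m

theorem rho_smul {x : P1} (a : O (nb x)) (m : P.M x) :
    P.rho (a • m) = O.res (nb_eta_le x) a • P.rho m := by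
  change P.op _ 1 (P.op _ a m) = _
  rw [P.op_op, op_eq_smul_rho, one_mul]

theorem rho_eta (m : P.M .eta) : P.rho m = m := P.one_op m

theorem rho_zero {x : P1} : P.rho (0 : P.M x) = 0 := P.op_zero _ _

theorem smul_eq_zero_eta {a : O (nb .eta)} (ha : a ≠ 0) {m : P.M .eta} : a • m = 0 ↔ m = 0 := by
  refine ⟨fun h => ?_, fun h => by rw [h, smul_zero]⟩
  obtain ⟨b, hb⟩ := eta_exists_inv ha
  rw [← one_smul (O (nb .eta)) m, ← hb, mul_smul, h, smul_zero]

theorem Iso.map_smul (φ : Iso P Q) {x : P1} (a : O (nb x)) (m : P.M x) :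
    φ.e x (a • m) = a • φ.e x m := φ.map_op le_rfl a m

theorem Sub.smul_mem (S : P.Sub) {x : P1} (a : O (nb x)) {m : P.M x} (h : m ∈ S.carrier x) :
    a • m ∈ S.carrier x := S.op_mem le_rfl a h

theorem Sub.rho_mem (S : P.Sub) {x : P1} {m : P.M x} (h : m ∈ S.carrier x) :
    P.rho m ∈ S.carrier .eta := S.op_mem _ 1 h

theorem Sub.smul_mem_iff_eta (S : P.Sub) {a : O (nb .eta)} (ha : a ≠ 0) {m : P.M .eta} :
    a • m ∈ S.carrier .eta ↔ m ∈ S.carrier .eta := by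
  refine ⟨fun h => ?_, S.smul_mem a⟩
  obtain ⟨b, hb⟩ := eta_exists_inv ha
  rw [← one_smul (O (nb .eta)) m, ← hb, mul_smul]
  exact S.smul_mem b h

/-- The torsion of a finitely generated system is bounded. -/
theorem Fin.exists_torsion_bound (hP : P.Fin) : ∃ k : ℕ, ∀ (x : P1) (m : P.M x),
    (∃ n : ℕ, gen x ^ n • m = 0) → gen x ^ k • m = 0 := by
  classical
  have := Fintype.ofFinite P1
  have hx : ∀ x, ∃ k : ℕ, ∀ m : P.M x, (∃ n : ℕ, gen x ^ n • m = 0) → gen x ^ k • m = 0 := by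
    intro x
    obtain ⟨G, hG⟩ := hP x
    -- The value 0 for a generator that is not torsion is harmless: if `a • g` is torsion with `a`
    -- nonzero, then `g` is torsion too.
    let N : P.M x → ℕ := fun g =>
      if h : ∃ n : ℕ, gen x ^ n • g = 0 then h.choose else 0
    have hN : ∀ g, (∃ n : ℕ, gen x ^ n • g = 0) → gen x ^ N g • g = 0 := by
      intro g h
      simp only [N, dif_pos h]
      exact h.choose_spec
    refine ⟨G.sup N, fun m hm => ?_⟩
    obtain ⟨a, g, hg, rfl⟩ := hG x le_rfl m
    rw [op_le_rfl] at hm ⊢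
    obtain ⟨n, hn⟩ := hm
    have key : (∃ n : ℕ, gen x ^ n • g = 0) → gen x ^ G.sup N • a • g = 0 := by
      intro h
      obtain ⟨j, hj⟩ := Nat.exists_eq_add_of_le (Finset.le_sup (f := N) hg)
      rw [smul_comm, hj, pow_add, mul_comm, mul_smul, hN g h, smul_zero, smul_zero]
    rcases O_cases a with rfl | ⟨j, rfl⟩ | ⟨-, j, hj⟩
    · rw [zero_smul, smul_zero]
    · exact key ⟨n + j, by rw [pow_add, mul_smul, hn]⟩
    · refine key ⟨n, ?_⟩
      have := congrArg (fun z => gen x ^ j • z) hn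
      simp only [smul_zero] at this
      rwa [← mul_smul, ← mul_smul, mul_right_comm, mul_comm (gen x ^ j) a, hj, one_mul] at this
  choose k hk using hx
  refine ⟨Finset.univ.sup k, fun x m hm => ?_⟩
  obtain ⟨j, hj⟩ := Nat.exists_eq_add_of_le (Finset.le_sup (f := k) (Finset.mem_univ x))
  rw [hj, pow_add, mul_comm, mul_smul, hk x m hm, smul_zero]

/-- Membership in `T` needs testing only on the multiples `gen x ^ j • g` with `j ≤ k`. At `η`
scalars are invertible, so `j = 0` suffices there; for large `j` the bound on the torsion of the
quotient takes over. -/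
theorem Sub.le_of_trace {S T : P.Sub} (k : ℕ) {G : ∀ x, Finset (P.M x)}
    (hG : ∀ (x : P1) (m : P.M x), ∃ a : O (nb x), ∃ g ∈ G x, m = a • g)
    (hT : T.quot.Torsion)
    (hk : ∀ (x : P1) (m : T.quot.M x), (∃ n : ℕ, gen x ^ n • m = 0) → gen x ^ k • m = 0)
    (htr : ∀ x, ∀ g ∈ G x, ∀ j ≤ k, gen x ^ j • g ∈ S.carrier x → gen x ^ j • g ∈ T.carrier x) :
    S ≤ T := by
  have hη : S.carrier .eta ⊆ T.carrier .eta := by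
    intro m hm
    obtain ⟨a, g, hg, rfl⟩ := hG _ m
    by_cases ha : a = 0
    · rw [ha, zero_smul]; exact T.zero_mem _
    · rw [S.smul_mem_iff_eta ha] at hm
      have := htr _ g hg 0 (Nat.zero_le _)
      rw [pow_zero, one_smul] at this
      exact T.smul_mem a (this hm)
  intro x m hm
  obtain ⟨a, g, hg, rfl⟩ := hG x m
  rcases O_cases a with rfl | ⟨j, rfl⟩ | ⟨rfl, -⟩
  · rw [zero_smul]; exact T.zero_mem _
  · rcases le_or_gt j k with hj | hj
    · exact htr x g hg j hj hm
    -- The element is `gen x ^ k` times `gen x ^ (i + 1) • g`. The latter lies in `T` at `η`, so its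
    -- class in the quotient is torsion and is killed by `gen x ^ k`.
    · obtain ⟨i, rfl⟩ := Nat.exists_eq_add_of_lt hj
      rw [add_assoc, pow_add, mul_smul] at hm ⊢
      have h1 := hη (S.rho_mem hm)
      rw [rho_smul, O_res_pow, T.smul_mem_iff_eta
        (O_pow_ne_zero (O_res_ne_zero _ (gen_ne_zero x)) k)] at h1
      have h2 : T.quot.op (nb_eta_le x) 1 (T.proj (gen x ^ (i + 1) • g)) = 0 :=
        T.proj_eq_zero.2 h1
      exact T.proj_eq_zero.1 (hk x _ (hT x _ h2))
  · exact hη hm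

/-- Finitely many finitely generated subsystems have a given quotient. -/
theorem Good.finite_quot (hP : P.Good) (c : IsoCl) :
    {S : P.CSub | S.1.quot.cl = c}.Finite := by
  classical
  obtain ⟨R, hR, rfl⟩ := exists_good c
  obtain ⟨k, hk⟩ := hR.fin.exists_torsion_bound
  choose G hG using hP.fin
  -- The finite test set: `k` bounds the torsion of the prescribed quotient `R`, and a subsystem
  -- with that quotient is determined by its intersection with `X`.
  let X : ∀ x, Set (P.M x) := fun x =>
    (fun p : ℕ × P.M x => gen x ^ p.1 • p.2) '' (Set.Iic k ×ˢ (G x : Set (P.M x)))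
  have hX : ∀ x, (X x).Finite := fun x =>
    ((Set.finite_Iic k).prod (G x).finite_toSet).image _
  have : ∀ x, Finite (X x) := fun x => (hX x).to_subtype
  let f : P.CSub → ∀ x, Set (X x) := fun S x => {m | m.1 ∈ S.1.carrier x}
  refine Set.Finite.of_injOn (f := f) (t := Set.univ) (fun _ _ => trivial) ?_ Set.finite_univ
  have key : ∀ S T : P.CSub, T.1.quot.cl = R.cl → f S = f T → S.1 ≤ T.1 := by
    intro S T hT he
    refine Sub.le_of_trace k (G := G) (fun x m => hG x x le_rfl m) (hP.quot T).torsion ?_ ?_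
    · obtain ⟨φ⟩ := ((hP.quot T).cl_eq_iff hR).1 hT
      rintro x m ⟨n, hn⟩
      rw [← φ.map_eq_zero, φ.map_smul]
      refine hk x _ ⟨n, ?_⟩
      rw [← φ.map_smul, hn, φ.map_zero]
    · intro x g hg j hj hm
      have h1 : (⟨gen x ^ j • g, (j, g), ⟨hj, hg⟩, rfl⟩ : X x) ∈ f S x := hm
      rw [he] at h1
      exact h1
  intro S hS T hT he
  exact Subtype.ext (le_antisymm (key S T hT he) (key T S hS he.symm))

/-! ### Extensions -/

/-- Short exact sequences of stalk systems. -/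
structure ShortExact (B P A : StalkMod) where
  i : ∀ x, B.M x → P.M x
  p : ∀ x, P.M x → A.M x
  i_op : ∀ {x y : P1} (h : nb y ≤ nb x) (a : O (nb y)) (m : B.M x),
    i y (B.op h a m) = P.op h a (i x m)
  p_op : ∀ {x y : P1} (h : nb y ≤ nb x) (a : O (nb y)) (m : P.M x),
    p y (P.op h a m) = A.op h a (p x m)
  i_inj : ∀ x, Function.Injective (i x)
  p_surj : ∀ x, Function.Surjective (p x)
  exact : ∀ {x} {m : P.M x}, p x m = 0 ↔ ∃ b, i x b = m
  p_normal : ∀ {x} {m m' : P.M x}, p x m ≠ 0 → p x m = p x m' → m = m'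

/-- The short exact sequence of a subsystem. -/
def Sub.shortExact (S : P.Sub) : ShortExact S.obj P S.quot where
  i _ m := m.1
  p _ m := S.proj m
  i_op _ _ _ := rfl
  p_op _ _ _ := rfl
  i_inj _ := Subtype.val_injective
  p_surj := S.proj_surjective
  exact {x m} := by
    rw [S.proj_eq_zero]
    exact ⟨fun h => ⟨⟨m, h⟩, rfl⟩, by rintro ⟨b, rfl⟩; exact b.2⟩
  p_normal {x m m'} h e := by
    rcases S.proj_eq.1 e with e | e
    · exact e
    · exact absurd (S.proj_eq_zero.2 e.1) h

namespace ShortExact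

variable {P' A' B' : StalkMod}

/-- Replacing the ends of a short exact sequence by isomorphic systems. -/
def congr (E : ShortExact B P A) (φ : Iso B' B) (ψ : Iso A A') : ShortExact B' P A' where
  i x m := E.i x (φ.e x m)
  p x m := ψ.e x (E.p x m)
  i_op h a m := by rw [φ.map_op, E.i_op]
  p_op h a m := by rw [E.p_op, ψ.map_op]
  i_inj x := (E.i_inj x).comp (φ.e x).injective
  p_surj x := (ψ.e x).surjective.comp (E.p_surj x)
  exact {x m} := by
    rw [ψ.map_eq_zero, E.exact]
    refine ⟨fun ⟨b, hb⟩ => ⟨(φ.e x).symm b, ?_⟩, fun ⟨b, hb⟩ => ⟨_, hb⟩⟩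
    rw [Equiv.apply_symm_apply, hb]
  p_normal {x m m'} h e := by
    rw [Ne, ψ.map_eq_zero] at h
    exact E.p_normal h ((ψ.e x).injective e)

variable (E : ShortExact B P A) (E' : ShortExact B P' A)

theorem p_i {x : P1} (b : B.M x) : E.p x (E.i x b) = 0 := E.exact.2 ⟨b, rfl⟩

theorem p_zero (x : P1) : E.p x 0 = 0 := by
  rw [← P.zero_op le_rfl 0, E.p_op, A.zero_op]

theorem i_zero (x : P1) : E.i x 0 = 0 := by
  rw [← B.zero_op le_rfl 0, E.i_op, P.zero_op]

theorem i_smul {x : P1} (a : O (nb x)) (m : B.M x) : E.i x (a • m) = a • E.i x m :=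
  E.i_op le_rfl a m

theorem p_smul {x : P1} (a : O (nb x)) (m : P.M x) : E.p x (a • m) = a • E.p x m :=
  E.p_op le_rfl a m

theorem i_rho {x : P1} (m : B.M x) : E.i _ (B.rho m) = P.rho (E.i x m) := E.i_op _ 1 m

theorem p_rho {x : P1} (m : P.M x) : E.p _ (P.rho m) = A.rho (E.p x m) := E.p_op _ 1 m

/-- The nonzero elements of the quotient that are killed by the generator. -/
def Top (A : StalkMod) (x : P1) : Type := {m : A.M x // m ≠ 0 ∧ gen x • m = 0}

/-- The elements that are zero or not divisible by the generator. -/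
def Indec (B : StalkMod) (x : P1) : Type := {n : B.M x // ∀ n', gen x • n' = n → n = 0}

/-- A nonzero `m` has a unique lift `q`, and `gen x • q` lies in `B`. If it were a nonzero multiple
`gen x • n'` with `n'` in `B`, normality would give `q = n'` and hence `m = 0`. -/
theorem exists_glue (hP : P.Normal) (x : P1) (m : Top A x) :
    ∃ n : Indec B x, ∀ q, E.p x q = m.1 → E.i x n.1 = gen x • q := by
  obtain ⟨q, hq⟩ := E.p_surj x m.1
  have h0 : E.p x (gen x • q) = 0 := by rw [E.p_smul, hq, m.2.2]
  obtain ⟨b, hb⟩ := E.exact.1 h0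
  refine ⟨⟨b, fun n' hn' => ?_⟩, fun q' hq' => ?_⟩
  · by_contra hb0
    have e : gen x • q = gen x • E.i x n' := by rw [← E.i_smul, hn', hb]
    have hne : gen x • q ≠ 0 := by
      rw [← hb, ← E.i_zero x]
      exact fun h => hb0 (E.i_inj x h)
    have := hP x x le_rfl (gen x) q (E.i x n') hne e
    refine m.2.1 ?_
    rw [← hq, this, E.p_i]
  · have : q = q' := E.p_normal (by rw [hq]; exact m.2.1) (hq.trans hq'.symm)
    rw [← this]
    exact hb

/-- The gluing datum of an extension. -/
noncomputable def glue (hP : P.Normal) (x : P1) (m : Top A x) : Indec B x :=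
  (E.exists_glue hP x m).choose

theorem glue_spec (hP : P.Normal) {x : P1} (m : Top A x) {q : P.M x} (hq : E.p x q = m.1) :
    E.i x (E.glue hP x m).1 = gen x • q := (E.exists_glue hP x m).choose_spec q hq

/-- The correspondence between the middle terms of two extensions. -/
def Rel {x : P1} (m : P.M x) (m' : P'.M x) : Prop :=
  (∃ b, E.i x b = m ∧ E'.i x b = m') ∨ (E.p x m ≠ 0 ∧ E.p x m = E'.p x m')

theorem Rel.symm {E : ShortExact B P A} {E' : ShortExact B P' A} {x : P1} {m : P.M x}
    {m' : P'.M x} (h : E.Rel E' m m') : E'.Rel E m' m := by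
  rcases h with ⟨b, h1, h2⟩ | ⟨h1, h2⟩
  · exact Or.inl ⟨b, h2, h1⟩
  · exact Or.inr ⟨h2 ▸ h1, h2.symm⟩

theorem exists_rel {x : P1} (m : P.M x) : ∃ m' : P'.M x, E.Rel E' m m' := by
  by_cases h : E.p x m = 0
  · obtain ⟨b, rfl⟩ := E.exact.1 h
    exact ⟨E'.i x b, Or.inl ⟨b, rfl, rfl⟩⟩
  · obtain ⟨m', hm'⟩ := E'.p_surj x (E.p x m)
    exact ⟨m', Or.inr ⟨h, hm'.symm⟩⟩

theorem Rel.unique {E : ShortExact B P A} {E' : ShortExact B P' A} {x : P1} {m : P.M x}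
    {m' m'' : P'.M x} (h : E.Rel E' m m') (h' : E.Rel E' m m'') : m' = m'' := by
  rcases h with ⟨b, rfl, rfl⟩ | ⟨h1, h2⟩
  · rcases h' with ⟨b', h1, rfl⟩ | ⟨h1, -⟩
    · rw [E.i_inj x h1]
    · exact absurd (E.p_i b) h1
  · rcases h' with ⟨b', rfl, -⟩ | ⟨-, h3⟩
    · exact absurd (E.p_i b') h1
    · exact E'.p_normal (h2 ▸ h1) (h2.symm.trans h3)

variable {E E'}

theorem Rel.zero (x : P1) : E.Rel E' (0 : P.M x) 0 := Or.inl ⟨0, E.i_zero x, E'.i_zero x⟩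

/-- The only products by `gen x` not already determined by `A` and `B` are those that take an
element outside `B` into `B`, and `glue` records exactly these. -/
theorem Rel.gen_smul {hP : P.Normal} {hP' : P'.Normal} (hg : E.glue hP = E'.glue hP') {x : P1}
    {m : P.M x} {m' : P'.M x} (h : E.Rel E' m m') : E.Rel E' (gen x • m) (gen x • m') := by
  rcases h with ⟨b, rfl, rfl⟩ | ⟨h1, h2⟩
  · exact Or.inl ⟨gen x • b, E.i_smul _ _, E'.i_smul _ _⟩
  · by_cases h0 : gen x • E.p x m = 0
    · left
      refine ⟨(E.glue hP x ⟨E.p x m, h1, h0⟩).1, E.glue_spec hP _ rfl, ?_⟩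
      rw [hg]
      exact E'.glue_spec hP' _ h2.symm
    · right
      rw [E.p_smul, E'.p_smul, h2]
      exact ⟨h2 ▸ h0, rfl⟩

theorem Rel.pow_smul {hP : P.Normal} {hP' : P'.Normal} (hg : E.glue hP = E'.glue hP') {x : P1}
    {m : P.M x} {m' : P'.M x} (h : E.Rel E' m m') (n : ℕ) :
    E.Rel E' (gen x ^ n • m) (gen x ^ n • m') := by
  induction n with
  | zero => rwa [pow_zero, one_smul, one_smul]
  | succ n ih =>
    rw [pow_succ', mul_smul, mul_smul]
    exact ih.gen_smul hg

/-- If `m` falls into `B` at `η`, torsion in `A` puts some `gen x ^ n • m` in `B` already at `x`.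
Dividing by the invertible power at `η` recovers the restriction from data in `B`, so restriction
needs no gluing datum of its own. -/
theorem Rel.rho {hP : P.Normal} {hP' : P'.Normal} (hA : A.Torsion)
    (hg : E.glue hP = E'.glue hP') {x : P1}
    {m : P.M x} {m' : P'.M x} (h : E.Rel E' m m') : E.Rel E' (P.rho m) (P'.rho m') := by
  have hi : ∀ b : B.M x, E.Rel E' (P.rho (E.i x b)) (P'.rho (E'.i x b)) := fun b =>
    Or.inl ⟨B.rho b, E.i_rho b, E'.i_rho b⟩
  by_cases h0 : A.rho (E.p x m) = 0
  · obtain ⟨n, hn⟩ := hA x _ h0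
    have hn' : E.p x (gen x ^ n • m) = 0 := by rw [E.p_smul]; exact hn
    obtain ⟨b, hb⟩ := E.exact.1 hn'
    have hb' : E'.i x b = gen x ^ n • m' :=
      Rel.unique (Or.inl ⟨b, hb, rfl⟩) (h.pow_smul hg n)
    have hne := O_pow_ne_zero (O_res_ne_zero (nb_eta_le x) (gen_ne_zero x)) n
    obtain ⟨c, hc⟩ := eta_exists_inv hne
    refine Or.inl ⟨c • B.rho b, ?_, ?_⟩
    · rw [E.i_smul, E.i_rho, hb, rho_smul, O_res_pow, ← mul_smul, hc, one_smul]
    · rw [E'.i_smul, E'.i_rho, hb', rho_smul, O_res_pow, ← mul_smul, hc, one_smul]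
  · rcases h with ⟨b, rfl, rfl⟩ | ⟨h1, h2⟩
    · exact hi b
    · right
      rw [E.p_rho, E'.p_rho, h2]
      exact ⟨h2 ▸ h0, rfl⟩

/-- Extensions with the same gluing datum are isomorphic. -/
theorem nonempty_iso {hP : P.Normal} {hP' : P'.Normal} (hA : A.Torsion)
    (hg : E.glue hP = E'.glue hP') : Nonempty (Iso P P') := by
  -- The correspondence `Rel` is the graph of a bijection, because it is total, single-valued and
  -- symmetric in the two extensions.
  choose f hf using fun x (m : P.M x) => E.exists_rel E' m
  refine ⟨Iso.ofBijective f (fun x => ⟨fun m m' e => ?_, fun m' => ?_⟩)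
    (map_op_of_gen (fun x => (hf x 0).unique (Rel.zero x))
      (fun x m => (hf x _).unique ((hf x m).gen_smul hg))
      (fun x m => (hf _ _).unique ((hf x m).rho hA hg)))⟩
  · have h1 := (hf x m).symm
    rw [e] at h1
    exact h1.unique (hf x m').symm
  · obtain ⟨m, hm⟩ := E'.exists_rel E m'
    exact ⟨m, (hf x m).unique hm.symm⟩

/-- For each generator `g` only the last nonzero `gen x ^ n • g` can be killed by `gen x`, so an
element is determined by its generator. At `η` there is none, since `gen` is invertible there. -/
theorem finite_top (hA : A.Fin) (x : P1) : Finite (Top A x) := by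
  obtain ⟨G, hG⟩ := hA x
  choose a g hg hm using fun m : A.M x => hG x le_rfl m
  refine Finite.of_injective (β := G) (fun m : Top A x => ⟨g m.1, hg m.1⟩) ?_
  rintro ⟨m, hm0, hm1⟩ ⟨m', hm0', hm1'⟩ e
  have e : g m = g m' := congrArg Subtype.val e
  have key : ∀ (n n' : ℕ) (q : A.M x), gen x ^ n • q ≠ 0 → gen x • gen x ^ n' • q = 0 →
      n ≤ n' := by
    intro n n' q h h'
    by_contra hlt
    obtain ⟨j, rfl⟩ := Nat.exists_eq_add_of_lt (not_le.1 hlt)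
    refine h ?_
    have e1 : gen x ^ (n' + j + 1) = gen x ^ j * (gen x * gen x ^ n') := by
      rw [← pow_succ', ← pow_add]
      congr 1
      omega
    rw [e1, mul_smul, mul_smul, h', smul_zero]
  have hpow : ∀ m : A.M x, m ≠ 0 → gen x • m = 0 → ∃ n : ℕ, m = gen x ^ n • g m := by
    intro m hm0 hm1
    rcases O_cases (a m) with h | ⟨n, h⟩ | ⟨h, -⟩
    · refine absurd ?_ hm0
      rw [hm m, h]
      exact A.zero_op _ _
    · exact ⟨n, by rw [← h]; exact hm m⟩
    · subst h
      exact absurd ((smul_eq_zero_eta (gen_ne_zero _)).1 hm1) hm0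
  obtain ⟨n, hn⟩ := hpow m hm0 hm1
  obtain ⟨n', hn'⟩ := hpow m' hm0' hm1'
  have h1 : n = n' := by
    rw [← e] at hn'
    refine le_antisymm (key n n' (g m) (hn ▸ hm0) (hn' ▸ hm1'))
      (key n' n (g m) (hn' ▸ hm0') (hn ▸ hm1))
  refine Subtype.ext ?_
  change m = m'
  rw [hn, hn', h1, e]

/-- A nonzero element not divisible by `gen x` must be one of the generators. At `η` everything is
divisible and only zero remains. -/
theorem finite_indec (hB : B.Fin) (x : P1) : Finite (Indec B x) := by
  classical
  obtain ⟨G, hG⟩ := hB x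
  have hs : ∀ n : Indec B x, n.1 ∈ insert 0 G := by
    rintro ⟨n, hn⟩
    change n ∈ insert 0 G
    rw [Finset.mem_insert]
    obtain ⟨a, g, hg, e⟩ := hG x le_rfl n
    rw [op_le_rfl] at e
    rcases O_cases a with rfl | ⟨j, rfl⟩ | ⟨h, -⟩
    · exact Or.inl (by rw [e, zero_smul])
    · rcases j with _ | j
      · right
        rw [e, pow_zero, one_smul]
        exact hg
      · left
        refine hn (gen x ^ j • g) ?_
        rw [e, pow_succ', mul_smul]
    · left
      subst h
      obtain ⟨c, hc⟩ := eta_exists_inv (gen_ne_zero .eta)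
      refine hn (c • n) ?_
      rw [← mul_smul, mul_comm, hc, one_smul]
  exact Finite.of_injective (β := (insert 0 G : Finset (B.M x))) (fun n => ⟨n.1, hs n⟩)
    fun n n' e => Subtype.ext (congrArg (fun z : (insert 0 G : Finset (B.M x)) => z.1) e)

end ShortExact

/-- Finitely many classes are extensions of given classes. -/
theorem finite_extensions (a b : IsoCl) :
    {c : IsoCl | ∃ P : StalkMod, P.Good ∧ P.cl = c ∧ ∃ S : P.CSub,
      S.1.quot.cl = a ∧ S.1.obj.cl = b}.Finite := by
  obtain ⟨A, hA, rfl⟩ := exists_good a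
  obtain ⟨B, hB, rfl⟩ := exists_good b
  have hE : ∀ c ∈ {c : IsoCl | ∃ P : StalkMod, P.Good ∧ P.cl = c ∧ ∃ S : P.CSub,
      S.1.quot.cl = A.cl ∧ S.1.obj.cl = B.cl}, ∃ P : StalkMod, P.Good ∧ P.cl = c ∧
        Nonempty (ShortExact B P A) := by
    rintro c ⟨P, hP, rfl, S, h1, h2⟩
    obtain ⟨φ⟩ := ((hP.quot S).cl_eq_iff hA).1 h1
    obtain ⟨ψ⟩ := ((hP.obj S).cl_eq_iff hB).1 h2
    exact ⟨P, hP, rfl, ⟨S.1.shortExact.congr ψ.symm φ⟩⟩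
  choose! P hP hc E using hE
  have := ShortExact.finite_top hA.fin
  have := ShortExact.finite_indec hB.fin
  -- The gluing datum takes values in a finite set of maps and determines the class of the middle
  -- term.
  refine Set.finite_coe_iff.1 (Finite.of_injective
    (β := ∀ x, ShortExact.Top A x → ShortExact.Indec B x)
    (fun c => (E c.1 c.2).some.glue (hP c.1 c.2).normal) ?_)
  intro c c' he
  obtain ⟨φ⟩ := ShortExact.nonempty_iso hA.torsion he
  refine Subtype.ext ?_
  rw [← hc c.1 c.2, ← hc c'.1 c'.2]
  exact cl_congr φ

/-! ### Decompositions -/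

/-- Direct summands. -/
def Sub.IsSummand (U : P.Sub) : Prop :=
  ∃ V : P.Sub, ∀ (x : P1) (m : P.M x), (m ∈ U.carrier x ∨ m ∈ V.carrier x) ∧
    (m ∈ U.carrier x → m ∈ V.carrier x → m = 0)

/-- Each generator lies in the summand or in its complement. A multiple of a generator in the
complement meets the summand only in zero, so the generators contained in a summand determine it. -/
theorem finite_summands (hP : P.Fin) : {U : P.Sub | U.IsSummand}.Finite := by
  choose G hG using hP
  let f : P.Sub → ∀ x, Set (G x) := fun U x => {g | g.1 ∈ U.carrier x}
  refine Set.Finite.of_injOn (f := f) (t := Set.univ) (fun _ _ => trivial) ?_ Set.finite_univ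
  have key : ∀ U U' : P.Sub, U.IsSummand → f U = f U' → U ≤ U' := by
    rintro U U' ⟨V, hV⟩ he x m hm
    obtain ⟨a, g, hg, e⟩ := hG x x le_rfl m
    rw [op_le_rfl] at e
    subst e
    rcases (hV x g).1 with h | h
    · have h1 : (⟨g, hg⟩ : G x) ∈ f U x := h
      rw [he] at h1
      exact U'.smul_mem a h1
    · rw [(hV x _).2 hm (V.smul_mem a h)]
      exact U'.zero_mem x
  exact fun U hU U' hU' he => le_antisymm (key U U' hU he) (key U' U hU' he.symm)

/-- A system has finitely many decompositions into two summands. -/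
theorem finite_decompositions (c : IsoCl) :
    {p : IsoCl × IsoCl | ∃ P Q : StalkMod, P.Good ∧ Q.Good ∧ P.cl = p.1 ∧ Q.cl = p.2 ∧
      (P.sum Q).cl = c}.Finite := by
  obtain ⟨R, hR, rfl⟩ := exists_good c
  refine ((finite_summands hR.fin).image fun U => (U.obj.cl, U.quot.cl)).subset ?_
  rintro ⟨_, _⟩ ⟨P, Q, hP, hQ, rfl, rfl, he⟩
  obtain ⟨φ⟩ := ((hP.sum hQ).cl_eq_iff hR).1 he
  -- The first axis and its complement. The pair of classes is recovered from the image of `U` in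
  -- `R` as subobject and quotient.
  let U := (Sub.top P).prod (Sub.bot Q)
  let V := (Sub.bot P).prod (Sub.top Q)
  refine ⟨φ.mapSub U, ⟨φ.mapSub V, fun x m => ⟨?_, fun h1 h2 => ?_⟩⟩, Prod.ext ?_ ?_⟩
  · rcases ((φ.e x).symm m).2 with h | h
    · exact Or.inr ⟨h, trivial⟩
    · exact Or.inl ⟨trivial, h⟩
  · have : (φ.e x).symm m = 0 := Subtype.ext (Prod.ext h2.1 h1.2)
    rw [Equiv.symm_apply_eq, φ.map_zero] at this
    exact this
  · refine cl_congr ((φ.mapObj U).symm.trans ((Sub.prodObj _ _).trans ?_))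
    exact (sumZero ((Sub.bot Q).obj_isZero_iff.2 rfl)).trans (Sub.topObj P)
  · refine cl_congr ((φ.mapQuot U).symm.trans ((Sub.prodQuot _ _).trans ?_))
    exact (sumComm _ _).trans
      ((sumZero ((Sub.top P).quot_isZero_iff.2 rfl)).trans (Sub.botQuot Q).symm)

end StalkMod

end HallP1

namespace HallP1

open TopologicalSpace

/-! ### The Euler characteristic -/

/-- The scalar `tⁿ` at the generic point. -/
def tz (n : ℤ) : O (nb .eta) := constO .eta (t ^ n) trivial

theorem tz_zero : tz 0 = 1 := O_ext (zpow_zero t)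

theorem tz_add (m n : ℤ) : tz (m + n) = tz m * tz n := O_ext (zpow_add₀ t_ne_zero m n)

theorem tz_ne_zero (n : ℤ) : tz n ≠ 0 := fun h =>
  zpow_ne_zero n t_ne_zero (congrFun (congrArg Subtype.val h) ⟨.eta, mem_nb _⟩)

theorem exists_tz {a : O (nb .eta)} (ha : a ≠ 0) : ∃ n, a = tz n := by
  obtain ⟨n, hn⟩ := exists_zpow_t (a.1 ⟨.eta, mem_nb _⟩) fun h => ha (O_ext h)
  exact ⟨n, O_ext hn⟩

theorem O_res_gen_zero_pow (n : ℕ) : O.res (nb_eta_le .zero) (gen .zero ^ n) = tz n :=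
  O_ext (zpow_natCast t n).symm

theorem O_res_gen_infty_pow (n : ℕ) : O.res (nb_eta_le .infty) (gen .infty ^ n) = tz (-n) :=
  O_ext (by
    change t⁻¹ ^ n = t ^ (-(n : ℤ))
    rw [zpow_neg, zpow_natCast, inv_pow])

theorem natCard_eq_finsum_fiber {T β : Type*} [Finite T] (f : T → β) :
    (Nat.card T : ℤ) = ∑ᶠ b, (Nat.card {t // f t = b} : ℤ) := by
  classical
  have := Fintype.ofFinite T
  rw [finsum_eq_sum_of_support_subset (s := Finset.univ.image f)]
  · rw [Nat.card_eq_fintype_card, ← Finset.card_univ, Finset.card_eq_sum_card_image f]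
    push_cast
    refine Finset.sum_congr rfl fun b _ => ?_
    rw [Nat.card_eq_fintype_card, Fintype.card_subtype]
  · intro b hb
    rw [Function.mem_support, Ne, Nat.cast_eq_zero, Finite.card_eq_zero_iff,
      not_isEmpty_iff] at hb
    obtain ⟨⟨m, rfl⟩⟩ := hb
    simp

theorem finsum_eq_finsum_mem_add_compl {α : Type*} (f : α → ℤ) (hf : f.support.Finite)
    (s : Set α) : ∑ᶠ y, f y = ∑ᶠ y ∈ s, f y + ∑ᶠ y ∈ sᶜ, f y := by
  rw [← finsum_mem_univ, ← Set.union_compl_self s]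
  exact finsum_mem_union' disjoint_compl_right (hf.subset Set.inter_subset_right)
    (hf.subset Set.inter_subset_right)

namespace StalkMod

variable {P Q A B : StalkMod}

theorem smul_inj_eta {a : O (nb .eta)} (ha : a ≠ 0) {m m' : P.M .eta} :
    a • m = a • m' ↔ m = m' := by
  refine ⟨fun h => ?_, fun h => by rw [h]⟩
  obtain ⟨b, hb⟩ := eta_exists_inv ha
  rw [← one_smul (O (nb .eta)) m, ← hb, mul_smul, h, ← mul_smul, hb, one_smul]

theorem tz_smul_tz_smul (m n : ℤ) (y : P.M .eta) : tz m • tz n • y = tz (m + n) • y := by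
  rw [tz_add, mul_smul]

/-- The nonzero germs at `x` with given value at `η`, up to a twist by `a`. -/
def Fiber (P : StalkMod) (x : P1) (a : O (nb .eta)) (y : P.M .eta) : Type :=
  {m : P.M x // m ≠ 0 ∧ a • P.rho m = y}

/-- Over a nonzero value normality leaves at most one germ. Over zero the germs are torsion, hence
of the form `gen x ^ j • g` with `j` below the torsion bound. -/
theorem fiber_finite (hP : P.Good) (x : P1) {a : O (nb .eta)} (ha : a ≠ 0) (y : P.M .eta) :
    Finite (P.Fiber x a y) := by
  by_cases hy : y = 0
  · subst hy
    obtain ⟨k, hk⟩ := hP.fin.exists_torsion_bound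
    obtain ⟨G, hG⟩ := hP.fin x
    have hs : {m : P.M x | m ≠ 0 ∧ a • P.rho m = 0}.Finite := by
      refine (((Finset.range k).finite_toSet.prod G.finite_toSet).image
        (fun p => gen x ^ p.1 • p.2)).subset ?_
      rintro m ⟨h0, h1⟩
      rw [smul_eq_zero_eta ha] at h1
      obtain ⟨n, hn⟩ := hP.torsion x m h1
      obtain ⟨b, g, hg, e⟩ := hG x le_rfl m
      rw [op_le_rfl] at e
      rcases O_cases b with rfl | ⟨j, rfl⟩ | ⟨rfl, -⟩
      · exact absurd (e.trans (zero_smul _ _)) h0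
      · refine ⟨(j, g), ⟨?_, hg⟩, e.symm⟩
        rw [Finset.mem_coe, Finset.mem_range]
        by_contra hjk
        obtain ⟨i, rfl⟩ := Nat.exists_eq_add_of_le (not_lt.1 hjk)
        refine h0 ?_
        rw [e, pow_add, mul_comm, mul_smul, hk x g ⟨n + (k + i), ?_⟩, smul_zero]
        rw [pow_add, mul_smul, ← e]
        exact hn
      · exact absurd ((rho_eta m).symm.trans h1) h0
    exact hs.to_subtype
  · have : Subsingleton (P.Fiber x a y) := by
      constructor
      rintro ⟨m, hm, rfl⟩ ⟨m', hm', e⟩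
      refine Subtype.ext (hP.normal x .eta (nb_eta_le x) a m m' ?_ ?_)
      · rw [op_eq_smul_rho]; exact hy
      · rw [op_eq_smul_rho, op_eq_smul_rho]; exact e.symm
    infer_instance

theorem card_fiber_le_one (hP : P.Good) (x : P1) (a : O (nb .eta)) {y : P.M .eta} (hy : y ≠ 0) :
    Nat.card (P.Fiber x a y) ≤ 1 := by
  have : Subsingleton (P.Fiber x a y) := by
    constructor
    rintro ⟨m, hm, rfl⟩ ⟨m', hm', e⟩
    refine Subtype.ext (hP.normal x .eta (nb_eta_le x) a m m' ?_ ?_)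
    · rw [op_eq_smul_rho]; exact hy
    · rw [op_eq_smul_rho, op_eq_smul_rho]; exact e.symm
  exact Finite.card_le_one_iff_subsingleton.2 this

open scoped Classical in
/-- The local contribution to the Euler characteristic. -/
noncomputable def chiTerm (P : StalkMod) (a : O (nb .eta)) (y : P.M .eta) : ℤ :=
  -- The Čech count for the cover by the two affine lines, sorted by the value at `η`: germs at `0`,
  -- plus germs at `∞` glued through `a`, minus one for each nonzero element at `η`. The three
  -- totals can be infinite, but the sorted differences almost all cancel.
  Nat.card (P.Fiber .zero 1 y) + Nat.card (P.Fiber .infty a y) - if y = 0 then 0 else 1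

/-- The Euler characteristic of a twist. -/
noncomputable def chi (P : StalkMod) (a : O (nb .eta)) : ℤ := ∑ᶠ y, P.chiTerm a y

/-- An isomorphism identifies fibers. -/
def Iso.fiber (φ : Iso P Q) (x : P1) (a : O (nb .eta)) (y : P.M .eta) :
    P.Fiber x a y ≃ Q.Fiber x a (φ.e _ y) :=
  (φ.e x).subtypeEquiv fun m => by
    have : Q.rho (φ.e x m) = φ.e _ (P.rho m) := (φ.map_op _ 1 m).symm
    rw [this, ← φ.map_smul, Ne, Ne, φ.map_eq_zero, (φ.e _).apply_eq_iff_eq]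

theorem chi_congr (φ : Iso P Q) (a : O (nb .eta)) : P.chi a = Q.chi a := by
  rw [chi, chi, ← finsum_comp_equiv (φ.e .eta)]
  refine finsum_congr fun y => ?_
  rw [chiTerm, chiTerm, Nat.card_congr (φ.fiber .zero 1 y), Nat.card_congr (φ.fiber .infty a y),
    φ.map_eq_zero]

/-- Exponents matter only modulo the period `p`. -/
theorem orbit_finite {u : P.M .eta} {p : ℤ} (hp : p ≠ 0) (h : tz p • u = u) :
    (Set.range fun i : ℤ => tz i • u).Finite := by
  have hn : ∀ n : ℤ, tz (n * p) • u = u := by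
    intro n
    induction n with
    | zero => rw [zero_mul, tz_zero, one_smul]
    | succ n ih => rw [add_mul, one_mul, tz_add, mul_smul, h, ih]
    | pred n ih =>
      rw [← smul_inj_eta (tz_ne_zero p), tz_smul_tz_smul, h]
      have e : p + (-(n : ℤ) - 1) * p = -n * p := by ring
      rw [e, ih]
  refine ((Set.finite_Ico 0 |p|).image fun i => tz i • u).subset ?_
  rintro _ ⟨i, rfl⟩
  refine ⟨i % p, ⟨Int.emod_nonneg _ hp, Int.emod_lt_abs _ hp⟩, ?_⟩
  change tz (i % p) • u = tz i • u
  conv_rhs => rw [← Int.emod_add_mul_ediv i p, mul_comm p, tz_add, mul_smul, hn]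

/-- With `u` and `v` the values of generators at `0` and `∞`, these are the candidates for a nonzero
term of the Euler characteristic. A periodic orbit is finite. On a free orbit `j - i` is constant,
so either alternative confines `i` to a bounded interval. -/
theorem finite_exceptional (u v : P.M .eta) (r : ℤ) :
    {y : P.M .eta | ∃ i j : ℤ, y = tz i • u ∧ y = tz j • v ∧
      ((0 ≤ i ∧ j ≤ r) ∨ (i < 0 ∧ r < j))}.Finite := by
  by_cases hper : ∃ p : ℤ, p ≠ 0 ∧ tz p • u = u
  · obtain ⟨p, hp, h⟩ := hper
    refine (orbit_finite hp h).subset ?_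
    rintro y ⟨i, j, rfl, -⟩
    exact ⟨i, rfl⟩
  by_cases hne : ∃ i₀ j₀ : ℤ, tz i₀ • u = tz j₀ • v
  · obtain ⟨i₀, j₀, h₀⟩ := hne
    refine ((Set.finite_Icc (-|r - (j₀ - i₀)|) |r - (j₀ - i₀)|).image fun i => tz i • u).subset ?_
    rintro y ⟨i, j, rfl, h, hc⟩
    refine ⟨i, ?_, rfl⟩
    have hδ : j - i = j₀ - i₀ := by
      by_contra hδ
      -- Two different values of `j - i` would give `u` a nonzero period.
      refine hper ⟨(j₀ + i) - (j + i₀), by omega, ?_⟩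
      rw [← smul_inj_eta (tz_ne_zero (j + i₀)), tz_smul_tz_smul]
      have e1 : tz (j₀ + i) • u = tz (j₀ + j) • v := by rw [tz_add, mul_smul, h, tz_smul_tz_smul]
      have e2 : tz (j + i₀) • u = tz (j + j₀) • v := by rw [tz_add, mul_smul, h₀, tz_smul_tz_smul]
      rw [add_sub_cancel, e1, e2, add_comm]
    have h1 := neg_abs_le (r - (j₀ - i₀))
    have h2 := le_abs_self (r - (j₀ - i₀))
    constructor <;> omega
  · convert Set.finite_empty (α := P.M .eta)
    refine Set.eq_empty_of_forall_notMem ?_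
    rintro y ⟨i, j, h1, h2, -⟩
    exact hne ⟨i, j, h1.symm.trans h2⟩

theorem card_fiber_pos (hP : P.Good) (x : P1) {a : O (nb .eta)} (ha : a ≠ 0) {y : P.M .eta} :
    0 < Nat.card (P.Fiber x a y) ↔ ∃ m : P.M x, m ≠ 0 ∧ a • P.rho m = y := by
  have := fiber_finite hP x ha y
  rw [Finite.card_pos_iff]
  exact ⟨fun ⟨m⟩ => ⟨m.1, m.2⟩, fun ⟨m, hm⟩ => ⟨⟨m, hm⟩⟩⟩

theorem card_fiber_zero_pos (hP : P.Good) {m : P.M .zero} {i : ℤ} (hi : 0 ≤ i)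
    (h : tz i • P.rho m ≠ 0) : 0 < Nat.card (P.Fiber .zero 1 (tz i • P.rho m)) := by
  obtain ⟨n, rfl⟩ := Int.eq_ofNat_of_zero_le hi
  have e : P.rho (gen .zero ^ n • m) = tz n • P.rho m := by
    rw [rho_smul, O_res_gen_zero_pow]
  refine (card_fiber_pos hP _ (O_one_ne_zero _)).2 ⟨gen .zero ^ n • m, fun h0 => h ?_, ?_⟩
  · rw [← e, h0, rho_zero]
  · rw [one_smul, e]

theorem card_fiber_infty_pos (hP : P.Good) {m : P.M .infty} {j r : ℤ} (hj : j ≤ r)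
    (h : tz j • P.rho m ≠ 0) : 0 < Nat.card (P.Fiber .infty (tz r) (tz j • P.rho m)) := by
  obtain ⟨n, hn⟩ := Int.eq_ofNat_of_zero_le (sub_nonneg.2 hj)
  have e : tz r • P.rho (gen .infty ^ n • m) = tz j • P.rho m := by
    rw [rho_smul, O_res_gen_infty_pow, tz_smul_tz_smul]
    congr 2
    omega
  refine (card_fiber_pos hP _ (tz_ne_zero r)).2 ⟨gen .infty ^ n • m, fun h0 => h ?_, e⟩
  rw [← e, h0, rho_zero, smul_zero]

theorem Fin.exists_tz (hP : P.Fin) (x : P1) : ∃ G : Finset (P.M x), ∀ y : P.M .eta, y ≠ 0 →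
    ∃ g ∈ G, ∃ i : ℤ, y = tz i • P.rho g := by
  obtain ⟨G, hG⟩ := hP x
  refine ⟨G, fun y hy => ?_⟩
  obtain ⟨a, g, hg, e⟩ := hG .eta (nb_eta_le x) y
  rw [op_eq_smul_rho] at e
  obtain ⟨i, rfl⟩ := HallP1.exists_tz (a := a) (by
    rintro rfl
    exact hy (e.trans (zero_smul _ _)))
  exact ⟨g, hg, i, e⟩

/-- For nonzero `y` both fibers have at most one element, so the term is nonzero only if `y` comes
from both sides or from neither. These are the two alternatives of `finite_exceptional`. -/
theorem chiTerm_support_finite (hP : P.Good) (r : ℤ) : (P.chiTerm (tz r)).support.Finite := by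
  obtain ⟨G, hG⟩ := hP.fin .zero
  obtain ⟨H, hH⟩ := hP.fin .infty
  have hfin : (⋃ g ∈ G, ⋃ h ∈ H, {y : P.M .eta | ∃ i j : ℤ, y = tz i • P.rho g ∧
      y = tz j • P.rho h ∧ ((0 ≤ i ∧ j ≤ r) ∨ (i < 0 ∧ r < j))}).Finite :=
    G.finite_toSet.biUnion fun g _ => H.finite_toSet.biUnion fun h _ => finite_exceptional _ _ _
  refine (hfin.union (Set.finite_singleton 0)).subset fun y hy => ?_
  by_cases hy0 : y = 0
  · exact Or.inr hy0
  left
  simp only [Set.mem_iUnion, exists_prop]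
  have h1 := card_fiber_le_one hP .zero 1 hy0
  have h2 := card_fiber_le_one hP .infty (tz r) hy0
  rw [Function.mem_support, chiTerm, if_neg hy0] at hy
  have nz : ∀ {x : P1} (a : O (nb .eta)) (m : P.M x), y = a • P.rho m → a ≠ 0 := by
    rintro x a m e rfl
    exact hy0 (e.trans (zero_smul _ _))
  by_cases hz : 0 < Nat.card (P.Fiber .zero 1 y)
  · have hi : 0 < Nat.card (P.Fiber .infty (tz r) y) := by omega
    obtain ⟨m, hm0, hm⟩ := (card_fiber_pos hP _ (O_one_ne_zero _)).1 hz
    obtain ⟨m', hm0', hm'⟩ := (card_fiber_pos hP _ (tz_ne_zero r)).1 hi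
    obtain ⟨a, g, hg, e⟩ := hG .zero le_rfl m
    obtain ⟨b, h, hh, e'⟩ := hH .infty le_rfl m'
    rw [op_le_rfl] at e e'
    obtain rfl | ⟨i, rfl⟩ | ⟨h, -⟩ := O_cases a
    · exact absurd (e.trans (zero_smul _ _)) hm0
    · obtain rfl | ⟨j, rfl⟩ | ⟨h, -⟩ := O_cases b
      · exact absurd (e'.trans (zero_smul _ _)) hm0'
      · refine ⟨g, hg, h, hh, i, r - j, ?_, ?_, Or.inl ⟨by omega, by omega⟩⟩
        · rw [← hm, e, rho_smul, O_res_gen_zero_pow, one_smul]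
        · rw [← hm', e', rho_smul, O_res_gen_infty_pow, tz_smul_tz_smul]
          rfl
      · cases h
    · cases h
  -- Neither side reaches `y`. Writing it through generators at `0` and `∞`, a nonnegative `i` or a
  -- `j ≤ r` would produce a germ.
  · have hi : ¬ 0 < Nat.card (P.Fiber .infty (tz r) y) := by omega
    obtain ⟨a, g, hg, e⟩ := hG .eta (nb_eta_le _) y
    obtain ⟨b, h, hh, e'⟩ := hH .eta (nb_eta_le _) y
    rw [op_eq_smul_rho] at e e'
    obtain ⟨i, rfl⟩ := HallP1.exists_tz (nz a g e)
    obtain ⟨j, rfl⟩ := HallP1.exists_tz (nz b h e')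
    refine ⟨g, hg, h, hh, i, j, e, e', Or.inr ⟨?_, ?_⟩⟩
    · by_contra hi0
      refine hz ?_
      rw [e]
      exact card_fiber_zero_pos hP (not_lt.1 hi0) (e ▸ hy0)
    · by_contra hj
      refine hi ?_
      rw [e']
      exact card_fiber_infty_pos hP (not_lt.1 hj) (e' ▸ hy0)

/-! ### Additivity of the Euler characteristic -/

namespace ShortExact

variable (E : ShortExact B P A)

/-- Germs outside the subsystem whose value at `η` is a given element of the subsystem. -/
def Mixed (x : P1) (a : O (nb .eta)) (b : B.M .eta) : Type :=
  {m : P.M x // E.p x m ≠ 0 ∧ a • P.rho m = E.i _ b}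

/-- The fiber over an element of the subsystem. -/
noncomputable def fiberSub (x : P1) (a : O (nb .eta)) (b : B.M .eta) :
    B.Fiber x a b ⊕ E.Mixed x a b ≃ P.Fiber x a (E.i _ b) :=
  Equiv.ofBijective
    (Sum.elim
      (fun m => ⟨E.i x m.1, fun h => m.2.1 (E.i_inj x (h.trans (E.i_zero x).symm)), by
        rw [← E.i_rho, ← E.i_smul, m.2.2]⟩)
      (fun m => ⟨m.1, fun h => m.2.1 (by rw [h, E.p_zero]), m.2.2⟩))
    (by
      constructor
      · rintro (m | m) (m' | m') e
        · exact congrArg Sum.inl (Subtype.ext (E.i_inj x (congrArg Subtype.val e)))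
        · refine absurd ?_ m'.2.1
          have e : E.i x m.1 = m'.1 := congrArg Subtype.val e
          rw [← e, E.p_i]
        · refine absurd ?_ m.2.1
          have e : m.1 = E.i x m'.1 := congrArg Subtype.val e
          rw [e, E.p_i]
        · have e : m.1 = m'.1 := congrArg (fun z : P.Fiber x a (E.i _ b) => z.1) e
          exact congrArg Sum.inr (Subtype.ext e)
      · rintro ⟨m, h0, h1⟩
        by_cases h : E.p x m = 0
        · obtain ⟨b', rfl⟩ := E.exact.1 h
          refine ⟨Sum.inl ⟨b', ?_, ?_⟩, rfl⟩
          · rintro rfl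
            exact h0 (E.i_zero x)
          · rw [← E.i_rho, ← E.i_smul] at h1
            exact E.i_inj _ h1
        · exact ⟨Sum.inr ⟨m, h, h1⟩, rfl⟩)

/-- The fiber over an element outside the subsystem. -/
noncomputable def fiberQuot (x : P1) (a : O (nb .eta)) {y : P.M .eta} (hy : E.p _ y ≠ 0) :
    P.Fiber x a y ≃ A.Fiber x a (E.p _ y) :=
  have h0 : ∀ m : P.M x, a • P.rho m = y → E.p x m ≠ 0 := fun m hm h => hy (by
    rw [← hm, E.p_smul, E.p_rho, h, rho_zero, smul_zero])
  Equiv.ofBijective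
    (fun m => ⟨E.p x m.1, h0 m.1 m.2.2, by rw [← E.p_rho, ← E.p_smul, m.2.2]⟩)
    (by
      constructor
      · intro m m' e
        exact Subtype.ext (E.p_normal (h0 _ m.2.2) (congrArg Subtype.val e))
      · rintro ⟨m, hm0, hm⟩
        obtain ⟨m, rfl⟩ := E.p_surj x m
        refine ⟨⟨m, fun h => hm0 (by rw [h, E.p_zero]), ?_⟩, rfl⟩
        rw [← E.p_rho, ← E.p_smul] at hm
        exact (E.p_normal (hm ▸ hy) hm))

/-- Torsion germs of the quotient. -/
noncomputable def sigmaMixed (x : P1) (a : O (nb .eta)) :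
    (Σ b, E.Mixed x a b) ≃ A.Fiber x a 0 :=
  Equiv.ofBijective
    (fun s => ⟨E.p x s.2.1, s.2.2.1, by rw [← E.p_rho, ← E.p_smul, s.2.2.2, E.p_i]⟩)
    (by
      constructor
      · rintro ⟨b, m, hm0, hm⟩ ⟨b', m', hm0', hm'⟩ e
        obtain rfl : m = m' := E.p_normal hm0 (congrArg Subtype.val e)
        obtain rfl := E.i_inj _ (hm.symm.trans hm')
        rfl
      · rintro ⟨m, hm0, hm⟩
        obtain ⟨m, rfl⟩ := E.p_surj x m
        rw [← E.p_rho, ← E.p_smul, E.exact] at hm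
        obtain ⟨b, hb⟩ := hm
        exact ⟨⟨b, m, hm0, hb.symm⟩, rfl⟩)

/-- Germs outside `B` that land in `B` at `η` are the lifts of the torsion germs of `A`, so sorting
them by their value in `B` redistributes the fiber of `A` over zero. -/
theorem card_mixed (hA : A.Good) (x : P1) {a : O (nb .eta)} (ha : a ≠ 0) :
    (fun b => (Nat.card (E.Mixed x a b) : ℤ)).support.Finite ∧
      (Nat.card (A.Fiber x a 0) : ℤ) = ∑ᶠ b, (Nat.card (E.Mixed x a b) : ℤ) := by
  have := fiber_finite hA x ha 0
  have : Finite (Σ b, E.Mixed x a b) := Finite.of_equiv _ (E.sigmaMixed x a).symm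
  constructor
  · refine (Set.finite_range fun s : Σ b, E.Mixed x a b => s.1).subset fun b hb => ?_
    have : Nonempty (E.Mixed x a b) := by
      by_contra h
      rw [not_nonempty_iff] at h
      exact hb (by simp)
    exact ⟨⟨b, this.some⟩, rfl⟩
  · rw [← Nat.card_congr (E.sigmaMixed x a),
      natCard_eq_finsum_fiber fun s : Σ b, E.Mixed x a b => s.1]
    exact finsum_congr fun b => by rw [Nat.card_congr (Equiv.sigmaSubtype b)]

/-- The stalk of `P` at `η` splits into `B` and the nonzero part of `A`. Over the second part the
terms are those of `A`. Over `B` there is an excess of mixed germs, whose total is the missing term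
of `A` at zero. -/
theorem chi_eq (E : ShortExact B P A) (hP : P.Good) (hB : B.Good) (hA : A.Good) (r : ℤ) :
    P.chi (tz r) = B.chi (tz r) + A.chi (tz r) := by
  classical
  have hne0 := O_one_ne_zero .eta
  have hner := tz_ne_zero r
  obtain ⟨f0, c0⟩ := E.card_mixed hA .zero hne0
  obtain ⟨f1, c1⟩ := E.card_mixed hA .infty hner
  have hsub : ∀ b, P.chiTerm (tz r) (E.i _ b) = B.chiTerm (tz r) b +
      (Nat.card (E.Mixed .zero 1 b) + Nat.card (E.Mixed .infty (tz r) b)) := by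
    intro b
    have := fiber_finite hP .zero hne0 (E.i _ b)
    have := fiber_finite hP .infty hner (E.i _ b)
    have : Finite (B.Fiber .zero 1 b ⊕ E.Mixed .zero 1 b) :=
      Finite.of_equiv _ (E.fiberSub .zero 1 b).symm
    have : Finite (B.Fiber .infty (tz r) b ⊕ E.Mixed .infty (tz r) b) :=
      Finite.of_equiv _ (E.fiberSub .infty (tz r) b).symm
    have : Finite (B.Fiber .zero 1 b) := Finite.sum_left (E.Mixed .zero 1 b)
    have : Finite (E.Mixed .zero 1 b) := Finite.sum_right (B.Fiber .zero 1 b)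
    have : Finite (B.Fiber .infty (tz r) b) := Finite.sum_left (E.Mixed .infty (tz r) b)
    have : Finite (E.Mixed .infty (tz r) b) := Finite.sum_right (B.Fiber .infty (tz r) b)
    have hb : E.i _ b = 0 ↔ b = 0 :=
      ⟨fun h => E.i_inj _ (h.trans (E.i_zero _).symm), fun h => by rw [h, E.i_zero]⟩
    rw [chiTerm, chiTerm, ← Nat.card_congr (E.fiberSub .zero 1 b),
      ← Nat.card_congr (E.fiberSub .infty (tz r) b), Nat.card_sum, Nat.card_sum]
    simp only [hb]
    push_cast
    ring
  have hquot : ∀ y, E.p _ y ≠ 0 → P.chiTerm (tz r) y = A.chiTerm (tz r) (E.p _ y) := by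
    intro y hy
    have hy0 : y ≠ 0 := fun h => hy (by rw [h, E.p_zero])
    rw [chiTerm, chiTerm, Nat.card_congr (E.fiberQuot .zero 1 hy),
      Nat.card_congr (E.fiberQuot .infty (tz r) hy), if_neg hy, if_neg hy0]
  have hA0 : A.chiTerm (tz r) 0 =
      Nat.card (A.Fiber .zero 1 0) + Nat.card (A.Fiber .infty (tz r) 0) := by
    rw [chiTerm, if_pos rfl, sub_zero]
  rw [chi, finsum_eq_finsum_mem_add_compl _ (chiTerm_support_finite hP r) (Set.range (E.i .eta)),
    finsum_mem_range (E.i_inj _), finsum_congr hsub,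
    finsum_add_distrib (chiTerm_support_finite hB r) ((f0.union f1).subset
      (Function.support_add _ _)), finsum_add_distrib f0 f1, ← c0, ← c1, ← hA0, add_assoc]
  congr 1
  rw [chi, finsum_eq_finsum_mem_add_compl _ (chiTerm_support_finite hA r) {0},
    finsum_mem_singleton]
  congr 1
  refine finsum_mem_eq_of_bijOn (E.p _) ⟨?_, ?_, ?_⟩ fun y hy => ?_
  · exact fun y hy h => hy (E.exact.1 h)
  · exact fun y hy y' _ e => E.p_normal (fun h => hy (E.exact.1 h)) e
  · intro q hq
    obtain ⟨y, rfl⟩ := E.p_surj _ q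
    exact ⟨y, fun h => hq (E.exact.2 h), rfl⟩
  · exact hquot y fun h => hy (E.exact.1 h)

end ShortExact

/-- A system all of whose twists have Euler characteristic zero vanishes. -/
theorem Good.isZero_of_chi (hP : P.Good) (h : ∀ r, P.chi (tz r) = 0) : P.IsZero := by
  classical
  obtain ⟨G, hG⟩ := hP.fin.exists_tz .zero
  obtain ⟨H, hH⟩ := hP.fin.exists_tz .infty
  -- The twist is chosen so large that the value at `η` of every generator at `0` also comes from a
  -- germ at `∞`.
  have hr : ∃ r : ℤ, ∀ g ∈ G, P.rho g ≠ 0 → ∃ j ≤ r, ∃ m ∈ H, P.rho g = tz j • P.rho m := by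
    have : ∀ g : P.M .zero, ∃ j : ℤ, P.rho g ≠ 0 → ∃ m ∈ H, P.rho g = tz j • P.rho m := by
      intro g
      by_cases h0 : P.rho g = 0
      · exact ⟨0, fun h => absurd h0 h⟩
      · obtain ⟨m, hm, j, e⟩ := hH _ h0
        exact ⟨j, fun _ => ⟨m, hm, e⟩⟩
    choose j hj using this
    obtain ⟨r, hr⟩ := (G.image j).exists_le
    exact ⟨r, fun g hg h0 => ⟨j g, hr _ (Finset.mem_image_of_mem _ hg), hj g h0⟩⟩
  obtain ⟨r, hr⟩ := hr
  -- For this `r` every nonzero `y` is reached from at least one side, so no term is negative and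
  -- the vanishing of the sum kills each term.
  have hpos : ∀ y : P.M .eta, y ≠ 0 → 0 < Nat.card (P.Fiber .zero 1 y) ∨
      0 < Nat.card (P.Fiber .infty (tz r) y) := by
    intro y hy
    obtain ⟨g, hg, i, e⟩ := hG y hy
    rcases le_or_gt 0 i with hi | hi
    · left
      rw [e]
      exact card_fiber_zero_pos hP hi (e ▸ hy)
    · right
      have h0 : P.rho g ≠ 0 := fun h0 => hy (by rw [e, h0, smul_zero])
      obtain ⟨j, hj, m, hm, e'⟩ := hr g hg h0
      rw [e', tz_smul_tz_smul] at e
      rw [e]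
      exact card_fiber_infty_pos hP (by omega) (e ▸ hy)
  have hnonneg : ∀ y, 0 ≤ P.chiTerm (tz r) y := by
    intro y
    rw [chiTerm]
    split_ifs with hy
    · omega
    · have := hpos y hy
      omega
  have hzero : ∀ y, P.chiTerm (tz r) y = 0 := by
    intro y
    have hc := h r
    rw [chi, finsum_eq_sum _ (chiTerm_support_finite hP r),
      Finset.sum_eq_zero_iff_of_nonneg fun y _ => hnonneg y] at hc
    by_contra hy
    exact hy (hc y ((Set.Finite.mem_toFinset _).2 hy))
  -- A nonzero value of a generator would be reached from both sides and contribute a term 1.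
  have hg : ∀ g ∈ G, P.rho g = 0 := by
    intro g hg
    by_contra h0
    obtain ⟨j, hj, m, hm, e⟩ := hr g hg h0
    have h1 : 0 < Nat.card (P.Fiber .zero 1 (P.rho g)) := by
      have := card_fiber_zero_pos hP (m := g) le_rfl (by rwa [tz_zero, one_smul])
      rwa [tz_zero, one_smul] at this
    have h2 : 0 < Nat.card (P.Fiber .infty (tz r) (P.rho g)) := by
      rw [e]
      exact card_fiber_infty_pos hP hj (e ▸ h0)
    have h3 := hzero (P.rho g)
    rw [chiTerm, if_neg h0] at h3
    omega
  have hη : ∀ y : P.M .eta, y = 0 := by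
    intro y
    by_contra hy
    obtain ⟨g, hg', i, e⟩ := hG y hy
    exact hy (by rw [e, hg g hg', smul_zero])
  -- Once the stalk at `η` is zero, the term at zero counts all nonzero germs at `0` and `∞`.
  have h0 := hzero 0
  rw [chiTerm, if_pos rfl] at h0
  intro x m
  by_contra hm
  cases x
  · have := (card_fiber_pos hP .zero (O_one_ne_zero _)).2 ⟨m, hm, hη _⟩
    omega
  · have := (card_fiber_pos hP .infty (tz_ne_zero r)).2 ⟨m, hm, hη _⟩
    omega
  · exact hm (hη m)

end StalkMod

end HallP1

namespace HallP1

open TopologicalSpace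

/-! ### The Grothendieck group -/

/-- A short exact sequence of sheaves induces one of stalks. -/
def IsShortExact.st {F' F F'' : CohN} {j : PMod.Hom F'.mod F.mod} {p : PMod.Hom F.mod F''.mod}
    (h : IsShortExact j p) : StalkMod.ShortExact F'.st F.st F''.st where
  i x m := j.app (nb x) m
  p x m := p.app (nb x) m
  i_op _ _ _ := by
    change j.app _ (_ • F'.mod.res _ _) = _ • F.mod.res _ _
    rw [j.app_smul, j.app_res]
  p_op _ _ _ := by
    change p.app _ (_ • F.mod.res _ _) = _ • F''.mod.res _ _
    rw [p.app_smul, p.app_res]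
  i_inj := h.injective
  p_surj := h.surjective
  exact {x m} := h.exact x m
  p_normal {x m m'} := h.normal_right x m m'

/-! ### The exact sequence of a coherent subsheaf -/

namespace CohN.Sub

variable {F : CohN} (N : F.Sub)

/-- The inclusion of a subsheaf. -/
def incl : PMod.Hom N.obj.mod F.mod where
  app _ s := s.1
  app_zero _ := rfl
  app_smul _ _ _ := rfl
  app_res _ _ := rfl

/-- The projection to a quotient sheaf. -/
def projHom : PMod.Hom F.mod N.quot.mod where
  app _ s := ⟨fun x => CollapseQuot.mk _ (F.mod.res (nb_le x.2) s), fun _ _ _ =>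
    congrArg (CollapseQuot.mk _) (F.mod.res_res _ _ _)⟩
  app_zero _ := Subtype.ext (funext fun _ => congrArg (CollapseQuot.mk _) (F.mod.res_zero _))
  app_smul _ a s := Subtype.ext (funext fun _ =>
    congrArg (CollapseQuot.mk _) (F.mod.res_smul _ a s))
  app_res _ _ := Subtype.ext (funext fun _ => congrArg (CollapseQuot.mk _) (F.mod.res_res _ _ _))

theorem projHom_eq {x : P1} (s : F.mod.sec (nb x)) :
    N.projHom.app (nb x) s = N.sub.preQuot.toSheafify (CollapseQuot.mk _ s) := rfl

theorem projHom_eq_iff {x : P1} (s s' : F.mod.sec (nb x)) :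
    N.projHom.app (nb x) s = N.projHom.app (nb x) s' ↔
      s = s' ∨ (s ∈ N.sub.carrier (nb x) ∧ s' ∈ N.sub.carrier (nb x)) := by
  rw [projHom_eq, projHom_eq, ← CollapseQuot.mk_eq]
  exact ((N.sub.preQuot.stSheafify).e x).apply_eq_iff_eq

theorem projHom_eq_zero_iff {x : P1} (s : F.mod.sec (nb x)) :
    N.projHom.app (nb x) s = 0 ↔ s ∈ N.sub.carrier (nb x) := by
  rw [← N.projHom.app_zero (nb x), projHom_eq_iff]
  constructor
  · rintro (rfl | h)
    · exact N.sub.zero_mem _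
    · exact h.1
  · exact fun h => Or.inr ⟨h, N.sub.zero_mem _⟩

theorem isShortExact : IsShortExact N.incl N.projHom where
  normal_left _ _ _ _ e := Subtype.ext e
  normal_right x m m' h e := by
    rcases (N.projHom_eq_iff m m').1 e with e | e
    · exact e
    · exact absurd ((N.projHom_eq_zero_iff m).2 e.1) h
  injective _ := Subtype.val_injective
  surjective x q := by
    obtain ⟨q, rfl⟩ := ((N.sub.preQuot.stSheafify).e x).surjective q
    obtain ⟨m, rfl⟩ := q.exists_rep
    exact ⟨m, rfl⟩
  exact x s := by
    rw [projHom_eq_zero_iff]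
    exact ⟨fun h => ⟨⟨s, h⟩, rfl⟩, by rintro ⟨m, rfl⟩; exact m.2⟩

end CohN.Sub

theorem K0cls_of_isShortExact {F' F F'' : CohN} {j : PMod.Hom F'.mod F.mod}
    {p : PMod.Hom F.mod F''.mod} (h : IsShortExact j p) :
    K0cls F.cls = K0cls F'.cls + K0cls F''.cls := by
  have : (QuotientAddGroup.mk (FreeAbelianGroup.of F'.cls + FreeAbelianGroup.of F''.cls -
      FreeAbelianGroup.of F.cls) : K0) = 0 :=
    (QuotientAddGroup.eq_zero_iff _).2 (AddSubgroup.subset_closure ⟨F', F, F'', j, p, h, rfl⟩)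
  rw [QuotientAddGroup.mk_sub, QuotientAddGroup.mk_add, sub_eq_zero] at this
  exact this.symm

namespace StalkMod

variable {P Q : StalkMod}

theorem Good.K0cls_eq (hP : P.Good) (S : P.CSub) :
    K0cls P.cl = K0cls S.1.quot.cl + K0cls S.1.obj.cl := by
  obtain ⟨F, N, ⟨φ⟩, ⟨ψ⟩, ⟨χ⟩⟩ := hP.exists_sub S
  rw [cl_eq_cls φ, cl_eq_cls ψ, cl_eq_cls χ, K0cls_of_isShortExact N.isShortExact, add_comm]

/-- The relation in `K0` is that of the second axis, with quotient `P`. -/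
theorem Good.K0cls_sum (hP : P.Good) (hQ : Q.Good) :
    K0cls (P.sum Q).cl = K0cls P.cl + K0cls Q.cl := by
  let S : (P.sum Q).CSub := csubSum P Q (CSub.bot P, CSub.top hQ.fin)
  rw [(hP.sum hQ).K0cls_eq S]
  congr 2
  · exact cl_congr ((Sub.prodQuot _ _).trans
      ((sumZero ((Sub.top Q).quot_isZero_iff.2 rfl)).trans (Sub.botQuot P).symm))
  · exact cl_congr ((Sub.prodObj _ _).trans ((sumComm _ _).trans
      ((sumZero ((Sub.bot P).obj_isZero_iff.2 rfl)).trans (Sub.topObj Q))))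

/-- The Euler characteristic on isomorphism classes. -/
noncomputable def chiCl (r : ℤ) (c : IsoCl) : ℤ :=
  Quotient.liftOn c (fun F => F.st.chi (tz r)) fun _ _ ⟨φ⟩ => chi_congr φ.st _

theorem chiCl_cls (r : ℤ) (F : CohN) : chiCl r F.cls = F.st.chi (tz r) := rfl

/-- The Euler characteristic on the Grothendieck group. -/
noncomputable def chiK0 (r : ℤ) : K0 →+ ℤ :=
  QuotientAddGroup.lift _ (FreeAbelianGroup.lift (chiCl r)) (by
    rw [AddSubgroup.closure_le]
    rintro _ ⟨F', F, F'', j, p, h, rfl⟩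
    rw [SetLike.mem_coe, AddMonoidHom.mem_ker, map_sub, map_add, FreeAbelianGroup.lift_apply_of,
      FreeAbelianGroup.lift_apply_of, FreeAbelianGroup.lift_apply_of, chiCl_cls, chiCl_cls,
      chiCl_cls, h.st.chi_eq (good_st _) (good_st _) (good_st _), sub_self])

theorem chiK0_K0cls (r : ℤ) (c : IsoCl) : chiK0 r (K0cls c) = chiCl r c :=
  FreeAbelianGroup.lift_apply_of _ _

end StalkMod

open StalkMod in
/-- Only the zero sheaf has class zero in the Grothendieck group. -/
theorem K0cls_eq_zero_iff {c : IsoCl} : K0cls c = 0 ↔ c = zeroSheaf.cls := by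
  have hz : ∀ F : CohN, K0cls F.cls = 0 → F.cls = zeroSheaf.cls := by
    intro F h
    rw [← cl_st, (good_st F).cl_eq_zero_iff]
    refine (good_st F).isZero_of_chi fun r => ?_
    rw [← chiCl_cls, ← chiK0_K0cls, h, map_zero]
  constructor
  · obtain ⟨F, rfl⟩ := Quotient.exists_rep c
    exact hz F
  · rintro rfl
    -- The zero sheaf is its own double, so its class equals twice itself.
    have := (good_st zeroSheaf).K0cls_sum (good_st zeroSheaf)
    rw [cl_congr (sumZero isZero_zeroSheaf), cl_st] at this
    exact left_eq_add.1 this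

end HallP1

namespace HallP1

open TopologicalSpace StalkMod

/-! ### The Hall product -/

theorem Good.finite_apply_quot {P : StalkMod} (hP : P.Good) (f : Hall) :
    {S : P.CSub | f S.1.quot.cl ≠ 0}.Finite := by
  refine (f.support.finite_toSet.biUnion fun c _ => hP.finite_quot c).subset fun S hS => ?_
  exact Set.mem_biUnion (Finsupp.mem_support_iff.2 hS) rfl

/-- The Hall product, as a sum over subsystems. -/
noncomputable def hallSum (f g : Hall) (P : StalkMod) : ℂ :=
  ∑ᶠ S : P.CSub, f S.1.quot.cl * g S.1.obj.cl

theorem hallSum_finite (f g : Hall) {P : StalkMod} (hP : P.Good) :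
    {S : P.CSub | f S.1.quot.cl * g S.1.obj.cl ≠ 0}.Finite :=
  (Good.finite_apply_quot hP f).subset fun _ hS => left_ne_zero_of_mul hS

theorem hallSum_congr (f g : Hall) {P Q : StalkMod} (φ : Iso P Q) :
    hallSum f g P = hallSum f g Q := by
  rw [hallSum, hallSum, ← finsum_comp_equiv φ.csub]
  refine finsum_congr fun S => ?_
  rw [cl_congr (φ.mapQuot S.1), cl_congr (φ.mapObj S.1)]
  rfl

theorem cls_out (c : IsoCl) : (Quotient.out c : CohN).cls = c := Quotient.out_eq c

/-- A class in the support is an extension of a class in the support of `f` by one in the support of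
`g`, and each such pair admits finitely many extensions. -/
theorem finite_support_hallSum (f g : Hall) :
    (Function.support fun c : IsoCl => hallSum f g (Quotient.out c : CohN).st).Finite := by
  refine (f.support.finite_toSet.biUnion fun a _ => g.support.finite_toSet.biUnion fun b _ =>
    finite_extensions a b).subset fun c hc => ?_
  obtain ⟨S, hS⟩ : ∃ S : (Quotient.out c : CohN).st.CSub,
      f S.1.quot.cl * g S.1.obj.cl ≠ 0 := by
    by_contra h
    push Not at h
    refine hc ?_
    change ∑ᶠ S, _ = _
    rw [finsum_congr h, finsum_zero]
  refine Set.mem_biUnion (Finsupp.mem_support_iff.2 (left_ne_zero_of_mul hS))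
    (Set.mem_biUnion (Finsupp.mem_support_iff.2 (right_ne_zero_of_mul hS)) ?_)
  exact ⟨_, good_st _, (cl_st _).trans (cls_out c), S, rfl, rfl⟩

/-- The Hall product. -/
noncomputable def hallMul (f g : Hall) : Hall :=
  Finsupp.ofSupportFinite _ (finite_support_hallSum f g)

theorem hallMul_cl (f g : Hall) {P : StalkMod} (hP : P.Good) :
    hallMul f g P.cl = hallSum f g P := by
  change hallSum f g _ = _
  obtain ⟨φ⟩ := ((good_st _).cl_eq_iff hP).1 ((cl_st _).trans (cls_out P.cl))
  exact hallSum_congr f g φ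

theorem hall_ext {f g : Hall} (h : ∀ P : StalkMod, P.Good → f P.cl = g P.cl) : f = g :=
  Finsupp.ext fun c => by
    obtain ⟨P, hP, rfl⟩ := exists_good c
    exact h P hP

/-- The Hall product, as a bilinear map. -/
noncomputable def hallStar : Hall →ₗ[ℂ] Hall →ₗ[ℂ] Hall :=
  LinearMap.mk₂ ℂ hallMul
    (fun f f' g => hall_ext fun P hP => by
      rw [Finsupp.add_apply, hallMul_cl _ _ hP, hallMul_cl _ _ hP, hallMul_cl _ _ hP, hallSum,
        hallSum, hallSum, ← finsum_add_distrib (hallSum_finite f g hP) (hallSum_finite f' g hP)]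
      exact finsum_congr fun S => by rw [Finsupp.add_apply, add_mul])
    (fun r f g => hall_ext fun P hP => by
      rw [Finsupp.smul_apply, hallMul_cl _ _ hP, hallMul_cl _ _ hP, hallSum, hallSum, smul_finsum]
      exact finsum_congr fun S => by rw [Finsupp.smul_apply, smul_mul_assoc])
    (fun f g g' => hall_ext fun P hP => by
      rw [Finsupp.add_apply, hallMul_cl _ _ hP, hallMul_cl _ _ hP, hallMul_cl _ _ hP, hallSum,
        hallSum, hallSum, ← finsum_add_distrib (hallSum_finite f g hP) (hallSum_finite f g' hP)]
      exact finsum_congr fun S => by rw [Finsupp.add_apply, mul_add])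
    (fun r f g => hall_ext fun P hP => by
      rw [Finsupp.smul_apply, hallMul_cl _ _ hP, hallMul_cl _ _ hP, hallSum, hallSum, smul_finsum]
      exact finsum_congr fun S => by rw [Finsupp.smul_apply, mul_smul_comm])

theorem hallStar_cl (f g : Hall) {P : StalkMod} (hP : P.Good) :
    hallStar f g P.cl = ∑ᶠ S : P.CSub, f S.1.quot.cl * g S.1.obj.cl := hallMul_cl f g hP

theorem hallStar_cls (f g : Hall) (F : CohN) :
    {N : F.Sub | f N.quot.cls * g N.obj.cls ≠ 0}.Finite ∧
      hallStar f g F.cls = ∑ᶠ N : F.Sub, f N.quot.cls * g N.obj.cls := by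
  have key : ∀ N : F.Sub, f N.quot.cls * g N.obj.cls =
      f (F.subEquiv N).1.quot.cl * g (F.subEquiv N).1.obj.cl := fun N => by
    rw [cl_eq_cls (CohN.quotSt N), cl_eq_cls (CohN.objSt N)]
  constructor
  · simp only [key]
    exact (hallSum_finite f g (good_st F)).preimage F.subEquiv.injective.injOn
  · rw [← cl_st, hallStar_cl f g (good_st F), ← finsum_comp_equiv F.subEquiv]
    exact finsum_congr fun N => (key N).symm

theorem finsum_subtype_eq_ite {α : Type*} (p : α → Prop) [DecidablePred p] (f : α → ℂ) :
    ∑ᶠ a : {a // p a}, f a.1 = ∑ᶠ a, if p a then f a else 0 := by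
  have := finsum_set_coe_eq_finsum_mem (f := f) {a | p a}
  refine this.trans ?_
  rw [finsum_mem_def]
  exact finsum_congr fun a => by
    by_cases h : p a
    · rw [if_pos h, Set.indicator_of_mem (show a ∈ {a | p a} from h)]
    · rw [if_neg h, Set.indicator_of_notMem (show a ∉ {a | p a} from h)]

open scoped Classical in
/-- The contribution of a flag to a triple product. -/
noncomputable def flagTerm (f g h : Hall) (P : StalkMod) (p : P.CSub × P.CSub) : ℂ :=
  if p.1.1 ≤ p.2.1 then
    f p.2.1.quot.cl * g (p.1.1.inner p.2.1).quot.cl * h p.1.1.obj.cl else 0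

/-- The support of `f` leaves finitely many larger terms `T`; inside each of them the support of `g`
leaves finitely many `S`. -/
theorem flagTerm_finite (f g h : Hall) {P : StalkMod} (hP : P.Good) :
    (Function.support (flagTerm f g h P)).Finite := by
  classical
  have hfin : (⋃ T ∈ {T : P.CSub | f T.1.quot.cl ≠ 0},
      (fun S : T.1.obj.CSub => ((csubObj T S).1, T)) ''
        {S : T.1.obj.CSub | g S.1.quot.cl ≠ 0}).Finite :=
    (Good.finite_apply_quot hP f).biUnion fun T _ =>
      (Good.finite_apply_quot (hP.obj T) g).image _
  refine hfin.subset ?_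
  rintro ⟨S, T⟩ hST
  rw [Function.mem_support, flagTerm] at hST
  have hle : S.1 ≤ T.1 := by
    by_contra hle
    exact hST (if_neg hle)
  rw [if_pos hle] at hST
  refine Set.mem_biUnion (left_ne_zero_of_mul (left_ne_zero_of_mul hST))
    ⟨(csubObj T).symm ⟨S, hle⟩, right_ne_zero_of_mul (left_ne_zero_of_mul hST), ?_⟩
  exact congrArg (fun z => (z.1, T)) ((csubObj T).apply_symm_apply ⟨S, hle⟩)

/-- Both bracketings sum over flags `S ≤ T`, weighting the quotients `P/T`, `T/S` and the subsystem
`S`: one fixes `S` and varies `T` through the subsystems of `P/S`, the other fixes `T` and varies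
`S` inside it. Finite support allows the exchange of the sums. -/
theorem hallStar_assoc (f g h : Hall) :
    hallStar (hallStar f g) h = hallStar f (hallStar g h) := by
  classical
  refine hall_ext fun P hP => ?_
  rw [hallStar_cl _ _ hP, hallStar_cl _ _ hP]
  have hl : ∀ S : P.CSub, hallStar f g S.1.quot.cl * h S.1.obj.cl =
      ∑ᶠ T, flagTerm f g h P (S, T) := by
    intro S
    rw [hallStar_cl _ _ (hP.quot S), finsum_mul, ← finsum_comp_equiv (csubQuot S).symm]
    refine Eq.trans ?_ (finsum_subtype_eq_ite (fun T : P.CSub => S.1 ≤ T.1) fun T =>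
        f T.1.quot.cl * g (S.1.inner T.1).quot.cl * h S.1.obj.cl)
    exact finsum_congr fun T => by rw [cl_quot_csubQuot, cl_obj_csubQuot]
  have hr : ∀ T : P.CSub, f T.1.quot.cl * hallStar g h T.1.obj.cl =
      ∑ᶠ S, flagTerm f g h P (S, T) := by
    intro T
    rw [hallStar_cl _ _ (hP.obj T), mul_finsum, ← finsum_comp_equiv (csubObj T).symm]
    refine Eq.trans ?_ (finsum_subtype_eq_ite (fun S : P.CSub => S.1 ≤ T.1) fun S =>
        f T.1.quot.cl * g (S.1.inner T.1).quot.cl * h S.1.obj.cl)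
    refine finsum_congr fun S => ?_
    rw [cl_obj_csubObj, mul_assoc]
    rfl
  rw [finsum_congr hl, finsum_congr hr, ← finsum_curry _ (flagTerm_finite f g h hP),
    ← finsum_curry (fun p : P.CSub × P.CSub => flagTerm f g h P (p.2, p.1))
      ((flagTerm_finite f g h hP).preimage (Prod.swap_injective.injOn)),
    ← finsum_comp_equiv (Equiv.prodComm P.CSub P.CSub)]
  rfl

/-- The unit of the Hall algebra. -/
noncomputable def hallOne : Hall := delta zeroSheaf.cls

open scoped Classical in
theorem hallOne_apply {P : StalkMod} (hP : P.Good) :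
    hallOne P.cl = if P.IsZero then 1 else 0 := by
  rw [hallOne, delta, Finsupp.single_apply, ← hP.cl_eq_zero_iff]
  simp only [eq_comm]

theorem hallOne_star (f : Hall) : hallStar hallOne f = f := by
  classical
  refine hall_ext fun P hP => ?_
  rw [hallStar_cl _ _ hP, finsum_eq_single _ (CSub.top hP.fin)]
  · rw [hallOne_apply (hP.quot _), CSub.top_val, if_pos ((Sub.top P).quot_isZero_iff.2 rfl), one_mul]
    rw [cl_congr (Sub.topObj P)]
  · intro S hS
    rw [hallOne_apply (hP.quot _), if_neg fun h => hS (Subtype.ext (S.1.quot_isZero_iff.1 h)),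
      zero_mul]

theorem hallStar_one (f : Hall) : hallStar f hallOne = f := by
  classical
  refine hall_ext fun P hP => ?_
  rw [hallStar_cl _ _ hP, finsum_eq_single _ (CSub.bot P)]
  · rw [hallOne_apply (hP.obj _), CSub.bot_val, if_pos ((Sub.bot P).obj_isZero_iff.2 rfl), mul_one]
    rw [cl_congr (Sub.botQuot P)]
  · intro S hS
    rw [hallOne_apply (hP.obj _), if_neg fun h => hS (Subtype.ext (S.1.obj_isZero_iff.1 h)),
      mul_zero]

/-- The zero sheaf has only one subsystem. This makes the counit multiplicative. -/
theorem hallStar_apply_zero (f g : Hall) :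
    hallStar f g zeroSheaf.cls = f zeroSheaf.cls * g zeroSheaf.cls := by
  have hz : ∀ S : zeroSheaf.st.Sub, S = Sub.bot _ := fun S => by
    rw [← S.obj_isZero_iff]
    exact fun x m => Subtype.ext (isZero_zeroSheaf x m.1)
  rw [← cl_st zeroSheaf, hallStar_cl _ _ (good_st _), finsum_eq_single _ (CSub.bot _)]
  · rw [CSub.bot_val, ← cl_congr (Sub.botQuot zeroSheaf.st)]
    congr 2
    exact cl_congr (((Sub.bot zeroSheaf.st).obj_isZero_iff.2 rfl).iso isZero_zeroSheaf)
  · exact fun S hS => absurd (Subtype.ext (hz S.1)) hS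

/-! ### The coproduct -/

theorem add_cl_aux {P P' Q Q' : StalkMod} (hP : P.Good) (hP' : P'.Good) (hQ : Q.Good)
    (hQ' : Q'.Good) (h : P.cl = P'.cl) (h' : Q.cl = Q'.cl) : (P.sum Q).cl = (P'.sum Q').cl := by
  obtain ⟨φ⟩ := (hP.cl_eq_iff hP').1 h
  obtain ⟨ψ⟩ := (hQ.cl_eq_iff hQ').1 h'
  exact cl_congr (sumCongr φ ψ)

/-- The sum uses chosen representatives; `cl_sum` shows independence of the choice. -/
noncomputable instance : Add IsoCl :=
  ⟨fun a b => ((Quotient.out a : CohN).st.sum (Quotient.out b : CohN).st).cl⟩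

noncomputable instance : Zero IsoCl := ⟨zeroSheaf.cls⟩

theorem cl_sum {P Q : StalkMod} (hP : P.Good) (hQ : Q.Good) :
    (P.sum Q).cl = P.cl + Q.cl :=
  add_cl_aux hP (good_st _) hQ (good_st _) ((cls_out _).symm.trans (cl_st _).symm)
    ((cls_out _).symm.trans (cl_st _).symm)

theorem cls_sum (F G : CohN) : (F.sum G).cls = F.cls + G.cls := by
  rw [← cl_st F, ← cl_st G, ← cl_sum (good_st F) (good_st G)]
  exact (cl_eq_cls (F.sumSt G)).symm

/-- Isomorphism classes form a commutative monoid under direct sum. -/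
noncomputable instance : AddCommMonoid IsoCl where
  add_comm a b := by
    obtain ⟨P, hP, rfl⟩ := exists_good a
    obtain ⟨Q, hQ, rfl⟩ := exists_good b
    rw [← cl_sum hP hQ, ← cl_sum hQ hP]
    exact cl_congr (sumComm P Q)
  add_assoc a b c := by
    obtain ⟨P, hP, rfl⟩ := exists_good a
    obtain ⟨Q, hQ, rfl⟩ := exists_good b
    obtain ⟨R, hR, rfl⟩ := exists_good c
    rw [← cl_sum hP hQ, ← cl_sum (hP.sum hQ) hR, ← cl_sum hQ hR, ← cl_sum hP (hQ.sum hR)]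
    exact cl_congr (sumAssoc P Q R)
  add_zero a := by
    obtain ⟨P, hP, rfl⟩ := exists_good a
    change P.cl + zeroSheaf.cls = _
    rw [← cl_st zeroSheaf, ← cl_sum hP (good_st _)]
    exact cl_congr (sumZero isZero_zeroSheaf)
  zero_add a := by
    obtain ⟨P, hP, rfl⟩ := exists_good a
    change zeroSheaf.cls + P.cl = _
    rw [← cl_st zeroSheaf, ← cl_sum (good_st _) hP]
    exact cl_congr ((sumComm _ _).trans (sumZero isZero_zeroSheaf))
  nsmul := nsmulRec

theorem zero_eq_cls : (0 : IsoCl) = zeroSheaf.cls := rfl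

theorem add_eq_zero_iff_cls {a b : IsoCl} : a + b = 0 ↔ a = 0 ∧ b = 0 := by
  obtain ⟨P, hP, rfl⟩ := exists_good a
  obtain ⟨Q, hQ, rfl⟩ := exists_good b
  rw [← cl_sum hP hQ, zero_eq_cls, (hP.sum hQ).cl_eq_zero_iff, hP.cl_eq_zero_iff,
    hQ.cl_eq_zero_iff, sum_isZero_iff]

theorem K0cls_add (a b : IsoCl) : K0cls (a + b) = K0cls a + K0cls b := by
  obtain ⟨P, hP, rfl⟩ := exists_good a
  obtain ⟨Q, hQ, rfl⟩ := exists_good b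
  rw [← cl_sum hP hQ, hP.K0cls_sum hQ]

/-- Needed for `f (a + b)` to have finite support as a function of the pair. -/
theorem finite_antidiagonal (c : IsoCl) : {p : IsoCl × IsoCl | p.1 + p.2 = c}.Finite := by
  refine (finite_decompositions c).subset ?_
  rintro ⟨a, b⟩ h
  obtain ⟨P, hP, rfl⟩ := exists_good a
  obtain ⟨Q, hQ, rfl⟩ := exists_good b
  exact ⟨P, Q, hP, hQ, rfl, rfl, (cl_sum hP hQ).trans h⟩

/-- Elements of the tensor square as functions on pairs. -/
noncomputable abbrev tensorFun : Hall ⊗[ℂ] Hall ≃ₗ[ℂ] (IsoCl × IsoCl →₀ ℂ) :=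
  finsuppTensorFinsupp' ℂ IsoCl IsoCl

/-- The function `(a, b) ↦ f (a + b)`. -/
noncomputable def comulFun : Hall →ₗ[ℂ] (IsoCl × IsoCl →₀ ℂ) where
  toFun f := Finsupp.ofSupportFinite (fun p => f (p.1 + p.2)) (by
    refine (f.support.finite_toSet.biUnion fun c _ => finite_antidiagonal c).subset fun p hp => ?_
    exact Set.mem_biUnion (Finsupp.mem_support_iff.2 hp) rfl)
  map_add' _ _ := Finsupp.ext fun _ => rfl
  map_smul' _ _ := Finsupp.ext fun _ => rfl

/-- The coproduct. -/
noncomputable def hallComul : Hall →ₗ[ℂ] Hall ⊗[ℂ] Hall := tensorFun.symm.toLinearMap ∘ₗ comulFun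

theorem tensorFun_comul (f : Hall) (a b : IsoCl) :
    tensorFun (hallComul f) (a, b) = f (a + b) := by
  change tensorFun (tensorFun.symm (comulFun f)) (a, b) = _
  rw [LinearEquiv.apply_symm_apply]
  rfl

theorem tensor_ext {w w' : Hall ⊗[ℂ] Hall}
    (h : ∀ a b, tensorFun w (a, b) = tensorFun w' (a, b)) : w = w' :=
  tensorFun.injective (Finsupp.ext fun p => h p.1 p.2)

/-- Elements of the tensor cube as functions on triples. -/
noncomputable def tensorFun₃ : Hall ⊗[ℂ] (Hall ⊗[ℂ] Hall) ≃ₗ[ℂ]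
    (IsoCl × (IsoCl × IsoCl) →₀ ℂ) :=
  (TensorProduct.congr (LinearEquiv.refl ℂ Hall) tensorFun).trans
    (finsuppTensorFinsupp' ℂ IsoCl (IsoCl × IsoCl))

theorem tensorFun₃_tmul (f : Hall) (w : Hall ⊗[ℂ] Hall) (a b c : IsoCl) :
    tensorFun₃ (f ⊗ₜ w) (a, (b, c)) = f a * tensorFun w (b, c) :=
  finsuppTensorFinsupp'_apply_apply _ _ _ _ _ _ _

theorem tensorFun₃_lTensor (w : Hall ⊗[ℂ] Hall) (a b c : IsoCl) :
    tensorFun₃ (hallComul.lTensor Hall w) (a, (b, c)) = tensorFun w (a, b + c) := by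
  induction w with
  | zero => simp
  | add w w' hw hw' => simp only [map_add, Finsupp.add_apply, hw, hw']
  | tmul f g =>
    rw [LinearMap.lTensor_tmul, tensorFun₃_tmul, tensorFun_comul,
      finsuppTensorFinsupp'_apply_apply]

theorem tensorFun₃_assoc (w : Hall ⊗[ℂ] Hall) (g : Hall) (a b c : IsoCl) :
    tensorFun₃ (TensorProduct.assoc ℂ Hall Hall Hall (w ⊗ₜ g)) (a, (b, c)) =
      tensorFun w (a, b) * g c := by
  induction w with
  | zero => simp
  | add w w' hw hw' => simp only [TensorProduct.add_tmul, map_add, Finsupp.add_apply, hw, hw',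
      add_mul]
  | tmul f g =>
    rw [TensorProduct.assoc_tmul, tensorFun₃_tmul, finsuppTensorFinsupp'_apply_apply,
      finsuppTensorFinsupp'_apply_apply, mul_assoc]

theorem tensorFun₃_rTensor (w : Hall ⊗[ℂ] Hall) (a b c : IsoCl) :
    tensorFun₃ (TensorProduct.assoc ℂ Hall Hall Hall (hallComul.rTensor Hall w)) (a, (b, c)) =
      tensorFun w (a + b, c) := by
  induction w with
  | zero => simp
  | add w w' hw hw' => simp only [map_add, Finsupp.add_apply, hw, hw']
  | tmul f g =>
    rw [LinearMap.rTensor_tmul, tensorFun₃_assoc, tensorFun_comul,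
      finsuppTensorFinsupp'_apply_apply]

/-- Evaluated at a triple, both sides are the value of `f` at a threefold sum, so the identity is
associativity of the direct sum. -/
theorem hallComul_coassoc :
    (TensorProduct.assoc ℂ Hall Hall Hall).toLinearMap ∘ₗ hallComul.rTensor Hall ∘ₗ hallComul =
      hallComul.lTensor Hall ∘ₗ hallComul := by
  refine LinearMap.ext fun f => tensorFun₃.injective (Finsupp.ext ?_)
  rintro ⟨a, b, c⟩
  change tensorFun₃ (TensorProduct.assoc ℂ Hall Hall Hall (hallComul.rTensor Hall _)) _ =
    tensorFun₃ (hallComul.lTensor Hall _) _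
  rw [tensorFun₃_rTensor, tensorFun₃_lTensor, tensorFun_comul, tensorFun_comul, add_assoc]

theorem tensorFun_comm (w : Hall ⊗[ℂ] Hall) (a b : IsoCl) :
    tensorFun (TensorProduct.comm ℂ Hall Hall w) (a, b) = tensorFun w (b, a) := by
  induction w with
  | zero => simp
  | add w w' hw hw' => simp only [map_add, Finsupp.add_apply, hw, hw']
  | tmul f g =>
    rw [TensorProduct.comm_tmul, finsuppTensorFinsupp'_apply_apply,
      finsuppTensorFinsupp'_apply_apply, mul_comm]

theorem hallComul_comm (f : Hall) :
    TensorProduct.comm ℂ Hall Hall (hallComul f) = hallComul f :=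
  tensor_ext fun a b => by rw [tensorFun_comm, tensorFun_comul, tensorFun_comul, add_comm]

theorem hallComul_one : hallComul hallOne = hallOne ⊗ₜ hallOne := by
  classical
  refine tensor_ext fun a b => ?_
  rw [tensorFun_comul, finsuppTensorFinsupp'_apply_apply]
  simp only [hallOne, delta, Finsupp.single_apply, ← zero_eq_cls]
  rw [eq_comm, eq_comm (a := (0 : IsoCl)), eq_comm (a := (0 : IsoCl)), eq_comm (a := (0 : IsoCl))]
  simp only [add_eq_zero_iff_cls]
  by_cases ha : a = 0 <;> by_cases hb : b = 0 <;> simp [ha, hb]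

/-- The counit. -/
noncomputable def hallCounit : Hall →ₗ[ℂ] ℂ := Finsupp.lapply zeroSheaf.cls

theorem lid_rTensor_counit (w : Hall ⊗[ℂ] Hall) (a : IsoCl) :
    TensorProduct.lid ℂ Hall (hallCounit.rTensor Hall w) a = tensorFun w (0, a) := by
  induction w with
  | zero => simp
  | add w w' hw hw' => simp only [map_add, Finsupp.add_apply, hw, hw']
  | tmul f g =>
    rw [LinearMap.rTensor_tmul, TensorProduct.lid_tmul, finsuppTensorFinsupp'_apply_apply]
    rfl

theorem rid_lTensor_counit (w : Hall ⊗[ℂ] Hall) (a : IsoCl) :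
    TensorProduct.rid ℂ Hall (hallCounit.lTensor Hall w) a = tensorFun w (a, 0) := by
  induction w with
  | zero => simp
  | add w w' hw hw' => simp only [map_add, Finsupp.add_apply, hw, hw']
  | tmul f g =>
    rw [LinearMap.lTensor_tmul, TensorProduct.rid_tmul, finsuppTensorFinsupp'_apply_apply,
      mul_comm]
    rfl

theorem rTensor_counit_comul :
    hallCounit.rTensor Hall ∘ₗ hallComul = TensorProduct.mk ℂ _ _ 1 := by
  refine LinearMap.ext fun f => (TensorProduct.lid ℂ Hall).injective (Finsupp.ext fun a => ?_)
  refine (lid_rTensor_counit _ a).trans ?_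
  rw [tensorFun_comul, zero_add, TensorProduct.mk_apply, TensorProduct.lid_tmul, one_smul]

theorem lTensor_counit_comul :
    hallCounit.lTensor Hall ∘ₗ hallComul = (TensorProduct.mk ℂ _ _).flip 1 := by
  refine LinearMap.ext fun f => (TensorProduct.rid ℂ Hall).injective (Finsupp.ext fun a => ?_)
  refine (rid_lTensor_counit _ a).trans ?_
  rw [tensorFun_comul, add_zero, LinearMap.flip_apply, TensorProduct.mk_apply,
    TensorProduct.rid_tmul, one_smul]

/-! ### Compatibility of product and coproduct -/

theorem finite_tensorFun (w w' : Hall ⊗[ℂ] Hall) {P Q : StalkMod} (hP : P.Good) (hQ : Q.Good) :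
    Function.HasFiniteSupport fun S : P.CSub × Q.CSub =>
      tensorFun w (S.1.1.quot.cl, S.2.1.quot.cl) * tensorFun w' (S.1.1.obj.cl, S.2.1.obj.cl) := by
  refine ((tensorFun w).support.finite_toSet.biUnion fun p _ =>
    (hP.finite_quot p.1).prod (hQ.finite_quot p.2)).subset fun S hS => ?_
  exact Set.mem_biUnion (Finsupp.mem_support_iff.2 (left_ne_zero_of_mul hS)) ⟨rfl, rfl⟩

/-- Expresses the componentwise product as one sum over pairs of subsystems, the form in which it is
compared with the sum over subsystems of `P.sum Q`. -/
theorem tensorFun_map₂ (w w' : Hall ⊗[ℂ] Hall) {P Q : StalkMod} (hP : P.Good) (hQ : Q.Good) :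
    tensorFun (TensorProduct.map₂ hallStar hallStar w w') (P.cl, Q.cl) =
      ∑ᶠ S : P.CSub × Q.CSub, tensorFun w (S.1.1.quot.cl, S.2.1.quot.cl) *
        tensorFun w' (S.1.1.obj.cl, S.2.1.obj.cl) := by
  induction w with
  | zero => simp
  | add w₁ w₂ h₁ h₂ =>
    simp only [map_add, LinearMap.add_apply, Finsupp.add_apply, add_mul, h₁, h₂]
    exact (finsum_add_distrib (finite_tensorFun w₁ w' hP hQ) (finite_tensorFun w₂ w' hP hQ)).symm
  | tmul f g =>
    induction w' with
    | zero => simp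
    | add w₁ w₂ h₁ h₂ =>
      simp only [map_add, Finsupp.add_apply, mul_add, h₁, h₂]
      exact (finsum_add_distrib (finite_tensorFun _ w₁ hP hQ)
        (finite_tensorFun _ w₂ hP hQ)).symm
    | tmul f' g' =>
      rw [finsum_curry _ (finite_tensorFun _ _ hP hQ)]
      rw [TensorProduct.map₂_apply_tmul, TensorProduct.map_tmul,
        finsuppTensorFinsupp'_apply_apply, hallStar_cl _ _ hP, hallStar_cl _ _ hQ, finsum_mul]
      refine finsum_congr fun S => ?_
      rw [mul_finsum]
      refine finsum_congr fun T => ?_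
      rw [finsuppTensorFinsupp'_apply_apply, finsuppTensorFinsupp'_apply_apply]
      ring

/-- Subsystems of `P ⊕ Q` are the sums `S ⊕ T`, and their quotients are the sums of the quotients,
so the two sums agree term by term under `csubSum`. -/
theorem hallComul_star (f g : Hall) :
    hallComul (hallStar f g) =
      TensorProduct.map₂ hallStar hallStar (hallComul f) (hallComul g) := by
  refine tensor_ext fun a b => ?_
  obtain ⟨P, hP, rfl⟩ := exists_good a
  obtain ⟨Q, hQ, rfl⟩ := exists_good b
  rw [tensorFun_comul, tensorFun_map₂ _ _ hP hQ, ← cl_sum hP hQ, hallStar_cl _ _ (hP.sum hQ),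
    ← finsum_comp_equiv (csubSum P Q)]
  refine finsum_congr fun S => ?_
  rw [tensorFun_comul, tensorFun_comul, ← cl_sum (hP.quot S.1) (hQ.quot S.2),
    ← cl_sum (hP.obj S.1) (hQ.obj S.2), ← cl_congr (Sub.prodQuot S.1.1 S.2.1),
    ← cl_congr (Sub.prodObj S.1.1 S.2.1)]
  rfl

end HallP1

namespace HallP1

open TopologicalSpace StalkMod

/-! ### The Hall bialgebra -/

/-- The Hall algebra, as a ring. -/
def HallAlg : Type 1 := Hall

/-- Only the linear structure is carried over; product and coproduct on `HallAlg` are the Hall ones.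
-/
noncomputable instance : AddCommGroup HallAlg := inferInstanceAs (AddCommGroup Hall)

noncomputable instance : Module ℂ HallAlg := inferInstanceAs (Module ℂ Hall)

/-- The identification of the Hall algebra with the space of functions. -/
noncomputable def toAlg : Hall ≃ₗ[ℂ] HallAlg := LinearEquiv.refl ℂ Hall

noncomputable instance : Ring HallAlg :=
  { (inferInstance : AddCommGroup HallAlg) with
    mul := fun f g => toAlg (hallStar (toAlg.symm f) (toAlg.symm g))
    one := toAlg hallOne
    mul_assoc := hallStar_assoc
    one_mul := hallOne_star
    mul_one := hallStar_one
    left_distrib := fun f g h => map_add (hallStar f) g h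
    right_distrib := fun f g h => LinearMap.map_add₂ hallStar f g h
    zero_mul := fun f => LinearMap.map_zero₂ hallStar f
    mul_zero := fun f => map_zero (hallStar f) }

noncomputable instance : Algebra ℂ HallAlg :=
  Algebra.ofModule (fun r f g => LinearMap.map_smul₂ hallStar r f g)
    (fun r f g => map_smul (hallStar f) r g)

theorem toAlg_star (f g : Hall) : toAlg (hallStar f g) = toAlg f * toAlg g := rfl

theorem toAlg_one : toAlg hallOne = 1 := rfl

noncomputable instance : Coalgebra ℂ HallAlg where
  comul := hallComul
  counit := hallCounit
  coassoc := hallComul_coassoc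
  rTensor_counit_comp_comul := rTensor_counit_comul
  lTensor_counit_comp_comul := lTensor_counit_comul

theorem map_toAlg (w : Hall ⊗[ℂ] Hall) :
    TensorProduct.map toAlg.toLinearMap toAlg.toLinearMap w = (w : HallAlg ⊗[ℂ] HallAlg) :=
  LinearMap.congr_fun (TensorProduct.map_id (R := ℂ) (M := Hall) (N := Hall)) w

theorem comul_toAlg (f : Hall) : Coalgebra.comul (R := ℂ) (toAlg f) =
    TensorProduct.map toAlg.toLinearMap toAlg.toLinearMap (hallComul f) := (map_toAlg _).symm

theorem counit_toAlg (f : Hall) : Coalgebra.counit (R := ℂ) (toAlg f) = f zeroSheaf.cls := rfl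

theorem map_toAlg_mul (w w' : Hall ⊗[ℂ] Hall) :
    TensorProduct.map toAlg.toLinearMap toAlg.toLinearMap
        (TensorProduct.map₂ hallStar hallStar w w') =
      TensorProduct.map toAlg.toLinearMap toAlg.toLinearMap w *
        TensorProduct.map toAlg.toLinearMap toAlg.toLinearMap w' := by
  induction w with
  | zero => simp
  | add w₁ w₂ h₁ h₂ => simp only [map_add, LinearMap.add_apply, add_mul, h₁, h₂]
  | tmul f g =>
    induction w' with
    | zero => simp
    | add w₁ w₂ h₁ h₂ => simp only [map_add, mul_add, h₁, h₂]
    | tmul f' g' =>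
      rw [TensorProduct.map₂_apply_tmul, TensorProduct.map_tmul, TensorProduct.map_tmul,
        TensorProduct.map_tmul, TensorProduct.map_tmul, Algebra.TensorProduct.tmul_mul_tmul]
      rfl

noncomputable instance : Bialgebra ℂ HallAlg :=
  Bialgebra.mk' ℂ HallAlg
    (by
      rw [← toAlg_one, counit_toAlg]
      exact Finsupp.single_eq_same)
    (fun {a b} => by
      obtain ⟨f, rfl⟩ := toAlg.surjective a
      obtain ⟨g, rfl⟩ := toAlg.surjective b
      rw [← toAlg_star, counit_toAlg, counit_toAlg, counit_toAlg, hallStar_apply_zero])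
    (by
      rw [← toAlg_one, comul_toAlg, hallComul_one, TensorProduct.map_tmul]
      rfl)
    (fun {a b} => by
      obtain ⟨f, rfl⟩ := toAlg.surjective a
      obtain ⟨g, rfl⟩ := toAlg.surjective b
      rw [← toAlg_star, comul_toAlg, comul_toAlg, comul_toAlg, hallComul_star, map_toAlg_mul])

instance : Coalgebra.IsCocomm ℂ HallAlg where
  comm_comp_comul := LinearMap.ext hallComul_comm

/-! ### The grading -/

/-- The degree of an isomorphism class. -/
noncomputable def degK (c : IsoCl) : K0plus := ⟨K0cls c, AddSubmonoid.subset_closure ⟨c, rfl⟩⟩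

theorem degK_add (a b : IsoCl) : degK (a + b) = degK a + degK b := Subtype.ext (K0cls_add a b)

theorem degK_zero : degK 0 = 0 := Subtype.ext (K0cls_eq_zero_iff.2 rfl)

theorem delta_mem_grade (c : IsoCl) : delta c ∈ Hall.grade (degK c) :=
  Submodule.subset_span ⟨c, rfl, rfl⟩

/-- Describes homogeneity by supports, which can be checked pointwise on products. -/
theorem mem_grade_iff {γ : K0plus} {f : Hall} :
    f ∈ Hall.grade γ ↔ ∀ c, f c ≠ 0 → degK c = γ := by
  classical
  constructor
  · intro h c
    induction h using Submodule.span_induction with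
    | mem f hf =>
      obtain ⟨c', h, rfl⟩ := hf
      intro hc
      obtain rfl : c' = c := by
        by_contra hne
        exact hc (Finsupp.single_eq_of_ne (Ne.symm hne))
      exact Subtype.ext h
    | zero => exact fun h => absurd rfl h
    | add f g _ _ hf hg =>
      intro h
      by_cases h0 : f c = 0
      · exact hg fun h1 => h (by rw [Finsupp.add_apply, h0, h1, add_zero])
      · exact hf h0
    | smul r f _ hf => exact fun h => hf fun h0 => h (by rw [Finsupp.smul_apply, h0, smul_zero])
  · intro h
    rw [← f.sum_single]
    refine Submodule.sum_mem _ fun c hc => ?_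
    have e : Finsupp.single c (f c) = f c • delta c := by
      rw [delta, Finsupp.smul_single, smul_eq_mul, mul_one]
    rw [e]
    refine Submodule.smul_mem _ _ ?_
    rw [← h c (Finsupp.mem_support_iff.1 hc)]
    exact delta_mem_grade c

theorem hallStar_mem_grade {α β : K0plus} {f g : Hall} (hf : f ∈ Hall.grade α)
    (hg : g ∈ Hall.grade β) : hallStar f g ∈ Hall.grade (α + β) := by
  rw [mem_grade_iff] at *
  intro c hc
  obtain ⟨P, hP, rfl⟩ := exists_good c
  rw [hallStar_cl _ _ hP] at hc
  obtain ⟨S, hS⟩ : ∃ S : P.CSub, f S.1.quot.cl * g S.1.obj.cl ≠ 0 := by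
    by_contra h
    push Not at h
    exact hc (by rw [finsum_congr h, finsum_zero])
  rw [← hf _ (left_ne_zero_of_mul hS), ← hg _ (right_ne_zero_of_mul hS)]
  exact Subtype.ext (hP.K0cls_eq S)

/-- The coproduct expands into finitely many multiples of `delta a ⊗ delta b` with `f (a + b)`
nonzero, and `degK` is additive on direct sums. -/
theorem hallComul_mem_grade {γ : K0plus} {f : Hall} (hf : f ∈ Hall.grade γ) :
    hallComul f ∈ ⨆ (α : K0plus) (β : K0plus) (_ : α + β = γ), LinearMap.range
      (TensorProduct.map (Hall.grade α).subtype (Hall.grade β).subtype) := by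
  rw [mem_grade_iff] at hf
  have e : hallComul f = (comulFun f).sum fun p r => tensorFun.symm (Finsupp.single p r) := by
    change tensorFun.symm (comulFun f) = _
    conv_lhs => rw [← (comulFun f).sum_single]
    rw [map_finsuppSum]
  rw [e]
  refine Submodule.sum_mem _ fun p hp => ?_
  have hp' : comulFun f p ≠ 0 := Finsupp.mem_support_iff.1 hp
  refine Submodule.mem_iSup_of_mem (degK p.1) (Submodule.mem_iSup_of_mem (degK p.2)
    (Submodule.mem_iSup_of_mem ((degK_add _ _).symm.trans (hf _ hp')) ?_))
  change (finsuppTensorFinsupp' ℂ IsoCl IsoCl).symm (Finsupp.single p (comulFun f p)) ∈ _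
  rw [finsuppTensorFinsupp'_symm_single_eq_tmul_single_one]
  have e1 : Finsupp.single p.1 (comulFun f p) = comulFun f p • delta p.1 := by
    rw [delta, Finsupp.smul_single, smul_eq_mul, mul_one]
  rw [e1]
  exact ⟨⟨_, Submodule.smul_mem _ _ (delta_mem_grade p.1)⟩ ⊗ₜ ⟨_, delta_mem_grade p.2⟩, rfl⟩

/-- Connectedness is exactly the detection of the zero sheaf by its class in `K0`. -/
theorem grade_zero : Hall.grade 0 = Submodule.span ℂ {delta zeroSheaf.cls} := by
  rw [Hall.grade]
  congr 1
  refine Set.ext fun f => ⟨?_, ?_⟩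
  · rintro ⟨c, hc, rfl⟩
    rw [K0cls_eq_zero_iff.1 hc]
    exact Set.mem_singleton _
  · rintro rfl
    exact ⟨_, K0cls_eq_zero_iff.2 rfl, rfl⟩

/-- The homogeneous components of the Hall algebra. -/
noncomputable abbrev algGrade (γ : K0plus) : Submodule ℂ HallAlg :=
  (Hall.grade γ).map toAlg.toLinearMap

theorem toAlg_mem_algGrade {γ : K0plus} {f : Hall} :
    toAlg f ∈ algGrade γ ↔ f ∈ Hall.grade γ :=
  ⟨fun ⟨_, hg, e⟩ => toAlg.injective e ▸ hg, fun h => ⟨f, h, rfl⟩⟩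

instance : SetLike.GradedMonoid algGrade where
  one_mem := by
    rw [← toAlg_one, toAlg_mem_algGrade, ← degK_zero]
    exact delta_mem_grade 0
  mul_mem := by
    rintro α β _ _ ⟨f, hf, rfl⟩ ⟨g, hg, rfl⟩
    exact toAlg_mem_algGrade.2 (hallStar_mem_grade hf hg)

open scoped Classical DirectSum in
/-- The decomposition of a function into homogeneous components. -/
noncomputable def decomposeMap : HallAlg →ₗ[ℂ] ⨁ γ, algGrade γ :=
  (Finsupp.lsum ℂ fun c => LinearMap.toSpanSingleton ℂ (⨁ γ, algGrade γ)
    (DirectSum.lof ℂ K0plus (fun γ => algGrade γ) (degK c)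
      ⟨toAlg (delta c), toAlg_mem_algGrade.2 (delta_mem_grade c)⟩)) ∘ₗ toAlg.symm.toLinearMap

open scoped Classical in
theorem decomposeMap_delta (c : IsoCl) : decomposeMap (toAlg (delta c)) =
    DirectSum.lof ℂ K0plus (fun γ => algGrade γ) (degK c)
      ⟨toAlg (delta c), toAlg_mem_algGrade.2 (delta_mem_grade c)⟩ := by
  change Finsupp.lsum ℂ _ (Finsupp.single c 1) = _
  rw [Finsupp.lsum_single, LinearMap.toSpanSingleton_apply, one_smul]

open scoped Classical in
theorem decomposeMap_of_mem {γ : K0plus} {f : Hall} (hf : f ∈ Hall.grade γ) :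
    decomposeMap (toAlg f) = DirectSum.lof ℂ K0plus (fun γ => algGrade γ) γ
      ⟨toAlg f, toAlg_mem_algGrade.2 hf⟩ := by
  have key : ∀ h : toAlg f ∈ algGrade γ, decomposeMap (toAlg f) =
      DirectSum.lof ℂ K0plus (fun γ => algGrade γ) γ ⟨toAlg f, h⟩ := by
    induction hf using Submodule.span_induction with
    | mem f hf =>
      obtain ⟨c, h, rfl⟩ := hf
      obtain rfl : degK c = γ := Subtype.ext h
      exact fun _ => decomposeMap_delta c
    | zero =>
      exact fun _ => (map_zero decomposeMap).trans
        (map_zero (DirectSum.lof ℂ K0plus (fun γ => algGrade γ) γ)).symm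
    | add f g hf hg h₁ h₂ =>
      intro _
      refine (map_add decomposeMap (toAlg f) (toAlg g)).trans ?_
      rw [h₁ (toAlg_mem_algGrade.2 hf), h₂ (toAlg_mem_algGrade.2 hg), ← map_add]
      rfl
    | smul r f hf h =>
      intro _
      refine (map_smul decomposeMap r (toAlg f)).trans ?_
      rw [h (toAlg_mem_algGrade.2 hf), ← map_smul]
      rfl
  exact key _

open scoped Classical in
/-- The grading of the Hall algebra by the effective cone. -/
@[reducible] noncomputable def hallGraded : GradedAlgebra algGrade :=
  { (inferInstance : SetLike.GradedMonoid algGrade) with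
    toDecomposition := DirectSum.Decomposition.ofLinearMap _ decomposeMap
      (by
        have h : (DirectSum.coeLinearMap algGrade ∘ₗ decomposeMap) ∘ₗ toAlg.toLinearMap =
            toAlg.toLinearMap := by
          refine Finsupp.lhom_ext' fun c => LinearMap.ext_ring ?_
          change DirectSum.coeLinearMap algGrade (decomposeMap (toAlg (delta c))) = toAlg (delta c)
          rw [decomposeMap_delta, DirectSum.coeLinearMap_lof]
        refine LinearMap.ext fun a => ?_
        obtain ⟨f, rfl⟩ := toAlg.surjective a
        exact LinearMap.congr_fun h f)
      (by
        refine DirectSum.linearMap_ext _ fun γ => LinearMap.ext ?_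
        rintro ⟨_, f, hf, rfl⟩
        change decomposeMap (DirectSum.coeLinearMap algGrade (DirectSum.lof ℂ K0plus
          (fun γ => algGrade γ) γ _)) = DirectSum.lof ℂ K0plus (fun γ => algGrade γ) γ _
        rw [DirectSum.coeLinearMap_lof]
        exact decomposeMap_of_mem hf) }

theorem counit_eq_zero {γ : K0plus} (hγ : γ ≠ 0) {f : Hall} (hf : f ∈ Hall.grade γ) :
    f zeroSheaf.cls = 0 := by
  by_contra h
  exact hγ ((mem_grade_iff.1 hf _ h).symm.trans degK_zero)

end HallP1

/-! ### The main theorem -/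

open scoped Classical in
theorem mainTheorem8 :
    ∃ (star : Hall →ₗ[ℂ] Hall →ₗ[ℂ] Hall) (Δ : Hall →ₗ[ℂ] Hall ⊗[ℂ] Hall),
      -- `(f ⋆ g)(F) = ∑_{F' ⊆ F} f(F / F') g(F')`, a finite sum
      (∀ (f g : Hall) (F : CohN),
        {N : F.Sub | f N.quot.cls * g N.obj.cls ≠ 0}.Finite ∧
        star f g F.cls = ∑ᶠ N : F.Sub, f N.quot.cls * g N.obj.cls) ∧
      -- `Δ(f)(F, F') = f(F ⊕ F')`
      (∀ (f : Hall) (F F' : CohN), evalTensor (Δ f) F.cls F'.cls = f (F.sum F').cls) ∧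
      -- `⋆` is associative
      (∀ f g h : Hall, star (star f g) h = star f (star g h)) ∧
      -- `Δ` is coassociative
      ((TensorProduct.assoc ℂ Hall Hall Hall).toLinearMap ∘ₗ Δ.rTensor Hall ∘ₗ Δ =
        Δ.lTensor Hall ∘ₗ Δ) ∧
      -- `Δ` is compatible with `⋆`
      (∀ f g : Hall, Δ (star f g) = TensorProduct.map₂ star star (Δ f) (Δ g)) ∧
      -- the Hall algebra is a graded, connected, cocommutative bialgebra
      ∃ (H : Type 1) (_ : Ring H) (_ : Bialgebra ℂ H) (e : Hall ≃ₗ[ℂ] H),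
        (∀ f g : Hall, e (star f g) = e f * e g) ∧
        e (delta zeroSheaf.cls) = 1 ∧
        (∀ f : Hall, Coalgebra.comul (R := ℂ) (e f) =
          TensorProduct.map e.toLinearMap e.toLinearMap (Δ f)) ∧
        (∀ f : Hall, Coalgebra.counit (R := ℂ) (e f) = f zeroSheaf.cls) ∧
        Coalgebra.IsCocomm ℂ H ∧
        Nonempty (GradedAlgebra fun γ : K0plus => (Hall.grade γ).map e.toLinearMap) ∧
        (∀ (γ : K0plus), ∀ f ∈ Hall.grade γ, Δ f ∈
          ⨆ (α : K0plus) (β : K0plus) (_ : α + β = γ), LinearMap.range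
            (TensorProduct.map (Hall.grade α).subtype (Hall.grade β).subtype)) ∧
        (∀ γ : K0plus, γ ≠ 0 → ∀ f ∈ Hall.grade γ, Coalgebra.counit (R := ℂ) (e f) = 0) ∧
        Hall.grade 0 = Submodule.span ℂ {delta zeroSheaf.cls} := by
  exact ⟨hallStar, hallComul, hallStar_cls,
    fun f F F' => (tensorFun_comul f F.cls F'.cls).trans (by rw [cls_sum]), hallStar_assoc,
    hallComul_coassoc, hallComul_star, HallAlg, inferInstance, inferInstance, toAlg, toAlg_star,
    toAlg_one, comul_toAlg, counit_toAlg, inferInstance, ⟨hallGraded⟩,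
    fun _ _ => hallComul_mem_grade,
    fun _ hγ f hf => (counit_toAlg f).trans (counit_eq_zero hγ hf), grade_zero⟩
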